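/- Let $n\ge 2$, let $\Omega\subset\mathbb R^n$ be open, and let $\Omega'\subset\subset\Omega$ (i.e. $\overline{\Omega'}$ is compact and contained in $\Omega$) be an open set with boundary $\Gamma=\partial\Omega'$ of class $C^2$ and outer unit normal $\nu$. Let $d_\Gamma(x)=-\operatorname{dist}(x,\Gamma)$ for $x\in\Omega'$ and $d_\Gamma(x)=\operatorname{dist}(x,\Gamma)$ for $x\notin\Omega'$ be the signed distance to $\Gamma$, and let $B_\varepsilon(\Gamma)=\{x\in\mathbb R^n:\operatorname{dist}(x,\Gamma)<\varepsilon\}$. Then there is $\varepsilon_0>0$, depending only on $n,\Omega,\Omega'$, such that for every $0<\varepsilon<\varepsilon_0$ one has $B_\varepsilon(\Gamma)\subset\subset\Omega$ and the following holds for all $p\in(n,\infty]$ and all $Q\in W^{2,p}(\Omega)$. The function $Q$ has a representative that is continuous on $\Omega$ (which defines the values of $Q$ on $\Gamma$), and for this representative $Q$ and all $Q\nu_i\nu_j$ are integrable with respect to the surface measure $\mathcal H^{n-1}\llcorner\Gamma$. There is a matrix field $g=(g_{ij})\in L^p(B_\varepsilon(\Gamma);\mathbb R^{n\times n})$ such that,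 in the sense of distributions on $B_\varepsilon(\Gamma)$, $$\partial^2_{ij}\Big(\frac{Q}{2}|d_\Gamma|\Big)=Q\,\nu_i\nu_j\,\mathcal H^{n-1}\llcorner\Gamma+g_{ij}\qquad(1\le i,j\le n),$$ and in particular $$-\Delta\Big(\frac{Q}{2}|d_\Gamma|\Big)=-Q\,\mathcal H^{n-1}\llcorner\Gamma-\operatorname{tr}(g).$$ -/

import Mathlib

open MeasureTheory Set
open scoped ENNReal Distributions LineDeriv CompactConvergenceCLM Gradient

namespace SignedDistance

noncomputable section

/-- Euclidean space `ℝⁿ`. -/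
abbrev Rn (n : ℕ) : Type := EuclideanSpace ℝ (Fin n)

/-- The standard basis vector `eᵢ`. -/
def stdVec {n : ℕ} (i : Fin n) : Rn n := EuclideanSpace.single i (1 : ℝ)

/-- `A ⊂⊂ B`: the closure of `A` is compact and contained in `B`. -/
def CompactlyContained {n : ℕ} (A B : Set (Rn n)) : Prop :=
  IsCompact (closure A) ∧ closure A ⊆ B

/-! ### Domains with boundary of class `C²` and their outer unit normal -/

/-- `ρ` is a `C²` defining function of `D` on the open neighbourhood `U` of `x`: its gradient
does not vanish at `x`, and `D ∩ U = {ρ < 0} ∩ U`. -/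
structure IsLocalDefiningFunction {n : ℕ} (D : Set (Rn n)) (x : Rn n) (U : Set (Rn n))
    (ρ : Rn n → ℝ) : Prop where
  isOpen : IsOpen U
  mem : x ∈ U
  contDiffOn : ContDiffOn ℝ 2 ρ U
  gradient_ne_zero : ∇ ρ x ≠ 0
  mem_iff : ∀ y ∈ U, (y ∈ D ↔ ρ y < 0)

/-- `D` is open and its boundary is of class `C²`: near every boundary point, `D` is the sublevel
set of a `C²` function with nonvanishing gradient. -/
structure IsC2Domain {n : ℕ} (D : Set (Rn n)) : Prop where
  isOpen : IsOpen D
  exists_definingFunction : ∀ x ∈ frontier D, ∃ (U : Set (Rn n)) (ρ : Rn n → ℝ),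
    IsLocalDefiningFunction D x U ρ

/-- `v` is the outer unit normal of `D` at `x`: the normalised gradient of a local defining
function. -/
def IsOuterUnitNormal {n : ℕ} (D : Set (Rn n)) (x v : Rn n) : Prop :=
  ∃ (U : Set (Rn n)) (ρ : Rn n → ℝ), IsLocalDefiningFunction D x U ρ ∧ v = ‖∇ ρ x‖⁻¹ • ∇ ρ x

open Classical in
/-- The outer unit normal field `ν` of `D` (with value `0` at the points without a normal). -/
def outerUnitNormal {n : ℕ} (D : Set (Rn n)) (x : Rn n) : Rn n :=
  if h : ∃ v, IsOuterUnitNormal D x v then h.choose else 0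

/-- Two local defining functions have positively parallel gradients at boundary points, so that
the outer unit normal is well defined. -/
theorem IsOuterUnitNormal.unique {n : ℕ} {D : Set (Rn n)} {x v w : Rn n}
    (hx : x ∈ frontier D) (hD : IsOpen D)
    (hv : IsOuterUnitNormal D x v) (hw : IsOuterUnitNormal D x w) : v = w := by
  obtain ⟨U, ρ, h, rfl⟩ := hv
  obtain ⟨V, σ, k, rfl⟩ := hw
  have key : ∀ (U : Set (Rn n)) (ρ : Rn n → ℝ), IsLocalDefiningFunction D x U ρ →
      ρ x = 0 ∧ HasGradientAt ρ (∇ ρ x) x := by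
    intro U ρ h
    have hU : U ∈ nhds x := h.isOpen.mem_nhds h.mem
    have hc : ContDiffAt ℝ 2 ρ x := h.contDiffOn.contDiffAt hU
    refine ⟨le_antisymm ?_ ?_, (hc.differentiableAt (by norm_num)).hasGradientAt⟩
    · by_contra! hpos
      have h1 : ∀ᶠ y in nhds x, 0 < ρ y := hc.continuousAt.eventually (lt_mem_nhds hpos)
      have h2 : ∃ᶠ y in nhds x, y ∈ D := mem_closure_iff_frequently.mp hx.1
      obtain ⟨y, hyD, hy0, hyU⟩ := (h2.and_eventually (h1.and hU)).exists
      exact lt_asymm hy0 ((h.mem_iff y hyU).mp hyD)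
    · by_contra! hneg
      have : x ∈ D := (h.mem_iff x h.mem).mpr hneg
      exact hx.2 (by rwa [hD.interior_eq])
  have line : ∀ (ρ : Rn n → ℝ), ρ x = 0 → HasGradientAt ρ (∇ ρ x) x → ∀ z : Rn n,
      HasDerivAt (fun t : ℝ => ρ (x + t • z)) (inner ℝ (∇ ρ x) z) 0 := by
    intro ρ _ hg z
    have h1 : HasDerivAt (fun t : ℝ => x + t • z) z 0 := by
      simpa using ((hasDerivAt_id (0 : ℝ)).smul_const z).const_add x
    have h2 : HasFDerivAt ρ (InnerProductSpace.toDual ℝ (Rn n) (∇ ρ x)) (x + (0 : ℝ) • z) := by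
      simpa using hg.hasFDerivAt
    have h3 := h2.comp_hasDerivAt (0 : ℝ) h1
    rwa [InnerProductSpace.toDual_apply_apply] at h3
  obtain ⟨r0, rg⟩ := key U ρ h
  obtain ⟨s0, sg⟩ := key V σ k
  set a := ‖∇ ρ x‖⁻¹ • ∇ ρ x with ha
  set b := ‖∇ σ x‖⁻¹ • ∇ σ x with hb
  have na : 0 < ‖∇ ρ x‖ := norm_pos_iff.mpr h.gradient_ne_zero
  have nb : 0 < ‖∇ σ x‖ := norm_pos_iff.mpr k.gradient_ne_zero
  have ea : ∇ ρ x = ‖∇ ρ x‖ • a := by rw [ha, smul_smul, mul_inv_cancel₀ na.ne', one_smul]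
  have eb : ∇ σ x = ‖∇ σ x‖ • b := by rw [hb, smul_smul, mul_inv_cancel₀ nb.ne', one_smul]
  have ua : ‖a‖ = 1 := by rw [ha, norm_smul, norm_inv, norm_norm, inv_mul_cancel₀ na.ne']
  have ub : ‖b‖ = 1 := by rw [hb, norm_smul, norm_inv, norm_norm, inv_mul_cancel₀ nb.ne']
  by_contra hab
  have hlt : inner ℝ a b < 1 := (inner_lt_one_iff_real_of_norm_eq_one ua ub).mpr hab
  have da : inner ℝ (∇ ρ x) (b - a) < 0 := by
    rw [ea, real_inner_smul_left, inner_sub_right, real_inner_self_eq_norm_sq, ua]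
    exact mul_neg_of_pos_of_neg na (by linarith)
  have db : 0 < inner ℝ (∇ σ x) (b - a) := by
    rw [eb, real_inner_smul_left, inner_sub_right, real_inner_self_eq_norm_sq, ub,
      real_inner_comm]
    exact mul_pos nb (by linarith)
  have ta : ∀ᶠ t in nhdsWithin (0 : ℝ) (Ioi 0), ρ (x + t • (b - a)) < 0 := by
    have h1 := hasDerivWithinAt_iff_tendsto_slope.mp
      ((line ρ r0 rg (b - a)).hasDerivWithinAt (s := Ioi 0))
    rw [sdiff_singleton_eq_self (by simp)] at h1
    filter_upwards [h1.eventually (gt_mem_nhds da), self_mem_nhdsWithin] with t ht htp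
    simp only [slope_def_field, zero_smul, add_zero, r0, sub_zero] at ht
    exact (div_neg_iff.mp ht).elim (fun q => absurd q.2 (not_lt.mpr (le_of_lt htp))) (·.1)
  have tb : ∀ᶠ t in nhdsWithin (0 : ℝ) (Ioi 0), 0 < σ (x + t • (b - a)) := by
    have h1 := hasDerivWithinAt_iff_tendsto_slope.mp
      ((line σ s0 sg (b - a)).hasDerivWithinAt (s := Ioi 0))
    rw [sdiff_singleton_eq_self (by simp)] at h1
    filter_upwards [h1.eventually (lt_mem_nhds db), self_mem_nhdsWithin] with t ht htp
    simp only [slope_def_field, zero_smul, add_zero, s0, sub_zero] at ht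
    exact (div_pos_iff_of_pos_right htp).mp ht
  have tU : ∀ᶠ t in nhdsWithin (0 : ℝ) (Ioi 0), x + t • (b - a) ∈ U ∩ V := by
    have hc : ContinuousAt (fun t : ℝ => x + t • (b - a)) 0 := by fun_prop
    refine (hc.eventually ?_).filter_mono nhdsWithin_le_nhds
    simpa using ((h.isOpen.inter k.isOpen).mem_nhds ⟨h.mem, k.mem⟩)
  obtain ⟨t, h1, h2, h3⟩ := (ta.and (tb.and tU)).exists
  exact lt_asymm h2 ((k.mem_iff _ h3.2).mp ((h.mem_iff _ h3.1).mpr h1))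

theorem outerUnitNormal_eq {n : ℕ} {D : Set (Rn n)} {x : Rn n} (hx : x ∈ frontier D)
    (hD : IsOpen D) {U : Set (Rn n)} {ρ : Rn n → ℝ} (h : IsLocalDefiningFunction D x U ρ) :
    outerUnitNormal D x = ‖∇ ρ x‖⁻¹ • ∇ ρ x := by
  have hex : ∃ v, IsOuterUnitNormal D x v := ⟨_, U, ρ, h, rfl⟩
  rw [outerUnitNormal, dif_pos hex]
  exact IsOuterUnitNormal.unique hx hD hex.choose_spec ⟨U, ρ, h, rfl⟩

/-! ### Signed distance and tubular neighbourhood -/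

open Classical in
/-- The signed distance to `∂D`: negative in `D`, nonnegative outside. -/
def signedDist {n : ℕ} (D : Set (Rn n)) (x : Rn n) : ℝ :=
  if x ∈ D then -Metric.infDist x (frontier D) else Metric.infDist x (frontier D)

/-- The open tubular neighbourhood `B_ε(S) = {x | dist(x, S) < ε}`. -/
def tube {n : ℕ} (ε : ℝ) (S : Set (Rn n)) : TopologicalSpace.Opens (Rn n) :=
  ⟨Metric.thickening ε S, Metric.isOpen_thickening⟩

/-! ### Distributions and Sobolev functions -/

/-- The distribution `φ ↦ ∫ φ f dμ` on `U` given by the measure `f μ`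
(it is meant for `f` locally `μ`-integrable on `U`). -/
def distOf {n : ℕ} (U : TopologicalSpace.Opens (Rn n)) (μ : Measure (Rn n)) (f : Rn n → ℝ) :
    𝓓'(U, ℝ) :=
  TestFunction.integralAgainstBilinCLM (ContinuousLinearMap.mul ℝ ℝ) μ f

theorem distOf_apply {n : ℕ} {U : TopologicalSpace.Opens (Rn n)} {μ : Measure (Rn n)}
    {f : Rn n → ℝ} (hf : LocallyIntegrableOn f U μ) (φ : 𝓓(U, ℝ)) :
    distOf U μ f φ = ∫ x, φ x * f x ∂μ :=
  TestFunction.integralAgainstBilinCLM_eq_integral (B := ContinuousLinearMap.mul ℝ ℝ) hf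

/-- `f'` is the weak partial derivative `∂ᵢ f` on `Ω`. -/
structure HasWeakPartialDeriv {n : ℕ} (Ω : TopologicalSpace.Opens (Rn n)) (i : Fin n)
    (f f' : Rn n → ℝ) : Prop where
  locallyIntegrableOn : LocallyIntegrableOn f Ω volume
  locallyIntegrableOn_deriv : LocallyIntegrableOn f' Ω volume
  deriv_eq : ∂_{stdVec i} (distOf Ω volume f) = distOf Ω volume f'

/-- `f ∈ W^{2,p}(Ω)`: `f` and its weak derivatives of order one and two lie in `L^p(Ω)`. -/
def MemW2 {n : ℕ} (Ω : TopologicalSpace.Opens (Rn n)) (p : ℝ≥0∞) (f : Rn n → ℝ) : Prop :=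
  MemLp f p (volume.restrict Ω) ∧
  ∃ (f₁ : Fin n → Rn n → ℝ) (f₂ : Fin n → Fin n → Rn n → ℝ),
    (∀ i, MemLp (f₁ i) p (volume.restrict Ω) ∧ HasWeakPartialDeriv Ω i f (f₁ i)) ∧
    (∀ i j, MemLp (f₂ i j) p (volume.restrict Ω) ∧ HasWeakPartialDeriv Ω i (f₁ j) (f₂ i j))

/-- The distributional Laplacian `∑ᵢ ∂ᵢ ∂ᵢ T`. -/
def distLaplacian {n : ℕ} {U : TopologicalSpace.Opens (Rn n)} (T : 𝓓'(U, ℝ)) : 𝓓'(U, ℝ) :=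
  ∑ i : Fin n, ∂_{stdVec i} (∂_{stdVec i} T)

/-- The surface measure `H^{n-1}⌊∂D`. -/
def surfaceMeasure {n : ℕ} (D : Set (Rn n)) : Measure (Rn n) :=
  (Measure.euclideanHausdorffMeasure (n - 1)).restrict (frontier D)

end

end SignedDistance

open SignedDistance

/-! Near `Γ` the signed distance `d` is `C²`, with `|∇d| = 1` and `∇d = ν` on `Γ`. Formally
∂ᵢⱼ(Q|d|) = |d| ∂ᵢⱼQ + sign(d) (∂ⱼQ ∂ᵢd + ∂ᵢQ ∂ⱼd + Q ∂ᵢⱼd) + Q |·|''(d) ∂ᵢd ∂ⱼd. Here `|·|'' =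
2δ₀`, and `|∇d| = 1` makes `δ₀ ∘ d` the surface measure of `Γ`. The other terms are `L^p` functions
times bounded coefficients, and half their sum is `g`. The Laplacian formula follows by summing the
diagonal, since `∑ νᵢ² = 1`.

Regularity of `d`: a point near `Γ` is written `y + s ∇ρ(y)` with `ρ(y) = 0`. The inverse function
theorem gives only `C¹` dependence of `y` and `s`, but `∇d` is the unit normal at the foot point
`y`, which is again `C¹`, so `d` is `C²` (`contDiffAt_of_eventually_eq_normalCoordinate`). That `d`
is the normal coordinate is the Lagrange condition at a nearest point
(`IsLocalDefiningFunction.eventually_signedDist_eq`).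

The second derivative: `|t|` is replaced by `√(t² + δ²)`, whose second derivative `peakKernel δ` has
mass 2 and concentrates at 0. Two integrations by parts against the weak derivatives of `Q` are then
legitimate (`integral_comp_mul_second_partialDeriv`). As `δ → 0` the regular terms converge by
domination, the singular one by `tendsto_integral_peakKernel_comp`.

That coarea-type limit is proved by flattening. Near a point with `e = ∇d`, the map replacing the
`e`-coordinate by `d` distorts distances, volume and hyperplane measure by factors close to 1, and
on a hyperplane the limit is Fubini plus an approximate identity. A partition of unity globalises
the comparison with ratio `q > 1`, and `q → 1` gives equality.

The continuous representative is Morrey's embedding (`exists_continuousOn_ae_eq`). The derivative in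
`r` of the average of `Q` at scale `r` is a divergence tested against `Q`, hence `O(r^(-n/p))`. This
is integrable at 0 because `p > n`, so the averages converge locally uniformly. -/

namespace SignedDistance

open Filter Topology
open scoped NNReal

/-! ### Normal coordinates around a level set -/

section NormalCoordinates

variable {E : Type*} [NormedAddCommGroup E] [InnerProductSpace ℝ E]

/-- The linearisation of `(y, s) ↦ (y + s a, ⟨a, y⟩)`. -/
noncomputable def normalLinearEquiv (a : E) (ha : a ≠ 0) : (E × ℝ) ≃L[ℝ] (E × ℝ) :=
  ContinuousLinearEquiv.equivOfInverse
    (((ContinuousLinearMap.fst ℝ E ℝ) + (ContinuousLinearMap.snd ℝ E ℝ).smulRight a).prod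
      ((innerSL ℝ a).comp (ContinuousLinearMap.fst ℝ E ℝ)))
    (((ContinuousLinearMap.fst ℝ E ℝ) -
        ((‖a‖ ^ 2)⁻¹ • ((innerSL ℝ a).comp (ContinuousLinearMap.fst ℝ E ℝ)
          - ContinuousLinearMap.snd ℝ E ℝ)).smulRight a).prod
      ((‖a‖ ^ 2)⁻¹ • ((innerSL ℝ a).comp (ContinuousLinearMap.fst ℝ E ℝ)
          - ContinuousLinearMap.snd ℝ E ℝ)))
    (by
      rintro ⟨v, t⟩
      have : ‖a‖ ^ 2 ≠ 0 := by positivity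
      have key : (‖a‖ ^ 2)⁻¹ * (inner ℝ a (v + t • a) - inner ℝ a v) = t := by
        rw [inner_add_right, real_inner_smul_right, real_inner_self_eq_norm_sq]
        field_simp
        ring
      ext <;> simp [key])
    (by
      rintro ⟨v, t⟩
      have : ‖a‖ ^ 2 ≠ 0 := by positivity
      have key : inner ℝ a (v - ((‖a‖ ^ 2)⁻¹ * (inner ℝ a v - t)) • a) = t := by
        rw [inner_sub_right, real_inner_smul_right, real_inner_self_eq_norm_sq]
        field_simp
        ring
      ext <;> simp [key])

theorem normalLinearEquiv_apply (a : E) (ha : a ≠ 0) (p : E × ℝ) :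
    normalLinearEquiv a ha p = (p.1 + p.2 • a, inner ℝ a p.1) := rfl

variable [CompleteSpace E]

theorem contDiffAt_gradient {ρ : E → ℝ} {x : E} (h : ContDiffAt ℝ 2 ρ x) :
    ContDiffAt ℝ 1 (∇ ρ) x := by
  have h1 : ContDiffAt ℝ 1 (fderiv ℝ ρ) x := h.fderiv_right (by norm_num)
  exact ((InnerProductSpace.toDual ℝ E).symm.contDiff.contDiffAt).comp x h1

theorem inner_gradient_eq_fderiv {ρ : E → ℝ} (x v : E) : inner ℝ (∇ ρ x) v = fderiv ℝ ρ x v := by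
  rw [gradient, InnerProductSpace.toDual_symm_apply]

/-- Coordinates normal to a level set. -/
theorem exists_normalCoordinates {ρ : E → ℝ} {x₀ : E} (hρ : ContDiffAt ℝ 2 ρ x₀) (h0 : ρ x₀ = 0)
    (ha : ∇ ρ x₀ ≠ 0) :
    ∃ (y : E → E) (s : E → ℝ), ContDiffAt ℝ 1 y x₀ ∧ ContDiffAt ℝ 1 s x₀ ∧ y x₀ = x₀ ∧ s x₀ = 0 ∧
      (∀ᶠ x in 𝓝 x₀, y x + s x • ∇ ρ (y x) = x ∧ ρ (y x) = 0) ∧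
      (∀ᶠ p : E × ℝ in 𝓝 (x₀, 0), ρ p.1 = 0 →
        y (p.1 + p.2 • ∇ ρ p.1) = p.1 ∧ s (p.1 + p.2 • ∇ ρ p.1) = p.2) := by
  -- The extra component `ρ` makes source and target the same space. Solving `G (y, s) = (x, 0)`
  -- says exactly that `x` lies on the normal line through a point `y` of the level set.
  set G : E × ℝ → E × ℝ := fun p => (p.1 + p.2 • ∇ ρ p.1, ρ p.1) with hG
  have hρ1 : ContDiffAt ℝ 1 (fun p : E × ℝ => ρ p.1) (x₀, 0) :=
    ContDiffAt.comp (x₀, (0 : ℝ)) (hρ.of_le (by norm_num)) contDiffAt_fst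
  have hg1 : ContDiffAt ℝ 1 (fun p : E × ℝ => ∇ ρ p.1) (x₀, 0) :=
    ContDiffAt.comp (g := ∇ ρ) (x₀, (0 : ℝ)) (contDiffAt_gradient hρ) contDiffAt_fst
  have hGc : ContDiffAt ℝ 1 G (x₀, 0) :=
    (contDiffAt_fst.add (contDiffAt_snd.smul hg1)).prodMk hρ1
  have hGd : HasFDerivAt G ((normalLinearEquiv (∇ ρ x₀) ha : (E × ℝ) →L[ℝ] (E × ℝ))) (x₀, 0) := by
    have d1 := (hg1.differentiableAt (by norm_num)).hasFDerivAt
    have d2 : HasFDerivAt (fun p : E × ℝ => ρ p.1)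
        ((fderiv ℝ ρ x₀).comp (ContinuousLinearMap.fst ℝ E ℝ)) (x₀, 0) :=
      HasFDerivAt.comp (x₀, (0 : ℝ)) (hρ.differentiableAt (by norm_num)).hasFDerivAt hasFDerivAt_fst
    have d3 := ((hasFDerivAt_fst (𝕜 := ℝ) (p := (x₀, (0 : ℝ)))).add
      ((hasFDerivAt_snd (𝕜 := ℝ) (p := (x₀, (0 : ℝ)))).smul d1)).prodMk d2
    refine d3.congr_fderiv ?_
    ext v <;> simp [normalLinearEquiv_apply]
  have hG0 : G (x₀, 0) = (x₀, 0) := by simp [hG, h0]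
  set Φ := hGc.toOpenPartialHomeomorph G hGd one_ne_zero
  have hsrc : (x₀, (0 : ℝ)) ∈ Φ.source := hGc.mem_toOpenPartialHomeomorph_source hGd one_ne_zero
  have htgt : (x₀, (0 : ℝ)) ∈ Φ.target := by
    have := hGc.image_mem_toOpenPartialHomeomorph_target hGd one_ne_zero
    rwa [hG0] at this
  have hΦ : ∀ p, Φ p = G p := fun _ => rfl
  have hsym : Φ.symm (x₀, 0) = (x₀, 0) := by
    have := Φ.left_inv hsrc
    rwa [hΦ, hG0] at this
  have hcs : ContDiffAt ℝ 1 Φ.symm (x₀, 0) :=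
    Φ.contDiffAt_symm htgt (by rw [hsym]; exact hGd) (by rw [hsym]; exact hGc)
  have hcH : ContDiffAt ℝ 1 (fun x : E => Φ.symm (x, (0 : ℝ))) x₀ :=
    ContDiffAt.comp x₀ hcs (contDiffAt_id.prodMk contDiffAt_const)
  refine ⟨fun x => (Φ.symm (x, 0)).1, fun x => (Φ.symm (x, 0)).2, hcH.fst, hcH.snd,
    by simp [hsym], by simp [hsym], ?_, ?_⟩
  · have hc : ContinuousAt (fun x : E => (x, (0 : ℝ))) x₀ := by fun_prop
    filter_upwards [hc.eventually (Φ.open_target.mem_nhds htgt)] with x hx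
    have := Φ.right_inv hx
    rw [hΦ] at this
    exact ⟨congrArg Prod.fst this, congrArg Prod.snd this⟩
  · filter_upwards [Φ.open_source.mem_nhds hsrc] with p hp hp0
    have := Φ.left_inv hp
    rw [hΦ] at this
    simp only [hG, hp0] at this
    exact ⟨congrArg Prod.fst this, congrArg Prod.snd this⟩

/-- The signed normal coordinate is `C²` with unit gradient. -/
theorem contDiffAt_of_eventually_eq_normalCoordinate {ρ d : E → ℝ} {x₀ : E} {y : E → E} {s : E → ℝ}
    (hρ : ContDiffAt ℝ 2 ρ x₀) (ha : ∇ ρ x₀ ≠ 0)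
    (hy : ContDiffAt ℝ 1 y x₀) (hy0 : y x₀ = x₀)
    (heq : ∀ᶠ x in 𝓝 x₀, y x + s x • ∇ ρ (y x) = x ∧ ρ (y x) = 0)
    (hd : ∀ᶠ x in 𝓝 x₀, d x = s x * ‖∇ ρ (y x)‖) :
    ContDiffAt ℝ 2 d x₀ ∧ ∀ᶠ x in 𝓝 x₀, ∇ d x = ‖∇ ρ (y x)‖⁻¹ • ∇ ρ (y x) := by
  set N : E → E := fun x => ‖∇ ρ (y x)‖⁻¹ • ∇ ρ (y x) with hN
  have hga : ContDiffAt ℝ 1 (fun x => ∇ ρ (y x)) x₀ :=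
    ContDiffAt.comp (g := ∇ ρ) (f := y) x₀ (by rw [hy0]; exact contDiffAt_gradient hρ) hy
  have hga0 : ∇ ρ (y x₀) ≠ 0 := by rwa [hy0]
  have hNc : ContDiffAt ℝ 1 N x₀ :=
    ((hga.norm ℝ hga0).inv (norm_ne_zero_iff.2 hga0)).smul hga
  have e1 : ∀ᶠ x in 𝓝 x₀, ∇ ρ (y x) ≠ 0 := hga.continuousAt.eventually_ne hga0
  have e2 : ∀ᶠ x in 𝓝 x₀, ContDiffAt ℝ 1 y x := hy.eventually (by simp)
  have e3 : ∀ᶠ x in 𝓝 x₀, ContDiffAt ℝ 1 N x := hNc.eventually (by simp)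
  have e4 : ∀ᶠ x in 𝓝 x₀, ContDiffAt ℝ 2 ρ (y x) := by
    have : ∀ᶠ z in 𝓝 (y x₀), ContDiffAt ℝ 2 ρ z := by
      rw [hy0]; exact hρ.eventually (by simp)
    exact hy.continuousAt.eventually this
  -- Differentiate `d = ⟨x - y, N⟩`. Since `x - y` is parallel to `N`, the `N'` term vanishes
  -- because `|N| = 1`, and the `y'` term vanishes because `ρ ∘ y = 0` makes `y'` tangential. Only
  -- `⟨v, N⟩` remains, and `N` is `C¹`.
  have key : ∀ᶠ x in 𝓝 x₀, HasFDerivAt d (innerSL ℝ (N x)) x := by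
    filter_upwards [e1.eventually_nhds, e2, e3, e4, heq.eventually_nhds, hd.eventually_nhds]
      with x h1 h2 h3 h4 h5 h6
    have hd' : d =ᶠ[𝓝 x] fun z => inner ℝ (z - y z) (N z) := by
      filter_upwards [h1, h5, h6] with z k1 k5 k6
      have k1' : ‖∇ ρ (y z)‖ ≠ 0 := norm_ne_zero_iff.2 k1
      have : z - y z = s z • ∇ ρ (y z) := by rw [sub_eq_iff_eq_add', k5.1]
      rw [this, k6, hN]
      simp only [real_inner_smul_left, real_inner_smul_right, real_inner_self_eq_norm_sq]
      field_simp
    have hNd := (h3.differentiableAt (by norm_num)).hasFDerivAt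
    have hyd := (h2.differentiableAt (by norm_num)).hasFDerivAt
    have hρd := (h4.differentiableAt (by norm_num)).hasFDerivAt
    have i1 : ∀ v, inner ℝ (N x) (fderiv ℝ N x v) = 0 := by
      intro v
      have hone : (fun z => inner ℝ (N z) (N z)) =ᶠ[𝓝 x] fun _ => (1 : ℝ) := by
        filter_upwards [h1] with z k1
        have k1' : ‖∇ ρ (y z)‖ ≠ 0 := norm_ne_zero_iff.2 k1
        rw [real_inner_self_eq_norm_sq, hN, norm_smul, norm_inv, norm_norm, inv_mul_cancel₀ k1',
          one_pow]
      have a1 := hNd.inner ℝ hNd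
      have a2 := (hasFDerivAt_const (𝕜 := ℝ) (1 : ℝ) x).congr_of_eventuallyEq hone
      have := congrArg (fun L : E →L[ℝ] ℝ => L v) (a1.unique a2)
      simp [fderivInnerCLM_apply] at this
      rw [real_inner_comm] at this
      rw [real_inner_comm]
      linarith
    have i2 : ∀ v, inner ℝ (N x) (fderiv ℝ y x v) = 0 := by
      intro v
      have hz : (fun z => ρ (y z)) =ᶠ[𝓝 x] fun _ => (0 : ℝ) := by
        filter_upwards [h5] with z k5 using k5.2
      have a1 := hρd.comp x hyd
      have a2 := (hasFDerivAt_const (𝕜 := ℝ) (0 : ℝ) x).congr_of_eventuallyEq hz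
      have := congrArg (fun L : E →L[ℝ] ℝ => L v) (a1.unique a2)
      simp only [ContinuousLinearMap.comp_apply, ← inner_gradient_eq_fderiv] at this
      simp [hN, real_inner_smul_left, this]
    have hmain := (((hasFDerivAt_id x).sub hyd).inner ℝ hNd).congr_of_eventuallyEq hd'
    refine hmain.congr_fderiv ?_
    have h5x := h5.self_of_nhds
    ext v
    have : x - y x = (s x * ‖∇ ρ (y x)‖) • N x := by
      have k1' : ‖∇ ρ (y x)‖ ≠ 0 := norm_ne_zero_iff.2 h1.self_of_nhds
      rw [hN, smul_smul, mul_assoc, mul_inv_cancel₀ k1', mul_one, sub_eq_iff_eq_add', h5x.1]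
    simp [fderivInnerCLM_apply, this, real_inner_smul_left, i1, inner_sub_left, i2,
      real_inner_comm (N x) (fderiv ℝ y x v), real_inner_comm (N x) v]
  constructor
  · have : ContDiffAt ℝ ((1 : ℕ) + 1) d x₀ := by
      rw [contDiffAt_succ_iff_hasFDerivAt]
      exact ⟨fun x => innerSL ℝ (N x), ⟨_, key, fun x hx => hx⟩,
        (innerSL ℝ (E := E)).contDiff.contDiffAt.comp x₀ hNc⟩
    simpa [one_add_one_eq_two] using this
  · filter_upwards [key] with x hx
    refine HasGradientAt.gradient ?_
    rw [hasGradientAt_iff_hasFDerivAt]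
    exact hx

end NormalCoordinates

/-! ### The signed distance as a normal coordinate -/

section LocalDistance

variable {n : ℕ} {D : Set (Rn n)} {x₀ : Rn n} {U : Set (Rn n)} {ρ : Rn n → ℝ}

theorem IsLocalDefiningFunction.contDiffAt (h : IsLocalDefiningFunction D x₀ U ρ) {z : Rn n}
    (hz : z ∈ U) : ContDiffAt ℝ 2 ρ z :=
  h.contDiffOn.contDiffAt (h.isOpen.mem_nhds hz)

theorem IsLocalDefiningFunction.eq_zero_of_mem_frontier (h : IsLocalDefiningFunction D x₀ U ρ)
    (hD : IsOpen D) {z : Rn n} (hz : z ∈ U) (hzf : z ∈ frontier D) : ρ z = 0 := by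
  have hU : U ∈ 𝓝 z := h.isOpen.mem_nhds hz
  refine le_antisymm ?_ ?_
  · by_contra! hpos
    have h1 : ∀ᶠ y in 𝓝 z, 0 < ρ y := (h.contDiffAt hz).continuousAt.eventually (lt_mem_nhds hpos)
    have h2 : ∃ᶠ y in 𝓝 z, y ∈ D := mem_closure_iff_frequently.mp hzf.1
    obtain ⟨y, hyD, hy0, hyU⟩ := (h2.and_eventually (h1.and hU)).exists
    exact lt_asymm hy0 ((h.mem_iff y hyU).mp hyD)
  · by_contra! hneg
    have : z ∈ D := (h.mem_iff z hz).mpr hneg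
    exact hzf.2 (by rwa [hD.interior_eq])

/-- If `z` were away from the closure of `D`, then `ρ ≥ 0` near `z` with equality at `z`, a local
minimum, which contradicts the nonvanishing gradient. -/
theorem IsLocalDefiningFunction.mem_frontier_of_eq_zero (h : IsLocalDefiningFunction D x₀ U ρ)
    (hD : IsOpen D) {z : Rn n} (hz : z ∈ U) (h0 : ρ z = 0) (hg : ∇ ρ z ≠ 0) : z ∈ frontier D := by
  rw [hD.frontier_eq]
  refine ⟨?_, fun hzD => by have := (h.mem_iff z hz).1 hzD; linarith⟩
  by_contra hcl
  have h1 : ∀ᶠ y in 𝓝 z, y ∉ D := by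
    filter_upwards [isClosed_closure.isOpen_compl.mem_nhds hcl] with y hy hyD
    exact hy (subset_closure hyD)
  have hmin : IsLocalMin ρ z := by
    filter_upwards [h1, h.isOpen.mem_nhds hz] with y hy hyU
    rw [h0]
    by_contra! hneg
    exact hy ((h.mem_iff y hyU).2 hneg)
  apply hg
  rw [gradient, hmin.fderiv_eq_zero, map_zero]

/-- A nearest point on a level set differs from the base point by a multiple of the gradient. -/
theorem exists_sub_eq_smul_gradient_of_isMinOn {ρ : Rn n → ℝ} {x z : Rn n}
    (hρ : ContDiffAt ℝ 1 ρ z) (hg : ∇ ρ z ≠ 0)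
    (hmin : ∀ᶠ w in 𝓝 z, ρ w = ρ z → dist x z ≤ dist x w) :
    ∃ t : ℝ, x - z = t • ∇ ρ z := by
  have hext : IsLocalExtrOn (fun w : Rn n => ‖w - x‖ ^ 2) {w | ρ w = ρ z} z := by
    left
    refine eventually_nhdsWithin_iff.2 ?_
    filter_upwards [hmin] with w hw hwρ
    have := hw hwρ
    rw [dist_comm x z, dist_comm x w, dist_eq_norm, dist_eq_norm] at this
    gcongr
  have hρs : HasStrictFDerivAt ρ (fderiv ℝ ρ z) z := hρ.hasStrictFDerivAt (by norm_num)
  have hφ : HasStrictFDerivAt (fun w : Rn n => ‖w - x‖ ^ 2) (2 • (innerSL ℝ (z - x))) z := by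
    have := (hasStrictFDerivAt_norm_sq (z - x)).comp z ((hasStrictFDerivAt_id z).sub_const x)
    exact this
  obtain ⟨a, b, hab, hsum⟩ := hext.exists_multipliers_of_hasStrictFDerivAt_1d hρs hφ
  have hv : ∀ v, a * inner ℝ (∇ ρ z) v + b * (2 * inner ℝ (z - x) v) = 0 := by
    intro v
    have := congrArg (fun L : Rn n →L[ℝ] ℝ => L v) hsum
    simpa [two_mul, inner_sub_left] using this
  have hvec : a • ∇ ρ z + (2 * b) • (z - x) = 0 := by
    refine ext_inner_right ℝ fun v => ?_
    rw [inner_add_left, real_inner_smul_left, real_inner_smul_left, inner_zero_left, ← hv v]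
    ring
  -- If the multiplier of the squared distance vanished, `∇ρ z ≠ 0` would force the other multiplier
  -- to vanish too.
  have hb : b ≠ 0 := by
    rintro rfl
    have : a = 0 := by simpa [hg] using hvec
    exact hab (by simp [this])
  refine ⟨a / (2 * b), ?_⟩
  have h3 : (2 * b) • (x - z) = a • ∇ ρ z := by
    rw [eq_comm, ← sub_eq_zero, ← hvec, ← neg_sub x z, smul_neg, sub_eq_add_neg]
  rw [div_eq_inv_mul, mul_smul, ← h3, smul_smul, inv_mul_cancel₀ (by simpa using hb), one_smul]

/-- The signed distance is, near a boundary point, the signed normal coordinate. -/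
theorem IsLocalDefiningFunction.eventually_signedDist_eq (h : IsLocalDefiningFunction D x₀ U ρ)
    (hD : IsOpen D) (hx₀ : x₀ ∈ frontier D) {y : Rn n → Rn n} {s : Rn n → ℝ}
    (hinv : ∀ᶠ p : Rn n × ℝ in 𝓝 (x₀, 0), ρ p.1 = 0 →
        y (p.1 + p.2 • ∇ ρ p.1) = p.1 ∧ s (p.1 + p.2 • ∇ ρ p.1) = p.2) :
    ∀ᶠ x in 𝓝 x₀, signedDist D x = s x * ‖∇ ρ (y x)‖ := by
  have hgc : ContinuousAt (∇ ρ) x₀ := (contDiffAt_gradient (h.contDiffAt h.mem)).continuousAt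
  set c := ‖∇ ρ x₀‖ / 2 with hc
  have hn0 : 0 < ‖∇ ρ x₀‖ := norm_pos_iff.2 h.gradient_ne_zero
  have hc0 : 0 < c := by positivity
  have e1 : ∀ᶠ z in 𝓝 x₀, c < ‖∇ ρ z‖ :=
    hgc.norm.eventually (lt_mem_nhds (by rw [hc]; linarith))
  have e2 : ∀ᶠ p : Rn n × Rn n in 𝓝 (x₀, x₀), 0 < inner ℝ (∇ ρ p.1) (∇ ρ p.2) := by
    have : ContinuousAt (fun p : Rn n × Rn n => (inner ℝ (∇ ρ p.1) (∇ ρ p.2) : ℝ)) (x₀, x₀) :=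
      (ContinuousAt.comp (g := ∇ ρ) (f := Prod.fst) hgc continuousAt_fst).inner
        (ContinuousAt.comp (g := ∇ ρ) (f := Prod.snd) hgc continuousAt_snd)
    refine this.eventually (lt_mem_nhds ?_)
    simp only [real_inner_self_eq_norm_sq]
    positivity
  obtain ⟨r₁, hr₁, H1⟩ := Metric.eventually_nhds_iff.1 (e1.and (h.isOpen.mem_nhds h.mem))
  obtain ⟨r₂, hr₂, H2⟩ := Metric.eventually_nhds_iff.1 e2
  obtain ⟨r₃, hr₃, H3⟩ := Metric.eventually_nhds_iff.1 hinv
  set r := min r₁ (min r₂ r₃)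
  have hr : 0 < r := by positivity
  -- The bound `r / 2` keeps a nearest boundary point `z` within `r` of `x₀`. The bound `c * r`
  -- forces `|t| < r` in `x = z + t ∇ρ(z)`, since there `|t| c ≤ dist x z`. So `(z, t)` lies where
  -- the inversion formula holds.
  have hδ : 0 < min (r / 2) (c * r) := by positivity
  filter_upwards [Metric.ball_mem_nhds x₀ hδ] with x hx
  rw [Metric.mem_ball] at hx
  have hx2 : dist x x₀ < r / 2 := lt_of_lt_of_le hx (min_le_left _ _)
  have hxc : dist x x₀ < c * r := lt_of_lt_of_le hx (min_le_right _ _)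
  obtain ⟨z, hzf, hz⟩ := (isClosed_frontier (s := D)).exists_infDist_eq_dist ⟨x₀, hx₀⟩ x
  have hzx : dist x z ≤ dist x x₀ := hz ▸ Metric.infDist_le_dist_of_mem hx₀
  have hzx₀ : dist z x₀ < r := by
    have := dist_triangle_left z x₀ x
    linarith
  have B1 : ∀ w, dist w x₀ < r → c < ‖∇ ρ w‖ ∧ w ∈ U := fun w hw =>
    H1 (lt_of_lt_of_le hw (min_le_left _ _))
  have B2 : ∀ w w', dist w x₀ < r → dist w' x₀ < r → 0 < inner ℝ (∇ ρ w) (∇ ρ w') := by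
    intro w w' hw hw'
    refine H2 (y := (w, w')) ?_
    rw [Prod.dist_eq]
    exact lt_of_lt_of_le (max_lt hw hw') ((min_le_right _ _).trans (min_le_left _ _))
  obtain ⟨hzc, hzU⟩ := B1 z hzx₀
  have hz0 : ρ z = 0 := h.eq_zero_of_mem_frontier hD hzU hzf
  have hzg : ∇ ρ z ≠ 0 := norm_pos_iff.1 (hc0.trans hzc)
  obtain ⟨t, ht⟩ := exists_sub_eq_smul_gradient_of_isMinOn (x := x) (z := z)
    ((h.contDiffAt hzU).of_le (by norm_num)) hzg (by
      filter_upwards [Metric.isOpen_ball.mem_nhds (Metric.mem_ball.2 hzx₀)] with w hw hw0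
      rw [Metric.mem_ball] at hw
      obtain ⟨hwc, hwU⟩ := B1 w hw
      rw [← hz]
      exact Metric.infDist_le_dist_of_mem (h.mem_frontier_of_eq_zero hD hwU (hw0.trans hz0)
        (norm_pos_iff.1 (hc0.trans hwc))))
  have hxeq : x = z + t • ∇ ρ z := by rw [← ht]; abel
  have hdist : dist x z = |t| * ‖∇ ρ z‖ := by
    rw [dist_eq_norm, ht, norm_smul, Real.norm_eq_abs]
  have htr : |t| < r := by
    have : |t| * c ≤ |t| * ‖∇ ρ z‖ := by gcongr
    have h4 : |t| * c < r * c := by linarith [hdist]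
    exact lt_of_mul_lt_mul_right h4 hc0.le
  obtain ⟨hy, hs⟩ := H3 (y := (z, t)) (by
    rw [Prod.dist_eq]
    refine lt_of_lt_of_le (max_lt hzx₀ ?_) ((min_le_right _ _).trans (min_le_right _ _))
    simpa using htr) hz0
  simp only [← hxeq] at hy hs
  rw [hy, hs]
  have hxU : x ∈ U := (B1 x (by linarith)).2
  -- By the mean value theorem on the segment from `z` to `x`, `ρ x = t ⟨∇ρ w, ∇ρ z⟩` with nearby
  -- gradients making an acute angle. Hence `t` has the sign of `ρ x`, which decides whether `x ∈
  -- D`.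
  have hsign : ∃ q : ℝ, 0 < q ∧ ρ x = t * q := by
    obtain ⟨w, hw, hw'⟩ := domain_mvt (f := ρ) (f' := fun w => fderiv ℝ ρ w)
      (s := Metric.ball x₀ r) (x := z) (y := x)
      (fun w hw => (((h.contDiffAt (B1 w hw).2).differentiableAt
        (by norm_num)).hasFDerivAt).hasFDerivWithinAt) (convex_ball _ _) hzx₀
      (Metric.mem_ball.2 (by linarith))
    refine ⟨inner ℝ (∇ ρ w) (∇ ρ z), B2 w z ?_ hzx₀, ?_⟩
    · exact (convex_ball x₀ r).segment_subset hzx₀ (Metric.mem_ball.2 (by linarith)) hw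
    · rw [hz0, sub_zero, ht, map_smul, smul_eq_mul, ← inner_gradient_eq_fderiv] at hw'
      exact hw'
  obtain ⟨q, hq, hρx⟩ := hsign
  unfold signedDist
  rw [hz, hdist]
  by_cases hxD : x ∈ D
  · have h1 := (h.mem_iff x hxU).1 hxD
    have : t < 0 := by
      by_contra! h2
      have := mul_nonneg h2 hq.le
      linarith
    rw [if_pos hxD, abs_of_neg this]; ring
  · have : 0 ≤ t := by
      by_contra! h2
      exact hxD ((h.mem_iff x hxU).2 (by rw [hρx]; exact mul_neg_of_neg_of_pos h2 hq))
    rw [if_neg hxD, abs_of_nonneg this]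

end LocalDistance

/-! ### Regularity of the signed distance and the normal -/

section SignedDistance

variable {n : ℕ} {D : Set (Rn n)}

theorem abs_signedDist (x : Rn n) : |signedDist D x| = Metric.infDist x (frontier D) := by
  unfold signedDist
  split_ifs <;> simp [abs_of_nonneg Metric.infDist_nonneg]

/-- The signed distance to a `C²` boundary is `C²` near the boundary, with unit gradient. -/
theorem IsC2Domain.eventually_contDiffAt_signedDist (hD : IsC2Domain D) {x₀ : Rn n}
    (hx₀ : x₀ ∈ frontier D) :
    ∀ᶠ x in 𝓝 x₀, ContDiffAt ℝ 2 (signedDist D) x ∧ ‖∇ (signedDist D) x‖ = 1 := by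
  obtain ⟨U, ρ, h⟩ := hD.exists_definingFunction x₀ hx₀
  have hρ := h.contDiffAt h.mem
  obtain ⟨y, s, hy, hs, hy0, hs0, heq, hinv⟩ := exists_normalCoordinates hρ
    (h.eq_zero_of_mem_frontier hD.isOpen h.mem hx₀) h.gradient_ne_zero
  obtain ⟨h1, h2⟩ := contDiffAt_of_eventually_eq_normalCoordinate hρ h.gradient_ne_zero hy hy0 heq
    (h.eventually_signedDist_eq hD.isOpen hx₀ hinv)
  have h3 : ∀ᶠ x in 𝓝 x₀, ∇ ρ (y x) ≠ 0 := by
    have : ContinuousAt (fun x => ∇ ρ (y x)) x₀ :=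
      ContinuousAt.comp (g := ∇ ρ) (f := y)
        (by rw [hy0]; exact (contDiffAt_gradient hρ).continuousAt) hy.continuousAt
    exact this.eventually_ne (by rw [hy0]; exact h.gradient_ne_zero)
  filter_upwards [h1.eventually (by simp), h2, h3] with x k1 k2 k3
  refine ⟨k1, ?_⟩
  rw [k2, norm_smul, norm_inv, norm_norm, inv_mul_cancel₀ (norm_ne_zero_iff.2 k3)]

theorem IsC2Domain.exists_isOpen_contDiffOn_signedDist (hD : IsC2Domain D) :
    ∃ W : Set (Rn n), IsOpen W ∧ frontier D ⊆ W ∧ ContDiffOn ℝ 2 (signedDist D) W ∧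
      ∀ x ∈ W, ‖∇ (signedDist D) x‖ = 1 := by
  refine ⟨interior {x | ContDiffAt ℝ 2 (signedDist D) x ∧ ‖∇ (signedDist D) x‖ = 1},
    isOpen_interior, fun x hx => mem_interior_iff_mem_nhds.2
      (hD.eventually_contDiffAt_signedDist hx), fun x hx => ?_, fun x hx => ?_⟩
  · exact (interior_subset hx).1.contDiffWithinAt
  · exact (interior_subset hx).2

/-- The signed distance is itself a local defining function, so the normal is its normalised
gradient, which already has length one. -/
theorem outerUnitNormal_eq_gradient_signedDist (hD : IsOpen D) {W : Set (Rn n)} (hW : IsOpen W)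
    (hd : ContDiffOn ℝ 2 (signedDist D) W) (hg : ∀ x ∈ W, ‖∇ (signedDist D) x‖ = 1) {x : Rn n}
    (hx : x ∈ frontier D) (hxW : x ∈ W) : outerUnitNormal D x = ∇ (signedDist D) x := by
  have h : IsLocalDefiningFunction D x W (signedDist D) :=
    { isOpen := hW
      mem := hxW
      contDiffOn := hd
      gradient_ne_zero := by
        intro h0
        have := hg x hxW
        simp [h0] at this
      mem_iff := by
        intro y _
        unfold signedDist
        constructor
        · intro hy
          rw [if_pos hy, neg_lt_zero, ← isClosed_frontier.notMem_iff_infDist_pos ⟨x, hx⟩,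
            hD.frontier_eq]
          exact fun h => h.2 hy
        · intro hy
          by_contra hyD
          rw [if_neg hyD] at hy
          exact absurd hy (not_lt.2 Metric.infDist_nonneg) }
  rw [outerUnitNormal_eq hx hD h, hg x hxW, inv_one, one_smul]

end SignedDistance

/-! ### The regularised absolute value and its second derivative -/

section PeakKernel

/-- The second derivative of the regularised absolute value `t ↦ √(t² + δ²)`. -/
noncomputable def peakKernel (δ t : ℝ) : ℝ := δ ^ 2 / Real.sqrt (t ^ 2 + δ ^ 2) ^ 3

theorem peakKernel_nonneg (δ t : ℝ) : 0 ≤ peakKernel δ t := by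
  unfold peakKernel; positivity

theorem hasDerivAt_sqrt_sq_add_sq {δ : ℝ} (hδ : δ ≠ 0) (t : ℝ) :
    HasDerivAt (fun t => Real.sqrt (t ^ 2 + δ ^ 2)) (t / Real.sqrt (t ^ 2 + δ ^ 2)) t := by
  have h0 : t ^ 2 + δ ^ 2 ≠ 0 := by positivity
  have := (((hasDerivAt_id t).pow 2).add_const (δ ^ 2)).sqrt h0
  refine this.congr_deriv ?_
  simp only [id_eq, Pi.pow_apply]
  field_simp
  norm_num

theorem hasDerivAt_div_sqrt_sq_add_sq {δ : ℝ} (hδ : δ ≠ 0) (t : ℝ) :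
    HasDerivAt (fun t => t / Real.sqrt (t ^ 2 + δ ^ 2)) (peakKernel δ t) t := by
  have h0 : 0 < t ^ 2 + δ ^ 2 := by positivity
  have h1 : Real.sqrt (t ^ 2 + δ ^ 2) ≠ 0 := (Real.sqrt_pos.2 h0).ne'
  have := (hasDerivAt_id t).div (hasDerivAt_sqrt_sq_add_sq hδ t) h1
  refine this.congr_deriv ?_
  unfold peakKernel
  have h2 : Real.sqrt (t ^ 2 + δ ^ 2) ^ 2 = t ^ 2 + δ ^ 2 := Real.sq_sqrt h0.le
  rw [div_eq_div_iff (by positivity) (by positivity)]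
  simp only [id_eq]
  field_simp
  linear_combination h2

theorem continuous_peakKernel {δ : ℝ} (hδ : δ ≠ 0) : Continuous (peakKernel δ) := by
  unfold peakKernel
  refine Continuous.div (by fun_prop) (by fun_prop) fun t => ?_
  have h0 : 0 < t ^ 2 + δ ^ 2 := by positivity
  positivity

theorem tendsto_div_sqrt_atTop :
    Tendsto (fun t : ℝ => t / Real.sqrt (t ^ 2 + 1 ^ 2)) atTop (𝓝 1) := by
  have h : Tendsto (fun t : ℝ => (Real.sqrt (1 + (t⁻¹) ^ 2))⁻¹) atTop (𝓝 1) := by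
    have h1 : Tendsto (fun t : ℝ => (Real.sqrt (1 + (t⁻¹) ^ 2))⁻¹) atTop
        (𝓝 (Real.sqrt (1 + 0 ^ 2))⁻¹) := by
      refine Tendsto.inv₀ ?_ (by simp)
      exact ((tendsto_inv_atTop_zero.pow 2).const_add 1).sqrt
    simpa using h1
  refine h.congr' ?_
  filter_upwards [eventually_gt_atTop 0] with t ht
  have : t ^ 2 + 1 ^ 2 = t ^ 2 * (1 + (t⁻¹) ^ 2) := by field_simp
  rw [this, Real.sqrt_mul (by positivity), Real.sqrt_sq ht.le]
  field_simp

theorem tendsto_div_sqrt_atBot :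
    Tendsto (fun t : ℝ => t / Real.sqrt (t ^ 2 + 1 ^ 2)) atBot (𝓝 (-1)) := by
  have := (tendsto_div_sqrt_atTop.comp tendsto_neg_atBot_atTop).neg
  refine this.congr fun t => ?_
  simp [neg_div]

theorem integrable_peakKernel_one : Integrable (peakKernel 1) := by
  have h : IntegrableOn (peakKernel 1) (Ioi 0) :=
    integrableOn_Ioi_deriv_of_nonneg' (fun t _ => hasDerivAt_div_sqrt_sq_add_sq one_ne_zero t)
      (fun t _ => peakKernel_nonneg 1 t) tendsto_div_sqrt_atTop
  have heven : (fun t => peakKernel 1 (-t)) = peakKernel 1 := by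
    ext t; simp [peakKernel]
  rw [← integrableOn_univ, ← Iic_union_Ioi (a := (0 : ℝ))]
  refine IntegrableOn.union ?_ h
  rw [integrableOn_Iic_iff_integrableOn_Iio]
  have h2 := (Measure.measurePreserving_neg (volume : Measure ℝ)).integrableOn_comp_preimage
    (MeasurableEquiv.neg ℝ).measurableEmbedding (f := peakKernel 1) (s := Ioi 0)
  rw [← heven]
  have h3 := h2.2 h
  simpa [Function.comp_def] using h3

/-- The mass is the total increase of `t / √(t² + 1)`, from `-1` to `1`. -/
theorem integral_peakKernel_one : ∫ t, peakKernel 1 t = 2 := by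
  rw [integral_of_hasDerivAt_of_tendsto (fun t => hasDerivAt_div_sqrt_sq_add_sq one_ne_zero t)
    integrable_peakKernel_one tendsto_div_sqrt_atBot tendsto_div_sqrt_atTop]
  norm_num

theorem peakKernel_mul {δ : ℝ} (hδ : 0 < δ) (s : ℝ) :
    peakKernel δ (δ * s) = δ⁻¹ * peakKernel 1 s := by
  unfold peakKernel
  have : (δ * s) ^ 2 + δ ^ 2 = δ ^ 2 * (s ^ 2 + 1 ^ 2) := by ring
  rw [this, Real.sqrt_mul (by positivity), Real.sqrt_sq hδ.le]
  have : 0 < Real.sqrt (s ^ 2 + 1 ^ 2) := Real.sqrt_pos.2 (by positivity)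
  field_simp

/-- The substitution `t = δ s` moves the scale into `k`, leaving the fixed weight `peakKernel 1` of
mass 2; then dominated convergence applies. -/
theorem tendsto_integral_peakKernel_mul {k : ℝ → ℝ} (hk : Continuous k) {C : ℝ}
    (hC : ∀ t, |k t| ≤ C) :
    Tendsto (fun δ => ∫ t, peakKernel δ t * k t) (𝓝[>] 0) (𝓝 (2 * k 0)) := by
  have h1 : Tendsto (fun δ => ∫ s, peakKernel 1 s * k (δ * s)) (𝓝[>] 0)
      (𝓝 (∫ s, peakKernel 1 s * k 0)) := by
    refine tendsto_integral_filter_of_dominated_convergence (fun s => peakKernel 1 s * C) ?_ ?_ ?_ ?_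
    · exact Eventually.of_forall fun δ => ((continuous_peakKernel one_ne_zero).mul
        (by fun_prop)).aestronglyMeasurable
    · refine Eventually.of_forall fun δ => Eventually.of_forall fun s => ?_
      rw [Real.norm_eq_abs, abs_mul, abs_of_nonneg (peakKernel_nonneg 1 s)]
      exact mul_le_mul_of_nonneg_left (hC _) (peakKernel_nonneg 1 s)
    · exact integrable_peakKernel_one.mul_const C
    · refine Eventually.of_forall fun s => ?_
      have : Continuous fun δ : ℝ => peakKernel 1 s * k (δ * s) := by fun_prop
      have h2 := (this.tendsto 0).mono_left (nhdsWithin_le_nhds (s := Ioi (0 : ℝ)))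
      simpa using h2
  rw [integral_mul_const, integral_peakKernel_one] at h1
  refine h1.congr' ?_
  filter_upwards [self_mem_nhdsWithin] with δ hδ
  have hδ : 0 < δ := hδ
  have h3 := Measure.integral_comp_mul_left (fun t => peakKernel δ t * k t) δ
  simp only [peakKernel_mul hδ, smul_eq_mul, mul_assoc, integral_const_mul] at h3
  rw [abs_of_pos (inv_pos.2 hδ)] at h3
  exact mul_left_cancel₀ (inv_pos.2 hδ).ne' h3

end PeakKernel

/-! ### The layer limit at a hyperplane -/

section Hyperplane

variable {E : Type*} [NormedAddCommGroup E] [InnerProductSpace ℝ E]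

theorem norm_smul_add_sq_of_unit {e : E} (he : ‖e‖ = 1) (t : ℝ) (w : (ℝ ∙ e)ᗮ) :
    ‖t • e + (w : E)‖ ^ 2 = t ^ 2 + ‖w‖ ^ 2 := by
  have h0 : inner ℝ e (w : E) = 0 := Submodule.mem_orthogonal_singleton_iff_inner_right.1 w.2
  rw [norm_add_sq_real, real_inner_smul_left, h0, norm_smul, he, Real.norm_eq_abs, mul_one, sq_abs]
  simp

/-- The orthogonal splitting of `E` along a unit vector. -/
noncomputable def unitSplitting (e : E) (he : ‖e‖ = 1) : WithLp 2 (ℝ × (ℝ ∙ e)ᗮ) ≃ₗᵢ[ℝ] E :=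
  LinearIsometryEquiv.ofSurjective
    { toFun := fun p => p.fst • e + (p.snd : E)
      map_add' := fun p q => by simp [add_smul]; abel
      map_smul' := fun c p => by simp [mul_smul]
      norm_map' := fun p => by
        rw [← sq_eq_sq₀ (norm_nonneg _) (norm_nonneg _), WithLp.prod_norm_sq_eq_of_L2]
        simpa using norm_smul_add_sq_of_unit he p.fst p.snd }
    (fun z => by
      refine ⟨WithLp.toLp 2 (inner ℝ e z, ⟨z - (inner ℝ e z : ℝ) • e, ?_⟩), ?_⟩
      · rw [Submodule.mem_orthogonal_singleton_iff_inner_right, inner_sub_right,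
          real_inner_smul_right, real_inner_self_eq_norm_sq, he]
        ring
      · simp)

variable [FiniteDimensional ℝ E] [MeasurableSpace E] [BorelSpace E]

theorem integral_eq_integral_integral_orthogonal {e : E} (he : ‖e‖ = 1) {g : E → ℝ}
    (hg : Integrable g) : ∫ z, g z = ∫ t : ℝ, ∫ w : (ℝ ∙ e)ᗮ, g (t • e + (w : E)) := by
  have h1 : MeasurePreserving (unitSplitting e he) := (unitSplitting e he).measurePreserving
  have h2 := WithLp.volume_preserving_toLp ℝ (ℝ ∙ e)ᗮ
  have h3 := h1.comp h2
  have hme : MeasurableEmbedding (unitSplitting e he ∘ WithLp.toLp 2) :=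
    (unitSplitting e he).toHomeomorph.measurableEmbedding.comp
      (WithLp.homeomorphProd 2 ℝ (ℝ ∙ e)ᗮ).symm.measurableEmbedding
  have h4 : Integrable (fun p : ℝ × (ℝ ∙ e)ᗮ => g ((unitSplitting e he ∘ WithLp.toLp 2) p))
      (volume.prod volume) := (h3.integrable_comp_emb hme).2 hg
  rw [← h3.integral_comp hme]
  exact integral_prod _ h4

/-- The Euclidean Hausdorff measure on the hyperplane, in its own dimension, is Lebesgue measure,
and isometric inclusions preserve Hausdorff measure. -/
theorem map_volume_orthogonal {e : E} {m : ℕ} (hm : Module.finrank ℝ (ℝ ∙ e)ᗮ = m) :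
    (volume : Measure (ℝ ∙ e)ᗮ).map (fun w : (ℝ ∙ e)ᗮ => (w : E)) =
      (Measure.euclideanHausdorffMeasure m).restrict ((ℝ ∙ e)ᗮ : Set E) := by
  subst hm
  have hiso : Isometry (fun w : (ℝ ∙ e)ᗮ => (w : E)) := fun _ _ => rfl
  rw [← InnerProductSpace.euclideanHausdorffMeasure_eq_volume, hiso.map_euclideanHausdorffMeasure]
  congr 1
  exact Subtype.range_coe

/-- By Fubini along `e` the integral becomes one-dimensional with weight `k(t)`, the integral of `h`
over the slice at height `t`. Compact support of `h` gives one integrable bound for all slices,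
hence continuity and boundedness of `k`. -/
theorem tendsto_integral_peakKernel_inner {e : E} (he : ‖e‖ = 1) {m : ℕ}
    (hm : Module.finrank ℝ (ℝ ∙ e)ᗮ = m) {h : E → ℝ} (hc : Continuous h)
    (hs : HasCompactSupport h) :
    Tendsto (fun δ => ∫ z, peakKernel δ (inner ℝ e z) * h z) (𝓝[>] 0)
      (𝓝 (2 * ∫ z in ((ℝ ∙ e)ᗮ : Set E), h z ∂(Measure.euclideanHausdorffMeasure m))) := by
  obtain ⟨C, hC⟩ := hs.exists_bound_of_continuous hc
  have hC0 : 0 ≤ C := (norm_nonneg _).trans (hC 0)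
  obtain ⟨R, hR⟩ := hs.isCompact.isBounded.subset_closedBall (0 : E)
  have hbd : ∀ (t : ℝ) (w : (ℝ ∙ e)ᗮ), ‖h (t • e + (w : E))‖ ≤
      (Metric.closedBall (0 : (ℝ ∙ e)ᗮ) R).indicator (fun _ => C) w := by
    intro t w
    by_cases hw : w ∈ Metric.closedBall (0 : (ℝ ∙ e)ᗮ) R
    · rw [indicator_of_mem hw]; exact hC _
    · rw [indicator_of_notMem hw]
      have : t • e + (w : E) ∉ tsupport h := by
        intro hmem
        have h1 := hR hmem
        rw [mem_closedBall_zero_iff] at h1 hw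
        have h2 := norm_smul_add_sq_of_unit he t w
        have h3 : ‖w‖ ^ 2 ≤ ‖t • e + (w : E)‖ ^ 2 := by rw [h2]; nlinarith [sq_nonneg t]
        have h4 := (sq_le_sq₀ (norm_nonneg _) (norm_nonneg _)).1 h3
        exact hw (h4.trans h1)
      rw [image_eq_zero_of_notMem_tsupport this, norm_zero]
  have hbi : Integrable ((Metric.closedBall (0 : (ℝ ∙ e)ᗮ) R).indicator (fun _ => C)) :=
    (integrable_indicator_iff Metric.isClosed_closedBall.measurableSet).2
      (integrableOn_const (isCompact_closedBall (0 : (ℝ ∙ e)ᗮ) R).measure_lt_top.ne)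
  set k : ℝ → ℝ := fun t => ∫ w : (ℝ ∙ e)ᗮ, h (t • e + (w : E)) with hk
  have hkc : Continuous k := by
    refine continuous_of_dominated (fun t => ?_) (fun t => Eventually.of_forall (hbd t)) hbi
      (Eventually.of_forall fun w => by fun_prop)
    exact Continuous.aestronglyMeasurable (by fun_prop)
  have hkb : ∀ t, |k t| ≤
      ∫ w : (ℝ ∙ e)ᗮ, (Metric.closedBall (0 : (ℝ ∙ e)ᗮ) R).indicator (fun _ => C) w := fun t =>
    norm_integral_le_of_norm_le hbi (Eventually.of_forall (hbd t))
  have hlim := tendsto_integral_peakKernel_mul hkc hkb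
  have hk0 : k 0 = ∫ z in ((ℝ ∙ e)ᗮ : Set E), h z ∂(Measure.euclideanHausdorffMeasure m) := by
    rw [← map_volume_orthogonal hm, integral_map (by fun_prop) hc.aestronglyMeasurable]
    simp [hk]
  rw [hk0] at hlim
  refine hlim.congr' ?_
  filter_upwards [self_mem_nhdsWithin] with δ hδ
  have hδ : δ ≠ 0 := (mem_Ioi.1 hδ).ne'
  have hcont : Continuous fun z : E => peakKernel δ (inner ℝ e z) * h z :=
    ((continuous_peakKernel hδ).comp (by fun_prop)).mul hc
  rw [integral_eq_integral_integral_orthogonal he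
    (hcont.integrable_of_hasCompactSupport hs.mul_left)]
  congr 1
  ext t
  rw [hk, ← integral_const_mul]
  congr 1
  ext w
  have h0 : inner ℝ e (w : E) = 0 := Submodule.mem_orthogonal_singleton_iff_inner_right.1 w.2
  rw [inner_add_right, h0, real_inner_smul_right, real_inner_self_eq_norm_sq, he]
  simp

end Hyperplane

/-! ### Hausdorff measure under Lipschitz and expanding maps -/

section HausdorffImage

variable {X Y : Type*} [EMetricSpace X] [MeasurableSpace X] [BorelSpace X]
  [EMetricSpace Y] [MeasurableSpace Y] [BorelSpace Y]

theorem _root_.LipschitzOnWith.euclideanHausdorffMeasure_image_le {K : ℝ≥0} {f : X → Y} {s : Set X}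
    (h : LipschitzOnWith K f s) (m : ℕ) :
    Measure.euclideanHausdorffMeasure m (f '' s) ≤
      (K : ℝ≥0∞) ^ m * Measure.euclideanHausdorffMeasure m s := by
  simp only [Measure.euclideanHausdorffMeasure_def, Measure.smul_apply]
  have := h.hausdorffMeasure_image_le (d := m) (by positivity)
  rw [ENNReal.rpow_natCast] at this
  rw [ENNReal.smul_def, ENNReal.smul_def, smul_eq_mul, smul_eq_mul, mul_left_comm]
  gcongr

end HausdorffImage

/-- The hypothesis makes `f` injective on `s` with a `K`-Lipschitz inverse on the image. -/
theorem euclideanHausdorffMeasure_le_of_expanding {E : Type*} [MetricSpace E] [MeasurableSpace E]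
    [BorelSpace E] {K : ℝ≥0} {f : E → E} {s : Set E}
    (h : ∀ x ∈ s, ∀ y ∈ s, dist x y ≤ K * dist (f x) (f y)) (m : ℕ) :
    Measure.euclideanHausdorffMeasure m s ≤
      (K : ℝ≥0∞) ^ m * Measure.euclideanHausdorffMeasure m (f '' s) := by
  rcases s.eq_empty_or_nonempty with rfl | ⟨x₀, _⟩
  · simp
  have : Nonempty E := ⟨x₀⟩
  have hinj : InjOn f s := fun x hx y hy hxy => by
    have := h x hx y hy
    rw [hxy, dist_self, mul_zero] at this
    exact dist_le_zero.1 this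
  have hL : LipschitzOnWith K (Function.invFunOn f s) (f '' s) := by
    refine LipschitzOnWith.of_dist_le_mul ?_
    rintro _ ⟨x, hx, rfl⟩ _ ⟨y, hy, rfl⟩
    rw [hinj.leftInvOn_invFunOn hx, hinj.leftInvOn_invFunOn hy]
    exact h x hx y hy
  have := hL.euclideanHausdorffMeasure_image_le m
  rwa [hinj.leftInvOn_invFunOn.image_image] at this

/-! ### The straightening map -/

section Straightening

variable {E : Type*} [NormedAddCommGroup E] [InnerProductSpace ℝ E]

/-- The map replacing the `e`-coordinate of a point by the value of `d`. -/
noncomputable def straighten (d : E → ℝ) (e : E) (x : E) : E := x + (d x - inner ℝ e x) • e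

theorem inner_straighten {d : E → ℝ} {e : E} (he : ‖e‖ = 1) (x : E) :
    inner ℝ e (straighten d e x) = d x := by
  rw [straighten, inner_add_right, real_inner_smul_right, real_inner_self_eq_norm_sq, he]
  ring

theorem hasFDerivAt_straighten {d : E → ℝ} {d' : E →L[ℝ] ℝ} {e x : E} (hd : HasFDerivAt d d' x) :
    HasFDerivAt (straighten d e)
      (ContinuousLinearMap.id ℝ E + (d' - innerSL ℝ e).smulRight e) x := by
  have h1 : HasFDerivAt (fun x => (inner ℝ e x : ℝ)) (innerSL ℝ e) x := (innerSL ℝ e).hasFDerivAt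
  exact (hasFDerivAt_id x).add ((hd.sub h1).smul_const e)

/-- The deviation from the identity is a multiple of `e` whose coefficient is the increment of `d -
⟨e, ·⟩`, controlled by the mean value inequality. This one estimate yields both the local
homeomorphism and the Lipschitz constants in the two directions. -/
theorem approximatesLinearOn_straighten {d : E → ℝ} {e : E} (he : ‖e‖ = 1) {V : Set E}
    (hV : Convex ℝ V) {η : ℝ≥0} (hd : ∀ x ∈ V, DifferentiableAt ℝ d x)
    (hη : ∀ x ∈ V, ‖fderiv ℝ d x - innerSL ℝ e‖ ≤ η) :
    ApproximatesLinearOn (straighten d e) ((ContinuousLinearEquiv.refl ℝ E : E →L[ℝ] E)) V η := by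
  intro x hx y hy
  have := hV.norm_image_sub_le_of_norm_hasFDerivWithin_le' (φ := innerSL ℝ e)
    (fun z hz => (hd z hz).hasFDerivAt.hasFDerivWithinAt) hη hy hx
  have h2 : straighten d e x - straighten d e y - (x - y) =
      (d x - d y - inner ℝ e (x - y)) • e := by
    simp only [straighten, inner_sub_right]
    module
  simp only [ContinuousLinearEquiv.coe_refl, ContinuousLinearMap.coe_id', id_eq]
  rw [h2, norm_smul, he, mul_one]
  exact this

variable [FiniteDimensional ℝ E]

/-- A rank-one perturbation of the identity along `e` has determinant `1 + (d' e - ⟨e, e⟩)`. -/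
theorem det_straighten_deriv (d' : E →L[ℝ] ℝ) {e : E} (he : ‖e‖ = 1) :
    (ContinuousLinearMap.id ℝ E + (d' - innerSL ℝ e).smulRight e).det = d' e := by
  have h1 := LinearMap.transvection.det ((d' - innerSL ℝ e : E →L[ℝ] ℝ) : E →ₗ[ℝ] ℝ) e
  have h2 : ((ContinuousLinearMap.id ℝ E + (d' - innerSL ℝ e).smulRight e : E →L[ℝ] E) : E →ₗ[ℝ] E)
      = LinearMap.transvection ((d' - innerSL ℝ e : E →L[ℝ] ℝ) : E →ₗ[ℝ] ℝ) e := by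
    ext v; simp [LinearMap.transvection]
  rw [ContinuousLinearMap.det, h2, h1]
  simp [he]

end Straightening

/-! ### Transport of test functions and auxiliary comparisons -/

section Transport

variable {E F : Type*} [TopologicalSpace E] [TopologicalSpace F] [T2Space F]

/-- Transport of a compactly supported function by a partial homeomorphism. -/
theorem exists_transport_of_tsupport_subset (Φ : OpenPartialHomeomorph E F) {f : E → ℝ}
    (hf : Continuous f) (hs : HasCompactSupport f) (hsub : tsupport f ⊆ Φ.source) :
    ∃ h : F → ℝ, Continuous h ∧ HasCompactSupport h ∧ (∀ x ∈ Φ.source, h (Φ x) = f x) ∧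
      ∀ z ∉ Φ.target, h z = 0 := by
  classical
  set h : F → ℝ := fun z => if z ∈ Φ.target then f (Φ.symm z) else 0 with hh
  have hK : IsCompact (Φ '' tsupport f) := hs.isCompact.image_of_continuousOn (Φ.continuousOn.mono hsub)
  have hzero : ∀ z ∉ Φ '' tsupport f, h z = 0 := by
    intro z hz
    simp only [hh]
    split_ifs with hzt
    · refine image_eq_zero_of_notMem_tsupport fun hmem => hz ⟨_, hmem, Φ.right_inv hzt⟩
    · rfl
  refine ⟨h, continuous_iff_continuousAt.2 fun z => ?_, HasCompactSupport.intro hK hzero, ?_, ?_⟩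
  · by_cases hz : z ∈ Φ.target
    · have : h =ᶠ[𝓝 z] fun z => f (Φ.symm z) := by
        filter_upwards [Φ.open_target.mem_nhds hz] with w hw
        simp [hh, hw]
      refine ContinuousAt.congr ?_ this.symm
      exact hf.continuousAt.comp (Φ.symm.continuousAt hz)
    · have hz' : z ∉ Φ '' tsupport f := by
        rintro ⟨x, hx, rfl⟩
        exact hz (Φ.map_source (hsub hx))
      have : h =ᶠ[𝓝 z] fun _ => 0 := by
        filter_upwards [hK.isClosed.isOpen_compl.mem_nhds hz'] with w hw
        exact hzero w hw
      exact continuousAt_const.congr this.symm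
  · intro x hx
    simp [hh, Φ.map_source hx, Φ.left_inv hx]
  · intro z hz
    simp [hh, hz]

end Transport

theorem integral_le_mul_of_measure_le_smul {E : Type*} [MeasurableSpace E] {μ ν : Measure E}
    {q : ℝ} (hq : 0 ≤ q) (hμν : μ ≤ ENNReal.ofReal q • ν) {h : E → ℝ} (h0 : 0 ≤ h)
    (hi : Integrable h ν) : ∫ x, h x ∂μ ≤ q * ∫ x, h x ∂ν := by
  have h1 := integral_mono_measure hμν (Eventually.of_forall h0)
    (hi.smul_measure ENNReal.ofReal_ne_top)
  rwa [integral_smul_measure, ENNReal.toReal_ofReal hq, smul_eq_mul] at h1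

theorem measurableSet_levelSet {E : Type*} [TopologicalSpace E] [MeasurableSpace E] [BorelSpace E]
    {d : E → ℝ} {W : Set E} (hW : IsOpen W) (hd : ContinuousOn d W) (c : ℝ) :
    MeasurableSet ({x | d x = c} ∩ W) := by
  have h1 : IsOpen (W ∩ d ⁻¹' {c}ᶜ) := hd.isOpen_inter_preimage hW isOpen_compl_singleton
  have : {x | d x = c} ∩ W = W \ (W ∩ d ⁻¹' {c}ᶜ) := by
    ext x
    constructor
    · rintro ⟨h1, h2⟩
      exact ⟨h2, fun h => h.2 h1⟩
    · rintro ⟨h1, h2⟩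
      exact ⟨by_contra fun h => h2 ⟨h1, h⟩, h1⟩
  rw [this]
  exact hW.measurableSet.diff h1.measurableSet

/-- All four expressions are continuous in `η` and equal 1 at 0. The first powers serve for the
Jacobian of the straightening map, the `m`-th powers for `m`-dimensional Hausdorff measure. -/
theorem exists_ratio_bounds {q : ℝ} (hq : 1 < q) (m : ℕ) : ∃ η : ℝ, 0 < η ∧ η < 1 ∧ 1 + η ≤ q ∧
    (1 - η)⁻¹ ≤ q ∧ (1 + η) ^ m ≤ q ∧ ((1 - η)⁻¹) ^ m ≤ q := by
  have c1 : ContinuousAt (fun η : ℝ => 1 + η) 0 := by fun_prop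
  have c2 : ContinuousAt (fun η : ℝ => (1 - η)⁻¹) 0 :=
    ContinuousAt.inv₀ (by fun_prop) (by norm_num)
  have e1 := c1.eventually_le_const (u := q) (by simpa using hq)
  have e2 := c2.eventually_le_const (u := q) (by simpa using hq)
  have e3 := (c1.pow m).eventually_le_const (u := q) (by simpa using hq)
  have e4 := (c2.pow m).eventually_le_const (u := q) (by simpa using hq)
  have e5 : ∀ᶠ η : ℝ in 𝓝 0, η < 1 := gt_mem_nhds one_pos
  have := ((e1.and (e2.and (e3.and (e4.and e5)))).filter_mono
    (nhdsWithin_le_nhds (s := Ioi (0 : ℝ)))).and self_mem_nhdsWithin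
  obtain ⟨η, ⟨h1, h2, h3, h4, h5⟩, h6⟩ := this.exists
  exact ⟨η, h6, h5, h1, h2, h3, h4⟩

/-! ### Local comparison with the flat layer -/

section LocalArea

variable {E : Type*} [NormedAddCommGroup E] [InnerProductSpace ℝ E]

theorem exists_ball_norm_fderiv_sub_le {d : E → ℝ} {W : Set E} (hW : IsOpen W)
    (hd : ContDiffOn ℝ 1 d W) {x₁ : E} (hx₁ : x₁ ∈ W) {η : ℝ} (hη : 0 < η) :
    ∃ r > 0, Metric.ball x₁ r ⊆ W ∧ (∀ x ∈ Metric.ball x₁ r, DifferentiableAt ℝ d x) ∧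
      ∀ x ∈ Metric.ball x₁ r, ‖fderiv ℝ d x - fderiv ℝ d x₁‖ ≤ η := by
  have hc : ContinuousAt (fderiv ℝ d) x₁ :=
    (hd.continuousOn_fderiv_of_isOpen hW le_rfl).continuousAt (hW.mem_nhds hx₁)
  have e1 : ∀ᶠ x in 𝓝 x₁, x ∈ W ∧ ‖fderiv ℝ d x - fderiv ℝ d x₁‖ ≤ η := by
    filter_upwards [hW.mem_nhds hx₁, hc.eventually (Metric.closedBall_mem_nhds _ hη)] with x h1 h2
    exact ⟨h1, by rwa [← dist_eq_norm]⟩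
  obtain ⟨r, hr, h⟩ := Metric.eventually_nhds_iff_ball.1 e1
  exact ⟨r, hr, fun x hx => (h x hx).1, fun x hx =>
    (hd.differentiableOn one_ne_zero).differentiableAt (hW.mem_nhds (h x hx).1), fun x hx => (h x hx).2⟩

variable [MeasurableSpace E] [BorelSpace E]

/-- The surface measure of a level set is comparable, with ratio close to one, to the surface
measure of its image under the straightening map. -/
theorem straighten_measure_comparison {d : E → ℝ} {e : E} (he : ‖e‖ = 1) {V S : Set E} {η q : ℝ}
    {m : ℕ} (hη : 0 < η) (hη1 : η < 1) (h1 : (1 + η) ^ m ≤ q) (h2 : ((1 - η)⁻¹) ^ m ≤ q)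
    (hV : Convex ℝ V) (hd : ∀ x ∈ V, DifferentiableAt ℝ d x)
    (hdη : ∀ x ∈ V, ‖fderiv ℝ d x - innerSL ℝ e‖ ≤ η) (hSV : S ⊆ V) (hS : MeasurableSet S) :
    ((Measure.euclideanHausdorffMeasure m).restrict (straighten d e '' S) ≤ ENNReal.ofReal q •
      ((Measure.euclideanHausdorffMeasure m).restrict S).map (straighten d e)) ∧
    (((Measure.euclideanHausdorffMeasure m).restrict S).map (straighten d e) ≤ ENNReal.ofReal q •
      (Measure.euclideanHausdorffMeasure m).restrict (straighten d e '' S)) := by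
  have happ := approximatesLinearOn_straighten (η := ⟨η, hη.le⟩) he hV hd hdη
  have hcont : ContinuousOn (straighten d e) V := happ.continuousOn
  have key : ∀ x ∈ V, ∀ y ∈ V, ‖straighten d e x - straighten d e y - (x - y)‖ ≤ η * ‖x - y‖ :=
    fun x hx y hy => happ x hx y hy
  have hlip : LipschitzOnWith ⟨1 + η, by positivity⟩ (straighten d e) V := by
    refine LipschitzOnWith.of_dist_le_mul fun x hx y hy => ?_
    rw [dist_eq_norm, dist_eq_norm]
    have k1 := key x hx y hy
    have k2 := norm_le_norm_sub_add (straighten d e x - straighten d e y) (x - y)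
    change _ ≤ (1 + η) * ‖x - y‖
    linarith
  have hη1' : 0 < 1 - η := by linarith
  have hexp : ∀ x ∈ V, ∀ y ∈ V, dist x y ≤ ((⟨(1 - η)⁻¹, by positivity⟩ : ℝ≥0) : ℝ) *
      dist (straighten d e x) (straighten d e y) := by
    intro x hx y hy
    rw [dist_eq_norm, dist_eq_norm]
    have k1 := key x hx y hy
    have k2 := norm_sub_norm_le (x - y) (straighten d e x - straighten d e y)
    rw [norm_sub_rev (x - y) (straighten d e x - straighten d e y)] at k2
    change _ ≤ (1 - η)⁻¹ * _
    rw [← div_eq_inv_mul, le_div_iff₀ hη1']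
    linarith
  have hae : AEMeasurable (straighten d e) ((Measure.euclideanHausdorffMeasure m).restrict S) :=
    (hcont.mono hSV).aemeasurable hS
  have hpow : ∀ {K : ℝ≥0}, (K : ℝ) ^ m ≤ q → (K : ℝ≥0∞) ^ m ≤ ENNReal.ofReal q := by
    intro K hK
    rw [← ENNReal.ofReal_coe_nnreal, ← ENNReal.ofReal_pow K.coe_nonneg]
    exact ENNReal.ofReal_le_ofReal hK
  constructor
  · refine Measure.le_iff.2 fun B hB => ?_
    rw [Measure.smul_apply, Measure.map_apply_of_aemeasurable hae hB, Measure.restrict_apply' hS,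
      Measure.restrict_apply hB, smul_eq_mul]
    have : B ∩ straighten d e '' S = straighten d e '' (straighten d e ⁻¹' B ∩ S) := by
      rw [image_preimage_inter]
    rw [this]
    refine ((hlip.mono (inter_subset_right.trans hSV)).euclideanHausdorffMeasure_image_le m).trans ?_
    gcongr
    exact hpow h1
  · refine Measure.le_iff.2 fun B hB => ?_
    rw [Measure.smul_apply, Measure.map_apply_of_aemeasurable hae hB, Measure.restrict_apply' hS,
      Measure.restrict_apply hB, smul_eq_mul]
    have : B ∩ straighten d e '' S = straighten d e '' (straighten d e ⁻¹' B ∩ S) := by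
      rw [image_preimage_inter]
    rw [this]
    refine (euclideanHausdorffMeasure_le_of_expanding
      (fun x hx y hy => hexp x (hSV hx.2) y (hSV hy.2)) m).trans ?_
    gcongr
    exact hpow h2

variable [FiniteDimensional ℝ E]

theorem euclideanHausdorffMeasure_orthogonal_inter_closedBall_lt_top {e : E} {m : ℕ}
    (hm : Module.finrank ℝ (ℝ ∙ e)ᗮ = m) (R : ℝ) :
    Measure.euclideanHausdorffMeasure m (((ℝ ∙ e)ᗮ : Set E) ∩ Metric.closedBall 0 R) < ⊤ := by
  rw [inter_comm, ← Measure.restrict_apply Metric.isClosed_closedBall.measurableSet,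
    ← map_volume_orthogonal hm, Measure.map_apply (by fun_prop)
      Metric.isClosed_closedBall.measurableSet]
  have : (fun w : (ℝ ∙ e)ᗮ => (w : E)) ⁻¹' Metric.closedBall 0 R = Metric.closedBall 0 R := by
    ext w; simp
  rw [this]
  exact (isCompact_closedBall _ _).measure_lt_top

/-- Local comparison of thin-layer integrals and surface integrals along a level set of a function
with unit gradient. -/
theorem exists_nhds_layer_comparison {m : ℕ} (hm : Module.finrank ℝ E = m + 1) {d : E → ℝ}
    {W : Set E} (hW : IsOpen W) (hd : ContDiffOn ℝ 1 d W) (hg : ∀ x ∈ W, ‖∇ d x‖ = 1) {x₁ : E}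
    (hx₁ : x₁ ∈ W) {q : ℝ} (hq : 1 < q) :
    ∃ V : Set E, IsOpen V ∧ x₁ ∈ V ∧ V ⊆ W ∧
      Measure.euclideanHausdorffMeasure m ({x | d x = 0} ∩ V) < ⊤ ∧
      ∀ F : E → ℝ, Continuous F → HasCompactSupport F → tsupport F ⊆ V → 0 ≤ F →
        ∃ (M : ℝ) (T : ℝ → ℝ),
          M ≤ q * ∫ x in {x | d x = 0} ∩ V, F x ∂(Measure.euclideanHausdorffMeasure m) ∧
          ∫ x in {x | d x = 0} ∩ V, F x ∂(Measure.euclideanHausdorffMeasure m) ≤ q * M ∧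
          Tendsto T (𝓝[>] 0) (𝓝 (2 * M)) ∧
          ∀ δ > 0, ∫ x, peakKernel δ (d x) * F x ≤ q * T δ ∧
            T δ ≤ q * ∫ x, peakKernel δ (d x) * F x := by
  obtain ⟨η, hη, hη1, hq1, hq2, hqm1, hqm2⟩ := exists_ratio_bounds hq m
  set e := ∇ d x₁ with he_def
  have he : ‖e‖ = 1 := hg x₁ hx₁
  have hee : fderiv ℝ d x₁ = innerSL ℝ e := by
    ext v; simp [he_def]
  obtain ⟨r, hr, hrW, hdiff, hdη⟩ := exists_ball_norm_fderiv_sub_le hW hd hx₁ hη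
  rw [hee] at hdη
  set V := Metric.ball x₁ r with hVdef
  have hVc : Convex ℝ V := convex_ball _ _
  have hVo : IsOpen V := Metric.isOpen_ball
  have happ := approximatesLinearOn_straighten (η := ⟨η, hη.le⟩) he hVc hdiff hdη
  have hfact : Fact (Module.finrank ℝ E = m + 1) := ⟨hm⟩
  have hm' : Module.finrank ℝ (ℝ ∙ e)ᗮ = m :=
    Submodule.finrank_orthogonal_span_singleton (norm_ne_zero_iff.1 (by rw [he]; exact one_ne_zero))
  have hη' : (⟨η, hη.le⟩ : ℝ≥0) < ‖(((ContinuousLinearEquiv.refl ℝ E).symm : E →L[ℝ] E))‖₊⁻¹ := by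
    have hnt : Nontrivial E := Module.nontrivial_of_finrank_pos (R := ℝ) (by omega)
    have : ‖(((ContinuousLinearEquiv.refl ℝ E).symm : E →L[ℝ] E))‖₊ = 1 := by
      apply NNReal.eq
      exact ContinuousLinearMap.norm_id
    rw [this, inv_one]
    exact hη1
  set Φ := happ.toOpenPartialHomeomorph (straighten d e) V (Or.inr hη') hVo with hΦ
  have hΦc : ∀ x, Φ x = straighten d e x := fun _ => rfl
  have hΦs : Φ.source = V := rfl
  have hΦt : Φ.target = straighten d e '' V := rfl
  -- The `e`-coordinate of the straightened point is `d x`, so the zero set of `d` goes to the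
  -- hyperplane orthogonal to `e`.
  have himg : straighten d e '' ({x | d x = 0} ∩ V) = ((ℝ ∙ e)ᗮ : Set E) ∩ Φ.target := by
    ext z
    constructor
    · rintro ⟨x, ⟨hx0, hxV⟩, rfl⟩
      refine ⟨?_, Φ.map_source hxV⟩
      rw [SetLike.mem_coe, Submodule.mem_orthogonal_singleton_iff_inner_right, inner_straighten he]
      exact hx0
    · rintro ⟨hz, x, hxV, rfl⟩
      rw [SetLike.mem_coe, Submodule.mem_orthogonal_singleton_iff_inner_right,
        inner_straighten he] at hz
      exact ⟨x, ⟨hz, hxV⟩, rfl⟩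
  have hSm : MeasurableSet ({x | d x = 0} ∩ V) :=
    measurableSet_levelSet hVo (hd.continuousOn.mono hrW) 0
  obtain ⟨hle1, hle2⟩ := straighten_measure_comparison (m := m) he hη hη1 hqm1 hqm2 hVc hdiff hdη
    inter_subset_right hSm
  set κ := ((Measure.euclideanHausdorffMeasure m).restrict ({x | d x = 0} ∩ V)).map
    (straighten d e) with hκ
  set κ' := (Measure.euclideanHausdorffMeasure m).restrict
    (straighten d e '' ({x | d x = 0} ∩ V)) with hκ'
  have hae : AEMeasurable (straighten d e)
      ((Measure.euclideanHausdorffMeasure m).restrict ({x | d x = 0} ∩ V)) :=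
    (happ.continuousOn.mono inter_subset_right).aemeasurable hSm
  -- The straightened piece is bounded inside a hyperplane, so its measure is finite; the comparison
  -- then transfers finiteness to the level set.
  have hfin' : IsFiniteMeasure κ' := by
    obtain ⟨R, hR⟩ : ∃ R, straighten d e '' V ⊆ Metric.closedBall 0 R := by
      refine ⟨‖straighten d e x₁‖ + (1 + η) * r, ?_⟩
      rintro _ ⟨x, hx, rfl⟩
      have h1 : ‖straighten d e x - straighten d e x₁ - (x - x₁)‖ ≤ η * ‖x - x₁‖ :=
        happ x hx x₁ (Metric.mem_ball_self hr)
      have h2 : ‖x - x₁‖ < r := by rwa [hVdef, mem_ball_iff_norm] at hx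
      have h3 := norm_le_norm_sub_add (straighten d e x - straighten d e x₁) (x - x₁)
      have h4 := norm_le_norm_sub_add (straighten d e x) (straighten d e x₁)
      have h5 : η * ‖x - x₁‖ ≤ η * r := by gcongr
      rw [mem_closedBall_zero_iff]
      linarith
    refine ⟨?_⟩
    rw [hκ', Measure.restrict_apply_univ]
    refine lt_of_le_of_lt (measure_mono ?_)
      (euclideanHausdorffMeasure_orthogonal_inter_closedBall_lt_top hm' R)
    rw [himg, hΦt]
    exact inter_subset_inter_right _ hR
  have hfin : IsFiniteMeasure κ := by
    refine ⟨lt_of_le_of_lt (hle2 univ) ?_⟩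
    rw [Measure.smul_apply, smul_eq_mul]
    exact ENNReal.mul_lt_top ENNReal.ofReal_lt_top (measure_lt_top κ' univ)
  refine ⟨V, hVo, Metric.mem_ball_self hr, hrW, ?_, ?_⟩
  · have := measure_lt_top κ univ
    rwa [hκ, Measure.map_apply_of_aemeasurable hae MeasurableSet.univ, preimage_univ,
      Measure.restrict_apply_univ] at this
  intro F hFc hFs hFV hF0
  obtain ⟨h, hhc, hhs, hhF, hhz⟩ := exists_transport_of_tsupport_subset Φ hFc hFs hFV
  have hh0 : 0 ≤ h := by
    intro z
    by_cases hz : z ∈ Φ.target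
    · rw [hΦt] at hz
      obtain ⟨x, hx, rfl⟩ := hz
      have := hhF x hx
      rw [hΦc] at this
      rw [this]; exact hF0 x
    · rw [hhz z hz]; simp
  have hhi : ∀ μ : Measure E, IsFiniteMeasure μ → Integrable h μ := fun μ _ =>
    hhc.integrable_of_hasCompactSupport hhs
  have hN : ∫ x in {x | d x = 0} ∩ V, F x ∂(Measure.euclideanHausdorffMeasure m) = ∫ z, h z ∂κ := by
    rw [hκ, integral_map hae hhc.aestronglyMeasurable]
    exact setIntegral_congr_fun hSm fun x hx => (hhF x hx.2).symm
  have hM : ∫ z in ((ℝ ∙ e)ᗮ : Set E), h z ∂(Measure.euclideanHausdorffMeasure m) =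
      ∫ z, h z ∂κ' := by
    rw [hκ', himg]
    refine setIntegral_eq_of_subset_of_forall_sdiff_eq_zero
      (Submodule.closed_of_finiteDimensional _).measurableSet inter_subset_left ?_
    rintro z ⟨hz1, hz2⟩
    exact hhz z fun hz => hz2 ⟨hz1, hz⟩
  have hq0 : 0 ≤ q := by linarith
  -- `M` and `T` are the surface and layer integrals of the transported function in the flat
  -- picture. Surface integrals are compared through Hausdorff measure, layer integrals through the
  -- change of variables.
  refine ⟨∫ z, h z ∂κ', fun δ => ∫ z, peakKernel δ (inner ℝ e z) * h z, ?_, ?_, ?_, ?_⟩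
  · rw [hN]
    exact integral_le_mul_of_measure_le_smul hq0 hle1 hh0 (hhi κ hfin)
  · rw [hN]
    exact integral_le_mul_of_measure_le_smul hq0 hle2 hh0 (hhi κ' hfin')
  · rw [← hM]
    exact tendsto_integral_peakKernel_inner he hm' hhc hhs
  intro δ hδ
  -- Change of variables by the straightening map, with Jacobian `|∂ₑd|`, which lies between `1 - η`
  -- and `1 + η`.
  have hT : ∫ z, peakKernel δ (inner ℝ e z) * h z =
      ∫ x in V, |fderiv ℝ d x e| * (peakKernel δ (d x) * F x) := by
    have hsub : ∫ z, peakKernel δ (inner ℝ e z) * h z =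
        ∫ z in straighten d e '' V, peakKernel δ (inner ℝ e z) * h z := by
      refine (setIntegral_eq_integral_of_forall_compl_eq_zero fun z hz => ?_).symm
      rw [hhz z hz, mul_zero]
    rw [hsub, integral_image_eq_integral_abs_det_fderiv_smul volume hVo.measurableSet
      (fun x hx => (hasFDerivAt_straighten (hdiff x hx).hasFDerivAt).hasFDerivWithinAt)
      (Φ.injOn)]
    refine setIntegral_congr_fun hVo.measurableSet fun x hx => ?_
    have := hhF x hx
    rw [hΦc] at this
    simp only [det_straighten_deriv _ he, inner_straighten he, this, smul_eq_mul]
  have hI : ∫ x, peakKernel δ (d x) * F x = ∫ x in V, peakKernel δ (d x) * F x := by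
    refine (setIntegral_eq_integral_of_forall_compl_eq_zero fun x hx => ?_).symm
    rw [image_eq_zero_of_notMem_tsupport fun hmem => hx (hFV hmem), mul_zero]
  have hdet : ∀ x ∈ V, |fderiv ℝ d x e - 1| ≤ η := by
    intro x hx
    have h1 := (fderiv ℝ d x - innerSL ℝ e).le_opNorm e
    rw [he, mul_one] at h1
    have h2 : (fderiv ℝ d x - innerSL ℝ e) e = fderiv ℝ d x e - 1 := by simp [he]
    rw [h2, Real.norm_eq_abs] at h1
    exact h1.trans (hdη x hx)
  have hnn : ∀ x, 0 ≤ peakKernel δ (d x) * F x := fun x =>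
    mul_nonneg (peakKernel_nonneg _ _) (hF0 x)
  have hdc : ContinuousOn d V := hd.continuousOn.mono hrW
  have hcomp : IntegrableOn (fun x => peakKernel δ (d x) * F x) V := by
    have hc : ContinuousOn (fun x => peakKernel δ (d x) * F x) (tsupport F) :=
      ((continuous_peakKernel hδ.ne').comp_continuousOn (hdc.mono hFV)).mul hFc.continuousOn
    have h1 : IntegrableOn (fun x => peakKernel δ (d x) * F x) (tsupport F) :=
      hc.integrableOn_compact hFs
    refine (h1.of_forall_sdiff_eq_zero hVo.measurableSet fun x hx => ?_)
    rw [image_eq_zero_of_notMem_tsupport hx.2, mul_zero]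
  have hcompJ : IntegrableOn (fun x => |fderiv ℝ d x e| * (peakKernel δ (d x) * F x)) V := by
    -- The constant 2 bounds the Jacobian, as `1 + η < 2`.
    refine Integrable.mono (hcomp.const_mul 2) ?_ ?_
    · refine AEStronglyMeasurable.mul ?_ hcomp.aestronglyMeasurable
      have hc : ContinuousOn (fun x => |fderiv ℝ d x e|) V :=
        (((hd.continuousOn_fderiv_of_isOpen hW le_rfl).mono hrW).clm_apply continuousOn_const).abs
      exact hc.aestronglyMeasurable hVo.measurableSet
    · refine (ae_restrict_iff' hVo.measurableSet).2 (Eventually.of_forall fun x hx => ?_)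
      rw [norm_mul, norm_mul (2 : ℝ)]
      have := abs_le.1 (hdet x hx)
      refine mul_le_mul_of_nonneg_right ?_ (norm_nonneg _)
      rw [Real.norm_eq_abs, abs_abs, Real.norm_eq_abs, abs_two, abs_le]
      constructor <;> linarith
  beta_reduce
  rw [hT, hI, ← integral_const_mul, ← integral_const_mul]
  constructor
  · refine setIntegral_mono_on hcomp (hcompJ.const_mul q) hVo.measurableSet fun x hx => ?_
    have h1 := abs_le.1 (hdet x hx)
    have h2 : 1 - η ≤ |fderiv ℝ d x e| := le_trans (by linarith) (le_abs_self _)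
    have h3 : 1 ≤ q * |fderiv ℝ d x e| := by
      have h4 : 0 < 1 - η := by linarith
      calc (1 : ℝ) = (1 - η)⁻¹ * (1 - η) := by field_simp
        _ ≤ q * |fderiv ℝ d x e| := by gcongr
    rw [← mul_assoc]
    exact le_mul_of_one_le_left (hnn x) h3
  · refine setIntegral_mono_on hcompJ (hcomp.const_mul q) hVo.measurableSet fun x hx => ?_
    have h1 := abs_le.1 (hdet x hx)
    refine mul_le_mul_of_nonneg_right ?_ (hnn x)
    rw [abs_le]
    constructor <;> linarith

end LocalArea

theorem integrable_mul_of_tsupport_subset {X : Type*} [TopologicalSpace X] [T2Space X]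
    [MeasurableSpace X] [BorelSpace X] {μ : Measure X} [IsFiniteMeasureOnCompacts μ]
    {g F : X → ℝ} {W : Set X} (hg : ContinuousOn g W) (hF : Continuous F)
    (hFs : HasCompactSupport F) (hFW : tsupport F ⊆ W) : Integrable (fun x => g x * F x) μ := by
  have hc : ContinuousOn (fun x => g x * F x) (tsupport F) :=
    (hg.mono hFW).mul hF.continuousOn
  rw [← integrableOn_univ]
  refine (hc.integrableOn_compact hFs).of_forall_sdiff_eq_zero MeasurableSet.univ fun x hx => ?_
  rw [image_eq_zero_of_notMem_tsupport hx.2, mul_zero]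

/-! ### The layer limit at a curved level set -/

section Coarea

variable {E : Type*} [NormedAddCommGroup E] [InnerProductSpace ℝ E] [FiniteDimensional ℝ E]
  [MeasurableSpace E] [BorelSpace E] {m : ℕ} {d : E → ℝ} {W : Set E}

/-- Finiteness is local and compactness sums it up. Only the finiteness clause of the local
comparison is needed, so the ratio 2 is arbitrary. -/
theorem euclideanHausdorffMeasure_levelSet_inter_lt_top (hm : Module.finrank ℝ E = m + 1)
    (hW : IsOpen W) (hd : ContDiffOn ℝ 1 d W) (hg : ∀ x ∈ W, ‖∇ d x‖ = 1) {K : Set E}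
    (hK : IsCompact K) (hKW : K ⊆ W) :
    Measure.euclideanHausdorffMeasure m ({x | d x = 0} ∩ K) < ⊤ := by
  refine hK.induction_on (p := fun K => Measure.euclideanHausdorffMeasure m
    ({x | d x = 0} ∩ K) < ⊤) (by simp) ?_ ?_ ?_
  · intro s t hst ht
    exact lt_of_le_of_lt (measure_mono (inter_subset_inter_right _ hst)) ht
  · intro s t hs ht
    rw [inter_union_distrib_left]
    exact measure_union_lt_top hs ht
  · intro x hx
    obtain ⟨V, hVo, hxV, -, hfin, -⟩ :=
      exists_nhds_layer_comparison hm hW hd hg (hKW hx) one_lt_two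
    exact ⟨V, mem_nhdsWithin_of_mem_nhds (hVo.mem_nhds hxV), hfin⟩

/-- Comparison of thin-layer integrals and surface integrals with ratio arbitrarily close to one. -/
theorem exists_layer_comparison (hm : Module.finrank ℝ E = m + 1)
    (hW : IsOpen W) (hd : ContDiffOn ℝ 1 d W) (hg : ∀ x ∈ W, ‖∇ d x‖ = 1) {q : ℝ} (hq : 1 < q)
    {F : E → ℝ} (hF : Continuous F) (hFs : HasCompactSupport F) (hFW : tsupport F ⊆ W)
    (hF0 : 0 ≤ F) :
    ∃ (M : ℝ) (T : ℝ → ℝ),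
      M ≤ q * ∫ x in {x | d x = 0} ∩ W, F x ∂(Measure.euclideanHausdorffMeasure m) ∧
      ∫ x in {x | d x = 0} ∩ W, F x ∂(Measure.euclideanHausdorffMeasure m) ≤ q * M ∧
      Tendsto T (𝓝[>] 0) (𝓝 (2 * M)) ∧
      ∀ δ > 0, ∫ x, peakKernel δ (d x) * F x ≤ q * T δ ∧
        T δ ≤ q * ∫ x, peakKernel δ (d x) * F x := by
  choose! V hVo hxV hVW hVfin hV using fun x hx =>
    exists_nhds_layer_comparison hm hW hd hg (x₁ := x) hx hq
  obtain ⟨t, htK, htc⟩ := hFs.isCompact.elim_nhds_subcover V fun x hx =>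
    (hVo x (hFW hx)).mem_nhds (hxV x (hFW hx))
  -- Nonnegative pieces keep each two-sided comparison with the same ratio `q`, so the comparisons
  -- add up to one for `F`, with `M` and `T` the sums.
  obtain ⟨f, hfsub, hfs⟩ := PartitionOfUnity.exists_isSubordinate_of_locallyFinite_t2space
    hFs.isCompact (fun x : t => V x) (fun x => hVo x (hFW (htK x x.2)))
    (locallyFinite_of_finite _) (by simpa [iUnion_subtype] using htc)
  have hWm : ∀ x : t, (x : E) ∈ W := fun x => hFW (htK x x.2)
  set G : t → E → ℝ := fun i x => f i x * F x with hG
  have hGc : ∀ i, Continuous (G i) := fun i => (f i).continuous.mul hF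
  have hGs : ∀ i, HasCompactSupport (G i) := fun i => hFs.mul_left
  have hG0 : ∀ i, 0 ≤ G i := fun i x => mul_nonneg (f.nonneg i x) (hF0 x)
  have hGV : ∀ i, tsupport (G i) ⊆ V i := fun i =>
    (tsupport_mul_subset_left).trans (hfsub i)
  have hGW : ∀ i, tsupport (G i) ⊆ W := fun i => (hGV i).trans (hVW i (hWm i))
  have hFG : ∀ x, F x = ∑ i, G i x := by
    intro x
    simp only [hG, ← Finset.sum_mul]
    by_cases hx : x ∈ tsupport F
    · have := f.sum_eq_one hx
      rw [finsum_eq_sum_of_fintype] at this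
      rw [this, one_mul]
    · rw [image_eq_zero_of_notMem_tsupport hx, mul_zero]
  choose M T hM1 hM2 hT hI using fun i : t =>
    hV i (hWm i) (G i) (hGc i) (hGs i) (hGV i) (hG0 i)
  have hlevel : MeasurableSet ({x | d x = 0} ∩ W) := measurableSet_levelSet hW hd.continuousOn 0
  have hNi : ∀ i : t, ∫ x in {x | d x = 0} ∩ V i, G i x ∂(Measure.euclideanHausdorffMeasure m) =
      ∫ x in {x | d x = 0} ∩ W, G i x ∂(Measure.euclideanHausdorffMeasure m) := by
    intro i
    refine (setIntegral_eq_of_subset_of_forall_sdiff_eq_zero hlevel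
      (inter_subset_inter_right _ (hVW i (hWm i))) ?_).symm
    rintro x ⟨hx1, hx2⟩
    exact image_eq_zero_of_notMem_tsupport fun hx => hx2 ⟨hx1.1, hGV i hx⟩
  have hGi : ∀ i : t, IntegrableOn (G i) ({x | d x = 0} ∩ W) (Measure.euclideanHausdorffMeasure m) := by
    intro i
    have : IsFiniteMeasure
        ((Measure.euclideanHausdorffMeasure m).restrict ({x | d x = 0} ∩ V i)) :=
      ⟨by rw [Measure.restrict_apply_univ]; exact hVfin i (hWm i)⟩
    have h1 : IntegrableOn (G i) ({x | d x = 0} ∩ V i) (Measure.euclideanHausdorffMeasure m) :=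
      (hGc i).integrable_of_hasCompactSupport (hGs i)
    refine h1.of_forall_sdiff_eq_zero hlevel ?_
    rintro x ⟨hx1, hx2⟩
    exact image_eq_zero_of_notMem_tsupport fun hx => hx2 ⟨hx1.1, hGV i hx⟩
  have hN : ∫ x in {x | d x = 0} ∩ W, F x ∂(Measure.euclideanHausdorffMeasure m) =
      ∑ i : t, ∫ x in {x | d x = 0} ∩ V i, G i x ∂(Measure.euclideanHausdorffMeasure m) := by
    simp only [hNi, hFG]
    exact integral_finsetSum _ fun i _ => hGi i
  have hIs : ∀ δ > 0, ∫ x, peakKernel δ (d x) * F x =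
      ∑ i : t, ∫ x, peakKernel δ (d x) * G i x := by
    intro δ hδ
    simp only [hFG, Finset.mul_sum]
    exact integral_finsetSum _ fun i _ => integrable_mul_of_tsupport_subset
      ((continuous_peakKernel hδ.ne').comp_continuousOn hd.continuousOn) (hGc i) (hGs i) (hGW i)
  refine ⟨∑ i : t, M i, fun δ => ∑ i : t, T i δ, ?_, ?_, ?_, fun δ hδ => ⟨?_, ?_⟩⟩
  · rw [hN, Finset.mul_sum]
    exact Finset.sum_le_sum fun i _ => hM1 i
  · rw [hN, Finset.mul_sum]
    exact Finset.sum_le_sum fun i _ => hM2 i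
  · rw [Finset.mul_sum]
    exact tendsto_finsetSum _ fun i _ => hT i
  · rw [hIs δ hδ, Finset.mul_sum]
    exact Finset.sum_le_sum fun i _ => (hI i δ hδ).1
  · rw [hIs δ hδ, Finset.mul_sum]
    exact Finset.sum_le_sum fun i _ => (hI i δ hδ).2

theorem exists_one_lt_sq_mul_lt {a b : ℝ} (hab : a < b) : ∃ q : ℝ, 1 < q ∧ q ^ 2 * a < b := by
  have c : ContinuousAt (fun q : ℝ => q ^ 2 * a) 1 := by fun_prop
  have h1 := c.eventually_lt_const (u := b) (by simpa using hab)
  obtain ⟨q, h, hq⟩ := ((h1.filter_mono (nhdsWithin_le_nhds (s := Ioi (1 : ℝ)))).and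
    self_mem_nhdsWithin).exists
  exact ⟨q, hq, h⟩

/-- Passing to the flat picture costs a factor `q` once for the layer integrals and once for the
surface integral. All limit points thus lie within a factor `q²` of the claimed limit, for every `q
> 1`. -/
theorem tendsto_integral_peakKernel_comp_of_nonneg (hm : Module.finrank ℝ E = m + 1)
    (hW : IsOpen W) (hd : ContDiffOn ℝ 1 d W) (hg : ∀ x ∈ W, ‖∇ d x‖ = 1)
    {F : E → ℝ} (hF : Continuous F) (hFs : HasCompactSupport F) (hFW : tsupport F ⊆ W)
    (hF0 : 0 ≤ F) :
    Tendsto (fun δ => ∫ x, peakKernel δ (d x) * F x) (𝓝[>] 0)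
      (𝓝 (2 * ∫ x in {x | d x = 0} ∩ W, F x ∂(Measure.euclideanHausdorffMeasure m))) := by
  set N := ∫ x in {x | d x = 0} ∩ W, F x ∂(Measure.euclideanHausdorffMeasure m) with hN
  have hI0 : ∀ δ, 0 ≤ ∫ x, peakKernel δ (d x) * F x := fun δ =>
    integral_nonneg fun x => mul_nonneg (peakKernel_nonneg _ _) (hF0 x)
  refine tendsto_order.2 ⟨fun b hb => ?_, fun b hb => ?_⟩
  · rcases lt_or_ge b 0 with hb0 | hb0
    · exact Eventually.of_forall fun δ => hb0.trans_le (hI0 δ)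
    obtain ⟨q, hq, hqb⟩ := exists_one_lt_sq_mul_lt hb
    have hq0 : 0 < q := by linarith
    obtain ⟨M, T, h1, h2, h3, h4⟩ := exists_layer_comparison hm hW hd hg hq hF hFs hFW hF0
    have h5 : q * b < 2 * M := by
      have : q * (q * b) < q * (2 * M) := by nlinarith
      exact lt_of_mul_lt_mul_left this hq0.le
    filter_upwards [h3.eventually_const_lt h5, self_mem_nhdsWithin] with δ k1 k2
    exact lt_of_mul_lt_mul_left (k1.trans_le (h4 δ k2).2) hq0.le
  · obtain ⟨q, hq, hqb⟩ := exists_one_lt_sq_mul_lt hb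
    have hq0 : 0 < q := by linarith
    obtain ⟨M, T, h1, h2, h3, h4⟩ := exists_layer_comparison hm hW hd hg hq hF hFs hFW hF0
    have h5 : q * (2 * M) < b := by nlinarith
    filter_upwards [(h3.const_mul q).eventually_lt_const h5, self_mem_nhdsWithin] with δ k1 k2
    exact (h4 δ k2).1.trans_lt k1

/-- Coarea-type formula: rescaled thin-layer integrals of a continuous function around a level set
converge to its surface integral. -/
theorem tendsto_integral_peakKernel_comp (hm : Module.finrank ℝ E = m + 1)
    (hW : IsOpen W) (hd : ContDiffOn ℝ 1 d W) (hg : ∀ x ∈ W, ‖∇ d x‖ = 1)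
    {F : E → ℝ} (hF : Continuous F) (hFs : HasCompactSupport F) (hFW : tsupport F ⊆ W) :
    Tendsto (fun δ => ∫ x, peakKernel δ (d x) * F x) (𝓝[>] 0)
      (𝓝 (2 * ∫ x in {x | d x = 0} ∩ W, F x ∂(Measure.euclideanHausdorffMeasure m))) := by
  -- The multiplicative comparison needs a sign, so `F` is split into positive and negative parts.
  have hcp : Continuous fun x => max (F x) 0 := by fun_prop
  have hcn : Continuous fun x => max (-F x) 0 := by fun_prop
  have hsp : HasCompactSupport fun x => max (F x) 0 := hFs.comp_left (g := fun t => max t 0) (by simp)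
  have hsn : HasCompactSupport fun x => max (-F x) 0 :=
    hFs.comp_left (g := fun t => max (-t) 0) (by simp)
  have htp : tsupport (fun x => max (F x) 0) ⊆ tsupport F :=
    closure_mono fun x hx h0 => hx (by simp [h0])
  have htn : tsupport (fun x => max (-F x) 0) ⊆ tsupport F :=
    closure_mono fun x hx h0 => hx (by simp [h0])
  have hlim := (tendsto_integral_peakKernel_comp_of_nonneg hm hW hd hg hcp hsp (htp.trans hFW)
    fun x => le_max_right _ _).sub (tendsto_integral_peakKernel_comp_of_nonneg hm hW hd hg hcn hsn
      (htn.trans hFW) fun x => le_max_right _ _)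
  have hsub : ∀ x, F x = max (F x) 0 - max (-F x) 0 := fun x => by
    rcases le_total (F x) 0 with h | h <;> simp [h]
  have hint : ∀ {H : E → ℝ}, Continuous H → HasCompactSupport H → tsupport H ⊆ tsupport F →
      IntegrableOn H ({x | d x = 0} ∩ W) (Measure.euclideanHausdorffMeasure m) := by
    intro H hHc hHs hHF
    have : IsFiniteMeasure
        ((Measure.euclideanHausdorffMeasure m).restrict ({x | d x = 0} ∩ tsupport F)) :=
      ⟨by rw [Measure.restrict_apply_univ]
          exact euclideanHausdorffMeasure_levelSet_inter_lt_top hm hW hd hg hFs hFW⟩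
    have h1 : IntegrableOn H ({x | d x = 0} ∩ tsupport F) (Measure.euclideanHausdorffMeasure m) :=
      hHc.integrable_of_hasCompactSupport hHs
    refine h1.of_forall_sdiff_eq_zero (measurableSet_levelSet hW hd.continuousOn 0) ?_
    rintro x ⟨hx1, hx2⟩
    exact image_eq_zero_of_notMem_tsupport fun hx => hx2 ⟨hx1.1, hHF hx⟩
  rw [← mul_sub, ← integral_sub (hint hcp hsp htp) (hint hcn hsn htn)] at hlim
  simp only [← hsub] at hlim
  refine hlim.congr' ?_
  filter_upwards [self_mem_nhdsWithin] with δ hδ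
  have hpc : ContinuousOn (fun x => peakKernel δ (d x)) W :=
    (continuous_peakKernel (mem_Ioi.1 hδ).ne').comp_continuousOn hd.continuousOn
  rw [← integral_sub (integrable_mul_of_tsupport_subset hpc hcp hsp (htp.trans hFW))
    (integrable_mul_of_tsupport_subset hpc hcn hsn (htn.trans hFW))]
  congr 1
  ext x
  rw [← mul_sub, ← hsub]

end Coarea

/-! ### Smooth approximation of test functions -/

section Mollification

variable {E : Type*} [NormedAddCommGroup E] [InnerProductSpace ℝ E] [FiniteDimensional ℝ E]
  [MeasurableSpace E] [BorelSpace E]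

/-- A compactly supported `C¹` function is `C¹`-close to smooth ones supported nearby. -/
theorem exists_smooth_approx {ψ : E → ℝ} (hψ : ContDiff ℝ 1 ψ) (hs : HasCompactSupport ψ) (v : E)
    {ε r : ℝ} (hε : 0 < ε) (hr : 0 < r) :
    ∃ χ : E → ℝ, ContDiff ℝ ((⊤ : ℕ∞) : WithTop ℕ∞) χ ∧
      tsupport χ ⊆ Metric.cthickening r (tsupport ψ) ∧
      (∀ x, |χ x - ψ x| ≤ ε) ∧ ∀ x, |fderiv ℝ χ x v - fderiv ℝ ψ x v| ≤ ε := by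
  have hdc : Continuous fun x => fderiv ℝ ψ x v :=
    (hψ.continuous_fderiv one_ne_zero).clm_apply continuous_const
  have hds : HasCompactSupport fun x => fderiv ℝ ψ x v := hs.fderiv_apply (𝕜 := ℝ) v
  have u1 := hs.uniformContinuous_of_continuous hψ.continuous
  have u2 := hds.uniformContinuous_of_continuous hdc
  obtain ⟨r₁, hr₁, h1⟩ := Metric.uniformContinuous_iff.1 u1 ε hε
  obtain ⟨r₂, hr₂, h2⟩ := Metric.uniformContinuous_iff.1 u2 ε hε
  -- The mollification radius respects the prescribed support and the moduli of continuity of `ψ`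
  -- and of its derivative along `v`.
  set ρ := min r (min r₁ r₂) with hρ
  have hρ0 : 0 < ρ := by positivity
  let φ : ContDiffBump (0 : E) := ⟨ρ / 2, ρ, by positivity, by linarith⟩
  have hφl : LocallyIntegrable (φ.normed volume) volume :=
    φ.continuous_normed.locallyIntegrable
  refine ⟨convolution (φ.normed volume) ψ (ContinuousLinearMap.lsmul ℝ ℝ) volume, ?_, ?_, ?_, ?_⟩
  · exact φ.hasCompactSupport_normed.contDiff_convolution_left _ φ.contDiff_normed
      hψ.continuous.locallyIntegrable
  · refine closure_minimal ?_ Metric.isClosed_cthickening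
    refine (support_convolution_subset _).trans ?_
    rw [φ.support_normed_eq]
    rintro _ ⟨a, ha, b, hb, rfl⟩
    refine Metric.thickening_subset_cthickening _ _ (Metric.mem_thickening_iff.2
      ⟨b, subset_tsupport _ hb, ?_⟩)
    rw [mem_ball_zero_iff] at ha
    simpa [dist_eq_norm] using ha.trans_le (min_le_left _ _)
  · intro x
    refine φ.dist_normed_convolution_le hψ.continuous.aestronglyMeasurable fun y hy => ?_
    exact (h1 (lt_of_lt_of_le hy ((min_le_right _ _).trans (min_le_left _ _)))).le
  · intro x
    -- The derivative is put on `ψ`, not on the bump: the mollified derivative is then close to the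
    -- derivative.
    have hfd := hs.hasFDerivAt_convolution_right (ContinuousLinearMap.lsmul ℝ ℝ) hφl hψ x
    rw [hfd.fderiv, convolution_precompR_apply _ hφl (hs.fderiv (𝕜 := ℝ))
      (hψ.continuous_fderiv one_ne_zero)]
    refine φ.dist_normed_convolution_le hdc.aestronglyMeasurable fun y hy => ?_
    exact (h2 (lt_of_lt_of_le hy ((min_le_right _ _).trans (min_le_right _ _)))).le

end Mollification

/-! ### Products with functions known only near the support -/

section Products

variable {E : Type*} [NormedAddCommGroup E] [NormedSpace ℝ E]

theorem continuous_mul_of_tsupport_subset {X : Type*} [TopologicalSpace X] {g φ : X → ℝ} {W : Set X}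
    (hW : IsOpen W) (hg : ContinuousOn g W) (hφ : Continuous φ) (hφW : tsupport φ ⊆ W) :
    Continuous fun x => g x * φ x := by
  refine continuous_iff_continuousAt.2 fun x => ?_
  by_cases hx : x ∈ tsupport φ
  · exact (hg.continuousAt (hW.mem_nhds (hφW hx))).mul hφ.continuousAt
  · have : (fun x => g x * φ x) =ᶠ[𝓝 x] fun _ => 0 := by
      filter_upwards [(isClosed_tsupport φ).isOpen_compl.mem_nhds hx] with y hy
      rw [image_eq_zero_of_notMem_tsupport hy, mul_zero]
    exact continuousAt_const.congr this.symm

theorem contDiff_mul_of_tsupport_subset {g φ : E → ℝ} {W : Set E}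
    (hW : IsOpen W) (hg : ContDiffOn ℝ 1 g W) (hφ : ContDiff ℝ 1 φ) (hφW : tsupport φ ⊆ W) :
    ContDiff ℝ 1 fun x => g x * φ x := by
  refine contDiff_iff_contDiffAt.2 fun x => ?_
  by_cases hx : x ∈ tsupport φ
  · exact (hg.contDiffAt (hW.mem_nhds (hφW hx))).mul hφ.contDiffAt
  · have : (fun x => g x * φ x) =ᶠ[𝓝 x] fun _ => 0 := by
      filter_upwards [(isClosed_tsupport φ).isOpen_compl.mem_nhds hx] with y hy
      rw [image_eq_zero_of_notMem_tsupport hy, mul_zero]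
    exact contDiffAt_const.congr_of_eventuallyEq this

theorem fderiv_mul_apply_of_tsupport_subset {g φ : E → ℝ} {W : Set E}
    (hW : IsOpen W) (hg : ContDiffOn ℝ 1 g W) (hφ : ContDiff ℝ 1 φ) (hφW : tsupport φ ⊆ W)
    (x v : E) : fderiv ℝ (fun x => g x * φ x) x v = g x * fderiv ℝ φ x v + fderiv ℝ g x v * φ x := by
  by_cases hx : x ∈ tsupport φ
  · have h1 : DifferentiableAt ℝ g x :=
      (hg.contDiffAt (hW.mem_nhds (hφW hx))).differentiableAt one_ne_zero
    have h2 : DifferentiableAt ℝ φ x := hφ.contDiffAt.differentiableAt one_ne_zero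
    rw [fderiv_fun_mul h1 h2]
    simp; ring
  · have h0 : φ =ᶠ[𝓝 x] fun _ => 0 := by
      filter_upwards [(isClosed_tsupport φ).isOpen_compl.mem_nhds hx] with y hy
      exact image_eq_zero_of_notMem_tsupport hy
    have h1 : (fun x => g x * φ x) =ᶠ[𝓝 x] fun _ => 0 := by
      filter_upwards [h0] with y hy
      rw [hy, mul_zero]
    rw [h1.fderiv_eq, h0.fderiv_eq, h0.self_of_nhds]
    simp

theorem integrable_mul_of_locallyIntegrableOn {X : Type*} [TopologicalSpace X] [T2Space X]
    [MeasurableSpace X] [BorelSpace X] [LocallyCompactSpace X] [SecondCountableTopology X]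
    {μ : Measure X}
    {f h : X → ℝ} {Ω : Set X} (hf : LocallyIntegrableOn f Ω μ) (hh : Continuous h)
    (hs : HasCompactSupport h) (hsΩ : tsupport h ⊆ Ω) : Integrable (fun x => f x * h x) μ := by
  have h1 : IntegrableOn f (tsupport h) μ := hf.integrableOn_compact_subset hsΩ hs
  rw [← integrableOn_univ]
  refine IntegrableOn.of_forall_sdiff_eq_zero (s := tsupport h) ?_ MeasurableSet.univ fun x hx => ?_
  · exact h1.mul_continuousOn hh.continuousOn hs
  · rw [image_eq_zero_of_notMem_tsupport hx.2, mul_zero]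

end Products

/-! ### Weak derivatives against `C¹` functions, and the Leibniz rule -/

section WeakDerivative

variable {n : ℕ} {Ω : TopologicalSpace.Opens (Rn n)} {i : Fin n} {f f' : Rn n → ℝ}

theorem lineDeriv_testFunction_apply (φ : 𝓓(Ω, ℝ)) (v x : Rn n) :
    (∂_{v} φ : 𝓓(Ω, ℝ)) x = fderiv ℝ φ x v := by
  rw [TestFunction.lineDerivOp_eq_lineDerivCLM ℝ, TestFunction.lineDerivCLM_apply]
  simp only [top_add, le_refl, if_true]
  exact (φ.contDiff.differentiable (by simp)).differentiableAt.lineDeriv_eq_fderiv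

theorem HasWeakPartialDeriv.integral_testFunction (h : HasWeakPartialDeriv Ω i f f')
    (φ : 𝓓(Ω, ℝ)) :
    ∫ x, f x * fderiv ℝ φ x (stdVec i) = -∫ x, f' x * φ x := by
  have h1 := DFunLike.congr_fun h.deriv_eq φ
  rw [Distribution.lineDerivOp_apply_apply, map_neg, distOf_apply h.locallyIntegrableOn,
    distOf_apply h.locallyIntegrableOn_deriv] at h1
  simp only [lineDeriv_testFunction_apply] at h1
  simp only [mul_comm (f _), mul_comm (f' _), ← h1, neg_neg]

/-- Weak derivatives may be tested against compactly supported `C¹` functions. -/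
theorem HasWeakPartialDeriv.integral_contDiff_one (h : HasWeakPartialDeriv Ω i f f')
    {ψ : Rn n → ℝ} (hψ : ContDiff ℝ 1 ψ) (hs : HasCompactSupport ψ)
    (hsΩ : tsupport ψ ⊆ (Ω : Set (Rn n))) :
    ∫ x, f x * fderiv ℝ ψ x (stdVec i) = -∫ x, f' x * ψ x := by
  obtain ⟨r, hr, hrΩ⟩ := hs.isCompact.exists_cthickening_subset_open Ω.isOpen hsΩ
  set K := Metric.cthickening r (tsupport ψ) with hK
  have hKc : IsCompact K := hs.isCompact.cthickening
  have hf : IntegrableOn f K := h.locallyIntegrableOn.integrableOn_compact_subset hrΩ hKc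
  have hf' : IntegrableOn f' K := h.locallyIntegrableOn_deriv.integrableOn_compact_subset hrΩ hKc
  have hψK : tsupport ψ ⊆ K := Metric.self_subset_cthickening _
  have hdψ : Continuous fun x => fderiv ℝ ψ x (stdVec i) :=
    (hψ.continuous_fderiv one_ne_zero).clm_apply continuous_const
  have hdsub : ∀ χ : Rn n → ℝ, tsupport (fun x => fderiv ℝ χ x (stdVec i)) ⊆ tsupport χ :=
    fun χ => tsupport_fderiv_apply_subset ℝ (stdVec i)
  rw [eq_neg_iff_add_eq_zero]
  set A := ∫ x, f x * fderiv ℝ ψ x (stdVec i)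
  set B := ∫ x, f' x * ψ x
  set C := (∫ x in K, |f x|) + ∫ x in K, |f' x|
  -- For a smooth approximation `χ` the identity is exact. Replacing `ψ` by `χ` changes each
  -- integral by at most `ε` times the `L¹` norm of `f` or `f'` on the fixed compact set `K`.
  have key : ∀ ε > 0, |A + B| ≤ ε * C := by
    intro ε hε
    obtain ⟨χ, hχ, hχK, hχ1, hχ2⟩ := exists_smooth_approx hψ hs (stdVec i) hε hr
    have hχs : HasCompactSupport χ := hKc.of_isClosed_subset (isClosed_tsupport χ) hχK
    have hdχ : Continuous fun x => fderiv ℝ χ x (stdVec i) :=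
      (hχ.continuous_fderiv (by simp)).clm_apply continuous_const
    have htest := h.integral_testFunction ⟨χ, hχ, hχs, hχK.trans hrΩ⟩
    change ∫ x, f x * fderiv ℝ χ x (stdVec i) = -∫ x, f' x * χ x at htest
    have I1 := integrable_mul_of_locallyIntegrableOn h.locallyIntegrableOn hdψ
      (hs.fderiv_apply (𝕜 := ℝ) _) ((hdsub ψ).trans hsΩ)
    have I2 := integrable_mul_of_locallyIntegrableOn h.locallyIntegrableOn hdχ
      (hχs.fderiv_apply (𝕜 := ℝ) _) ((hdsub χ).trans (hχK.trans hrΩ))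
    have I3 := integrable_mul_of_locallyIntegrableOn h.locallyIntegrableOn_deriv hψ.continuous
      hs hsΩ
    have I4 := integrable_mul_of_locallyIntegrableOn h.locallyIntegrableOn_deriv hχ.continuous
      hχs (hχK.trans hrΩ)
    have est : ∀ {g a b : Rn n → ℝ}, IntegrableOn g K → tsupport a ⊆ K → tsupport b ⊆ K →
        (∀ x, |b x - a x| ≤ ε) → Integrable (fun x => g x * a x) → Integrable (fun x => g x * b x) →
        |(∫ x, g x * a x) - ∫ x, g x * b x| ≤ ε * ∫ x in K, |g x| := by
      intro g a b hg ha hb hab ia ib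
      rw [← integral_sub ia ib, ← integral_const_mul]
      have h0 : ∫ x, (g x * a x - g x * b x) = ∫ x in K, (g x * a x - g x * b x) := by
        refine (setIntegral_eq_integral_of_forall_compl_eq_zero fun x hx => ?_).symm
        rw [image_eq_zero_of_notMem_tsupport fun h => hx (ha h),
          image_eq_zero_of_notMem_tsupport fun h => hx (hb h)]
        simp
      rw [h0, ← Real.norm_eq_abs]
      have hg' : Integrable (fun x => |g x|) (volume.restrict K) := hg.abs
      refine norm_integral_le_of_norm_le (hg'.const_mul ε) (Eventually.of_forall fun x => ?_)
      rw [← mul_sub, Real.norm_eq_abs, abs_mul, mul_comm, abs_sub_comm]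
      exact mul_le_mul_of_nonneg_right (hab x) (abs_nonneg _)
    have e1 := est hf ((hdsub ψ).trans hψK) ((hdsub χ).trans hχK) hχ2 I1 I2
    have e2 := est hf' hψK hχK hχ1 I3 I4
    have : A + B = (A - ∫ x, f x * fderiv ℝ χ x (stdVec i)) + (B - ∫ x, f' x * χ x) := by
      rw [htest]; ring
    rw [this, mul_add]
    exact (abs_add_le _ _).trans (add_le_add e1 e2)
  by_contra hne
  have hpos : 0 < |A + B| := abs_pos.2 hne
  have hC : 0 ≤ C := add_nonneg (integral_nonneg fun _ => abs_nonneg _)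
    (integral_nonneg fun _ => abs_nonneg _)
  have := key (|A + B| / (2 * (C + 1))) (by positivity)
  rw [div_mul_eq_mul_div, le_div_iff₀ (by positivity)] at this
  nlinarith

/-- Leibniz rule for the product of a weakly differentiable function and a `C¹` function. -/
theorem HasWeakPartialDeriv.integral_mul (h : HasWeakPartialDeriv Ω i f f') {W : Set (Rn n)}
    (hW : IsOpen W) {g φ : Rn n → ℝ} (hg : ContDiffOn ℝ 1 g W) (hφ : ContDiff ℝ 1 φ)
    (hs : HasCompactSupport φ) (hsΩ : tsupport φ ⊆ (Ω : Set (Rn n))) (hsW : tsupport φ ⊆ W) :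
    ∫ x, f x * (g x * fderiv ℝ φ x (stdVec i)) =
      -(∫ x, f' x * (g x * φ x)) - ∫ x, f x * (fderiv ℝ g x (stdVec i) * φ x) := by
  have hψs : HasCompactSupport fun x => g x * φ x := hs.mul_left
  have hψsub : tsupport (fun x => g x * φ x) ⊆ tsupport φ := tsupport_mul_subset_right
  have h1 := h.integral_contDiff_one (contDiff_mul_of_tsupport_subset hW hg hφ hsW) hψs
    (hψsub.trans hsΩ)
  simp only [fderiv_mul_apply_of_tsupport_subset hW hg hφ hsW, mul_add] at h1
  have hdsub : tsupport (fun x => fderiv ℝ φ x (stdVec i)) ⊆ tsupport φ :=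
    tsupport_fderiv_apply_subset ℝ (stdVec i)
  have hdφ : Continuous fun x => fderiv ℝ φ x (stdVec i) :=
    (hφ.continuous_fderiv one_ne_zero).clm_apply continuous_const
  have hdg : ContinuousOn (fun x => fderiv ℝ g x (stdVec i)) W :=
    (hg.continuousOn_fderiv_of_isOpen hW le_rfl).clm_apply continuousOn_const
  have I1 := integrable_mul_of_locallyIntegrableOn h.locallyIntegrableOn
    (continuous_mul_of_tsupport_subset hW hg.continuousOn hdφ (hdsub.trans hsW))
    (hs.fderiv_apply (𝕜 := ℝ) (stdVec i)).mul_left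
    (tsupport_mul_subset_right.trans (hdsub.trans hsΩ))
  have I2 := integrable_mul_of_locallyIntegrableOn h.locallyIntegrableOn
    (continuous_mul_of_tsupport_subset hW hdg hφ.continuous hsW)
    hs.mul_left (tsupport_mul_subset_right.trans hsΩ)
  rw [integral_add I1 I2] at h1
  linarith

end WeakDerivative

/-! ### Two integrations by parts and the limit of the regular terms -/

section SecondDerivative

variable {n : ℕ} {Ω : TopologicalSpace.Opens (Rn n)} {W : Set (Rn n)} {d : Rn n → ℝ}

/-- The partial derivative `∂ⱼ d`. -/
noncomputable def partialDeriv (j : Fin n) (d : Rn n → ℝ) (x : Rn n) : ℝ := fderiv ℝ d x (stdVec j)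

theorem contDiffOn_partialDeriv (hW : IsOpen W) (hd : ContDiffOn ℝ 2 d W) (j : Fin n) :
    ContDiffOn ℝ 1 (partialDeriv j d) W :=
  (hd.fderiv_of_isOpen hW (by norm_num [one_add_one_eq_two])).clm_apply contDiffOn_const

theorem continuousOn_partialDeriv (hW : IsOpen W) (hd : ContDiffOn ℝ 1 d W) (j : Fin n) :
    ContinuousOn (partialDeriv j d) W :=
  (hd.continuousOn_fderiv_of_isOpen hW le_rfl).clm_apply continuousOn_const

theorem contDiff_partialDeriv {φ : Rn n → ℝ} (hφ : ContDiff ℝ 2 φ) (j : Fin n) :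
    ContDiff ℝ 1 (partialDeriv j φ) :=
  (hφ.fderiv_right (by norm_num [one_add_one_eq_two])).clm_apply contDiff_const

theorem tsupport_partialDeriv_subset (φ : Rn n → ℝ) (j : Fin n) :
    tsupport (partialDeriv j φ) ⊆ tsupport φ := tsupport_fderiv_apply_subset ℝ (stdVec j)

theorem partialDeriv_comp {A : ℝ → ℝ} {a : ℝ} {x : Rn n} (hA : HasDerivAt A a (d x))
    (hd : DifferentiableAt ℝ d x) (j : Fin n) :
    partialDeriv j (fun x => A (d x)) x = a * partialDeriv j d x := by
  have := hA.comp_hasFDerivAt x hd.hasFDerivAt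
  simp only [partialDeriv]
  rw [show (fun x => A (d x)) = A ∘ d from rfl, this.fderiv]
  simp

variable {Q : Rn n → ℝ} {Q₁ : Fin n → Rn n → ℝ} {Q₂ : Fin n → Fin n → Rn n → ℝ}

/-- Integrating by parts twice against a smooth function of `d`. -/
theorem integral_comp_mul_second_partialDeriv
    (h₁ : ∀ i, HasWeakPartialDeriv Ω i Q (Q₁ i))
    (h₂ : ∀ i j, HasWeakPartialDeriv Ω i (Q₁ j) (Q₂ i j))
    (hW : IsOpen W) (hd : ContDiffOn ℝ 2 d W) {A A' A'' : ℝ → ℝ}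
    (hA : ∀ t, HasDerivAt A (A' t) t) (hA' : ∀ t, HasDerivAt A' (A'' t) t) (hA'' : Continuous A'')
    {φ : Rn n → ℝ} (hφ : ContDiff ℝ 2 φ) (hs : HasCompactSupport φ)
    (hsΩ : tsupport φ ⊆ (Ω : Set (Rn n))) (hsW : tsupport φ ⊆ W) (i j : Fin n) :
    ∫ x, Q x * (A (d x) * partialDeriv j (partialDeriv i φ) x) =
      (∫ x, Q₂ i j x * (A (d x) * φ x)) +
      (∫ x, Q₁ j x * (A' (d x) * partialDeriv i d x * φ x)) +
      (∫ x, Q₁ i x * (A' (d x) * partialDeriv j d x * φ x)) +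
      (∫ x, Q x * (A' (d x) * partialDeriv i (partialDeriv j d) x * φ x)) +
      ∫ x, Q x * (A'' (d x) * (partialDeriv i d x * partialDeriv j d x * φ x)) := by
  have hd1 : ContDiffOn ℝ 1 d W := hd.of_le (by norm_num)
  have cA' : ContDiff ℝ 1 A' := contDiff_one_iff_deriv.2
    ⟨fun t => (hA' t).differentiableAt, by
      have : deriv A' = A'' := funext fun t => (hA' t).deriv
      rwa [this]⟩
  have cA : ContDiff ℝ 1 A := contDiff_one_iff_deriv.2
    ⟨fun t => (hA t).differentiableAt, by
      have : deriv A = A' := funext fun t => (hA t).deriv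
      rw [this]; exact cA'.continuous⟩
  have gA : ContDiffOn ℝ 1 (fun x => A (d x)) W := cA.comp_contDiffOn hd1
  have gA' : ContDiffOn ℝ 1 (fun x => A' (d x)) W := cA'.comp_contDiffOn hd1
  have gD : ∀ j, ContDiffOn ℝ 1 (partialDeriv j d) W := contDiffOn_partialDeriv hW hd
  have hdW : ∀ x ∈ W, DifferentiableAt ℝ d x := fun x hx =>
    (hd.contDiffAt (hW.mem_nhds hx)).differentiableAt (by norm_num)
  have cφ : ContDiff ℝ 1 φ := hφ.of_le (by norm_num)
  have cφi := contDiff_partialDeriv hφ i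
  have tφi := tsupport_partialDeriv_subset φ i
  have sφi : HasCompactSupport (partialDeriv i φ) := hs.fderiv_apply (𝕜 := ℝ) (stdVec i)
  -- Chain-rule formulas involving `d` hold only on `W`; outside `W` the test function vanishes.
  have loc : ∀ {g χ : Rn n → ℝ} {G : Rn n → ℝ}, (∀ x ∈ W, G x = g x) → tsupport χ ⊆ W →
      ∀ x, G x * χ x = g x * χ x := by
    intro g χ G hG hχ x
    by_cases hx : x ∈ W
    · rw [hG x hx]
    · rw [image_eq_zero_of_notMem_tsupport fun h => hx (hχ h)]; simp
  -- `s1` moves `∂ⱼ` off the test function. Of its two terms, `s2` treats the one with `∂ⱼQ` and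
  -- `s3` the one with `A'(d) ∂ⱼd`, which produces `A''`. Each multiplier is only `C¹`, hence the
  -- Leibniz rule in that class.
  have s1 := (h₁ j).integral_mul hW gA cφi sφi (tφi.trans hsΩ) (tφi.trans hsW)
  have s2 := (h₂ i j).integral_mul hW gA cφ hs hsΩ hsW
  have s3 := (h₁ i).integral_mul hW (gA'.mul (gD j)) cφ hs hsΩ hsW
  have e1 : ∀ k, ∀ χ : Rn n → ℝ, tsupport χ ⊆ W → ∀ x,
      fderiv ℝ (fun x => A (d x)) x (stdVec k) * χ x = A' (d x) * partialDeriv k d x * χ x :=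
    fun k χ hχ => loc (fun x hx => partialDeriv_comp (hA _) (hdW x hx) k) hχ
  have e3 : ∀ x, fderiv ℝ (fun x => A' (d x) * partialDeriv j d x) x (stdVec i) * φ x =
      (A'' (d x) * (partialDeriv i d x * partialDeriv j d x) +
        A' (d x) * partialDeriv i (partialDeriv j d) x) * φ x := by
    refine loc (fun x hx => ?_) hsW
    have k1 := (gA'.contDiffAt (hW.mem_nhds hx)).differentiableAt one_ne_zero
    have k2 := ((gD j).contDiffAt (hW.mem_nhds hx)).differentiableAt one_ne_zero
    have k3 := partialDeriv_comp (hA' (d x)) (hdW x hx) i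
    rw [fderiv_fun_mul k1 k2]
    simp only [partialDeriv] at k3 ⊢
    simp [k3]
    ring
  simp only [e1 j _ (tφi.trans hsW)] at s1
  simp only [e1 i _ hsW] at s2
  have s3' : ∫ x, Q x * (fderiv ℝ (fun x => A' (d x) * partialDeriv j d x) x (stdVec i) * φ x) =
      (∫ x, Q x * (A'' (d x) * (partialDeriv i d x * partialDeriv j d x * φ x))) +
        ∫ x, Q x * (A' (d x) * partialDeriv i (partialDeriv j d) x * φ x) := by
    have gDD : ContinuousOn (partialDeriv i (partialDeriv j d)) W :=
      continuousOn_partialDeriv hW (gD j) i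
    have hloc := (h₁ i).locallyIntegrableOn
    have I1 : Integrable fun x =>
        Q x * (A'' (d x) * (partialDeriv i d x * partialDeriv j d x) * φ x) :=
      integrable_mul_of_locallyIntegrableOn hloc
        (continuous_mul_of_tsupport_subset hW ((hA''.comp_continuousOn hd.continuousOn).mul
          ((gD i).continuousOn.mul (gD j).continuousOn)) cφ.continuous hsW)
        hs.mul_left (tsupport_mul_subset_right.trans hsΩ)
    have I2 : Integrable fun x => Q x * (A' (d x) * partialDeriv i (partialDeriv j d) x * φ x) :=
      integrable_mul_of_locallyIntegrableOn hloc
        (continuous_mul_of_tsupport_subset hW (gA'.continuousOn.mul gDD) cφ.continuous hsW)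
        hs.mul_left (tsupport_mul_subset_right.trans hsΩ)
    simp only [e3, add_mul, mul_add]
    rw [integral_add I1 I2]
    simp only [mul_assoc]
  have s1' : ∫ x, Q x * (A (d x) * partialDeriv j (partialDeriv i φ) x) =
      -(∫ x, Q₁ j x * (A (d x) * partialDeriv i φ x)) -
        ∫ x, Q x * (A' (d x) * partialDeriv j d x * partialDeriv i φ x) := s1
  have s2' : ∫ x, Q₁ j x * (A (d x) * partialDeriv i φ x) =
      -(∫ x, Q₂ i j x * (A (d x) * φ x)) -
        ∫ x, Q₁ j x * (A' (d x) * partialDeriv i d x * φ x) := s2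
  have s3'' : ∫ x, Q x * (A' (d x) * partialDeriv j d x * partialDeriv i φ x) =
      -(∫ x, Q₁ i x * (A' (d x) * partialDeriv j d x * φ x)) -
        ∫ x, Q x * (fderiv ℝ (fun x => A' (d x) * partialDeriv j d x) x (stdVec i) * φ x) := s3
  rw [s1', s2', s3'', s3']
  ring

/-- Dominated convergence for compositions with `d` in a weighted integral. -/
theorem tendsto_integral_mul_comp {f g h : Rn n → ℝ} (hW : IsOpen W) (hdc : ContinuousOn d W)
    (hf : LocallyIntegrableOn f Ω volume) (hg : ContinuousOn g W) (hh : Continuous h)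
    (hs : HasCompactSupport h) (hsΩ : tsupport h ⊆ (Ω : Set (Rn n))) (hsW : tsupport h ⊆ W)
    {B : ℝ → ℝ → ℝ} {B₀ : ℝ → ℝ} (hB : ∀ δ, 0 < δ → Continuous (B δ))
    (hbd : ∀ δ t, 0 < δ → δ < 1 → |B δ t| ≤ 1 + |t|)
    (hlim : ∀ t, Tendsto (fun δ => B δ t) (𝓝[>] 0) (𝓝 (B₀ t))) :
    Tendsto (fun δ => ∫ x, f x * (B δ (d x) * g x * h x)) (𝓝[>] 0)
      (𝓝 (∫ x, f x * (B₀ (d x) * g x * h x))) := by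
  have hint : ∀ {b : ℝ → ℝ}, Continuous b → Integrable fun x => f x * (b (d x) * g x * h x) :=
    fun hb => integrable_mul_of_locallyIntegrableOn hf
      (continuous_mul_of_tsupport_subset hW ((hb.comp_continuousOn hdc).mul hg) hh hsW)
      hs.mul_left (tsupport_mul_subset_right.trans hsΩ)
  have hone : ∀ᶠ δ : ℝ in 𝓝[>] 0, 0 < δ ∧ δ < 1 :=
    (eventually_mem_nhdsWithin (s := Ioi (0 : ℝ))).and
      (Filter.Eventually.filter_mono nhdsWithin_le_nhds (gt_mem_nhds one_pos))
  -- The growth bound `1 + |t|` covers both `√(t² + δ²)` for `δ < 1` and its derivative in `t`.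
  refine tendsto_integral_filter_of_dominated_convergence
    (fun x => ‖f x * ((1 + |d x|) * g x * h x)‖) ?_ ?_ ?_ ?_
  · filter_upwards [hone] with δ hδ
    exact (hint (hB δ hδ.1)).aestronglyMeasurable
  · filter_upwards [hone] with δ hδ
    refine Eventually.of_forall fun x => ?_
    simp only [norm_mul]
    gcongr
    rw [Real.norm_eq_abs, Real.norm_eq_abs]
    exact (hbd δ _ hδ.1 hδ.2).trans (le_abs_self _)
  · exact (hint (b := fun t => 1 + |t|) (by fun_prop)).norm
  · refine Eventually.of_forall fun x => ?_
    exact (((hlim (d x)).mul_const _).mul_const _).const_mul _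

theorem sqrt_sq_add_sq_le {t δ : ℝ} (hδ : 0 ≤ δ) : Real.sqrt (t ^ 2 + δ ^ 2) ≤ |t| + δ := by
  rw [Real.sqrt_le_left (by positivity)]
  have := abs_nonneg t
  nlinarith [sq_abs t, mul_nonneg this hδ]

theorem tendsto_sqrt_sq_add_sq (t : ℝ) :
    Tendsto (fun δ : ℝ => Real.sqrt (t ^ 2 + δ ^ 2)) (𝓝[>] 0) (𝓝 |t|) := by
  have : Continuous fun δ : ℝ => Real.sqrt (t ^ 2 + δ ^ 2) := by fun_prop
  have h := (this.tendsto 0).mono_left (nhdsWithin_le_nhds (s := Ioi (0 : ℝ)))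
  simpa [Real.sqrt_sq_eq_abs] using h

theorem abs_div_sqrt_sq_add_sq_le (t δ : ℝ) : |t / Real.sqrt (t ^ 2 + δ ^ 2)| ≤ 1 := by
  rw [abs_div, abs_of_nonneg (Real.sqrt_nonneg _)]
  refine div_le_one_of_le₀ ?_ (Real.sqrt_nonneg _)
  rw [← Real.sqrt_sq_eq_abs]
  exact Real.sqrt_le_sqrt (by nlinarith [sq_nonneg δ])

/-- At `t = 0` both sides are 0, as `Real.sign 0 = 0`. Convergence is therefore pointwise
everywhere, and the zero set of `d` needs no separate treatment. -/
theorem tendsto_div_sqrt_sq_add_sq (t : ℝ) :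
    Tendsto (fun δ : ℝ => t / Real.sqrt (t ^ 2 + δ ^ 2)) (𝓝[>] 0) (𝓝 (Real.sign t)) := by
  rcases eq_or_ne t 0 with rfl | ht
  · simp
  · have h := Tendsto.div (tendsto_const_nhds (x := t)) (tendsto_sqrt_sq_add_sq t) (abs_ne_zero.2 ht)
    have : t / |t| = Real.sign t := by
      rcases lt_or_gt_of_ne ht with h | h
      · rw [Real.sign_of_neg h, abs_of_neg h, div_neg, div_self ht]
      · rw [Real.sign_of_pos h, abs_of_pos h, div_self ht]
    rwa [this] at h

end SecondDerivative

/-! ### The limit `δ → 0` -/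

section Identity

variable {m : ℕ} {Ω : TopologicalSpace.Opens (Rn (m + 1))} {W : Set (Rn (m + 1))}
  {d : Rn (m + 1) → ℝ} {Q Qc : Rn (m + 1) → ℝ} {Q₁ : Fin (m + 1) → Rn (m + 1) → ℝ}
  {Q₂ : Fin (m + 1) → Fin (m + 1) → Rn (m + 1) → ℝ}

/-- Second distributional derivatives of `Q |d|`, tested against `φ`. -/
theorem integral_abs_mul_second_partialDeriv
    (h₁ : ∀ i, HasWeakPartialDeriv Ω i Q (Q₁ i))
    (h₂ : ∀ i j, HasWeakPartialDeriv Ω i (Q₁ j) (Q₂ i j))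
    (hQc : ContinuousOn Qc Ω) (hQ : Qc =ᵐ[volume.restrict (Ω : Set (Rn (m + 1)))] Q)
    (hW : IsOpen W) (hd : ContDiffOn ℝ 2 d W) (hg : ∀ x ∈ W, ‖∇ d x‖ = 1)
    {φ : Rn (m + 1) → ℝ} (hφ : ContDiff ℝ 2 φ) (hs : HasCompactSupport φ)
    (hsΩ : tsupport φ ⊆ (Ω : Set (Rn (m + 1)))) (hsW : tsupport φ ⊆ W) (i j : Fin (m + 1)) :
    ∫ x, Q x * (|d x| * partialDeriv j (partialDeriv i φ) x) =
      (∫ x, Q₂ i j x * (|d x| * φ x)) +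
      (∫ x, Q₁ j x * (Real.sign (d x) * partialDeriv i d x * φ x)) +
      (∫ x, Q₁ i x * (Real.sign (d x) * partialDeriv j d x * φ x)) +
      (∫ x, Q x * (Real.sign (d x) * partialDeriv i (partialDeriv j d) x * φ x)) +
      2 * ∫ x in {x | d x = 0} ∩ W, Qc x * (partialDeriv i d x * partialDeriv j d x * φ x)
        ∂(Measure.euclideanHausdorffMeasure m) := by
  have hd1 : ContDiffOn ℝ 1 d W := hd.of_le (by norm_num)
  have gD : ∀ j, ContDiffOn ℝ 1 (partialDeriv j d) W := contDiffOn_partialDeriv hW hd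
  have gDD : ContinuousOn (partialDeriv i (partialDeriv j d)) W :=
    continuousOn_partialDeriv hW (gD j) i
  have cφ : ContDiff ℝ 1 φ := hφ.of_le (by norm_num)
  have cA : ∀ δ : ℝ, 0 < δ → Continuous fun t : ℝ => Real.sqrt (t ^ 2 + δ ^ 2) :=
    fun δ _ => by fun_prop
  have cA' : ∀ δ : ℝ, 0 < δ → Continuous fun t : ℝ => t / Real.sqrt (t ^ 2 + δ ^ 2) :=
    fun δ hδ => continuous_iff_continuousAt.2 fun t =>
      (hasDerivAt_div_sqrt_sq_add_sq hδ.ne' t).continuousAt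
  have bA : ∀ δ t : ℝ, 0 < δ → δ < 1 → |Real.sqrt (t ^ 2 + δ ^ 2)| ≤ 1 + |t| := by
    intro δ t h0 h1
    rw [abs_of_nonneg (Real.sqrt_nonneg _)]
    have := sqrt_sq_add_sq_le (t := t) h0.le
    linarith
  have bA' : ∀ δ t : ℝ, 0 < δ → δ < 1 → |t / Real.sqrt (t ^ 2 + δ ^ 2)| ≤ 1 + |t| :=
    fun δ t _ _ => (abs_div_sqrt_sq_add_sq_le t δ).trans (by linarith [abs_nonneg t])
  have cφi := contDiff_partialDeriv hφ i
  have cφij : Continuous (partialDeriv j (partialDeriv i φ)) :=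
    (cφi.continuous_fderiv one_ne_zero).clm_apply continuous_const
  have tφij : tsupport (partialDeriv j (partialDeriv i φ)) ⊆ tsupport φ :=
    (tsupport_partialDeriv_subset _ j).trans (tsupport_partialDeriv_subset φ i)
  have sφij : HasCompactSupport (partialDeriv j (partialDeriv i φ)) :=
    hs.of_isClosed_subset (isClosed_tsupport _) tφij
  have L0 := tendsto_integral_mul_comp (g := fun _ => 1) hW hd.continuousOn
    (h₁ i).locallyIntegrableOn continuousOn_const cφij sφij (tφij.trans hsΩ) (tφij.trans hsW)
    cA bA tendsto_sqrt_sq_add_sq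
  have L1 := tendsto_integral_mul_comp (g := fun _ => 1) hW hd.continuousOn
    (h₂ i j).locallyIntegrableOn_deriv continuousOn_const cφ.continuous hs hsΩ hsW
    cA bA tendsto_sqrt_sq_add_sq
  have L2 := tendsto_integral_mul_comp hW hd.continuousOn
    (h₂ i j).locallyIntegrableOn (gD i).continuousOn cφ.continuous hs hsΩ hsW
    cA' bA' tendsto_div_sqrt_sq_add_sq
  have L3 := tendsto_integral_mul_comp hW hd.continuousOn
    (h₁ i).locallyIntegrableOn_deriv (gD j).continuousOn cφ.continuous hs hsΩ hsW
    cA' bA' tendsto_div_sqrt_sq_add_sq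
  have L4 := tendsto_integral_mul_comp hW hd.continuousOn
    (h₁ i).locallyIntegrableOn gDD cφ.continuous hs hsΩ hsW
    cA' bA' tendsto_div_sqrt_sq_add_sq
  -- The continuous representative enters here. For `δ > 0` the integrals with `Q` and `Qc` agree,
  -- but the limit lives on a hypersurface, where only `Qc` has meaningful values.
  set F : Rn (m + 1) → ℝ := fun x => Qc x * (partialDeriv i d x * partialDeriv j d x * φ x) with hF
  have hF1 : Continuous fun x => partialDeriv i d x * partialDeriv j d x * φ x :=
    continuous_mul_of_tsupport_subset hW ((gD i).continuousOn.mul (gD j).continuousOn)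
      cφ.continuous hsW
  have hFt1 : tsupport (fun x => partialDeriv i d x * partialDeriv j d x * φ x) ⊆ tsupport φ :=
    tsupport_mul_subset_right
  have hFc : Continuous F := continuous_mul_of_tsupport_subset Ω.isOpen hQc hF1 (hFt1.trans hsΩ)
  have hFt : tsupport F ⊆ tsupport φ := tsupport_mul_subset_right.trans hFt1
  have L5 := tendsto_integral_peakKernel_comp (m := m) (by simp) hW hd1 hg hFc
    (hs.of_isClosed_subset (isClosed_tsupport _) hFt) (hFt.trans hsW)
  simp only [mul_one] at L0 L1
  -- For each `δ > 0` the left integral equals the sum of five terms, so the two limits coincide.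
  refine tendsto_nhds_unique L0 ((((L1.add L2).add L3).add L4).add L5 |>.congr' ?_)
  filter_upwards [self_mem_nhdsWithin] with δ hδ
  have hδ0 : δ ≠ 0 := (mem_Ioi.1 hδ).ne'
  rw [integral_comp_mul_second_partialDeriv h₁ h₂ hW hd (hasDerivAt_sqrt_sq_add_sq hδ0)
    (hasDerivAt_div_sqrt_sq_add_sq hδ0) (continuous_peakKernel hδ0) hφ hs hsΩ hsW i j]
  congr 1
  refine integral_congr_ae ?_
  have hQ' := (ae_restrict_iff' Ω.isOpen.measurableSet).1 hQ
  filter_upwards [hQ'] with x hx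
  by_cases hxΩ : x ∈ (Ω : Set (Rn (m + 1)))
  · simp only [hF, hx hxΩ]; ring
  · have : φ x = 0 := image_eq_zero_of_notMem_tsupport fun h => hxΩ (hsΩ h)
    simp [hF, this]

end Identity

/-! ### Rescaled kernels -/

section ScaledKernel

variable {n : ℕ}

/-- The `L¹`-normalised rescaling of `β`. -/
noncomputable def scaledKernel (β : Rn n → ℝ) (r : ℝ) (z : Rn n) : ℝ := (r ^ n)⁻¹ * β (r⁻¹ • z)

/-- The divergence of `z ↦ z * scaledKernel β r z`. -/
noncomputable def scaledKernelDiv (β : Rn n → ℝ) (r : ℝ) (z : Rn n) : ℝ :=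
  (r ^ n)⁻¹ * (n * β (r⁻¹ • z) + fderiv ℝ β (r⁻¹ • z) (r⁻¹ • z))

theorem sum_smul_stdVec (z : Rn n) : ∑ i, z i • stdVec i = z := by
  ext j
  simp [stdVec, Pi.single_apply]

/-- With the factor `r^(-n)`, the derivative in the scale is exactly `-r⁻¹ div (z k_r(z))`, writing
`k_r` for the rescaled kernel. This lets the scale derivative of an average be expressed through
weak derivatives. -/
theorem hasDerivAt_scaledKernel {β : Rn n → ℝ} (hβ : ContDiff ℝ 1 β) {r : ℝ} (hr : 0 < r)
    (z : Rn n) :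
    HasDerivAt (fun r => scaledKernel β r z) (-r⁻¹ * scaledKernelDiv β r z) r := by
  have h1 : HasDerivAt (fun r : ℝ => r⁻¹ • z) ((-(r ^ 2)⁻¹) • z) r :=
    (hasDerivAt_inv hr.ne').smul_const z
  have h2 := ((hβ.differentiable one_ne_zero) (r⁻¹ • z)).hasFDerivAt.comp_hasDerivAt r h1
  have h3 : HasDerivAt (fun r : ℝ => (r ^ n)⁻¹) (-(n * r ^ (n - 1)) / (r ^ n) ^ 2) r :=
    (hasDerivAt_pow n r).inv (by positivity)
  have h4 := h3.mul h2
  refine h4.congr_deriv ?_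
  have e1 : (-(r ^ 2)⁻¹) • z = (-r⁻¹) • (r⁻¹ • z) := by
    rw [smul_smul]; congr 1; field_simp
  have e2 : -((n : ℝ) * r ^ (n - 1)) / (r ^ n) ^ 2 = -r⁻¹ * ((r ^ n)⁻¹ * n) := by
    rcases n with _ | k
    · simp
    · simp only [Nat.add_sub_cancel]
      field_simp
      ring
  simp only [Function.comp_apply, scaledKernelDiv]
  rw [e1, map_smul, e2, smul_eq_mul]
  ring

theorem scaledKernel_eq_zero {β : Rn n → ℝ} (hs : tsupport β ⊆ Metric.closedBall 0 2) {r : ℝ}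
    (hr : 0 < r) {z : Rn n} (hz : 2 * r < ‖z‖) : scaledKernel β r z = 0 := by
  have : r⁻¹ • z ∉ tsupport β := fun h => by
    have := hs h
    rw [mem_closedBall_zero_iff, norm_smul, norm_inv, Real.norm_of_nonneg hr.le,
      inv_mul_le_iff₀ hr] at this
    linarith
  rw [scaledKernel, image_eq_zero_of_notMem_tsupport this, mul_zero]

theorem scaledKernelDiv_eq_zero {β : Rn n → ℝ} (hs : tsupport β ⊆ Metric.closedBall 0 2) {r : ℝ}
    (hr : 0 < r) {z : Rn n} (hz : 2 * r < ‖z‖) : scaledKernelDiv β r z = 0 := by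
  have : r⁻¹ • z ∉ tsupport β := fun h => by
    have := hs h
    rw [mem_closedBall_zero_iff, norm_smul, norm_inv, Real.norm_of_nonneg hr.le,
      inv_mul_le_iff₀ hr] at this
    linarith
  rw [scaledKernelDiv, image_eq_zero_of_notMem_tsupport this,
    image_eq_zero_of_notMem_tsupport fun h => this (tsupport_fderiv_subset ℝ h)]
  simp

theorem contDiff_scaledKernel {β : Rn n → ℝ} (hβ : ContDiff ℝ 1 β) (r : ℝ) :
    ContDiff ℝ 1 (scaledKernel β r) :=
  contDiff_const.mul (hβ.comp (contDiff_const_smul r⁻¹))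

theorem continuous_scaledKernelDiv {β : Rn n → ℝ} (hβ : ContDiff ℝ 1 β) (r : ℝ) :
    Continuous (scaledKernelDiv β r) := by
  have h1 : Continuous fun z : Rn n => r⁻¹ • z := by fun_prop
  exact continuous_const.mul ((continuous_const.mul (hβ.continuous.comp h1)).add
    (((hβ.continuous_fderiv one_ne_zero).comp h1).clm_apply h1))

theorem tsupport_scaledKernel_subset {β : Rn n → ℝ} (hs : tsupport β ⊆ Metric.closedBall 0 2)
    {r : ℝ} (hr : 0 < r) : tsupport (scaledKernel β r) ⊆ Metric.closedBall 0 (2 * r) := by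
  refine closure_minimal (fun z hz => ?_) Metric.isClosed_closedBall
  rw [mem_closedBall_zero_iff]
  by_contra! h
  exact hz (scaledKernel_eq_zero hs hr h)

theorem scaledKernelDiv_eq_sum {β : Rn n → ℝ} (hβ : ContDiff ℝ 1 β) (r : ℝ) (z : Rn n) :
    scaledKernelDiv β r z =
      ∑ i, fderiv ℝ (fun z => z i * scaledKernel β r z) z (stdVec i) := by
  have hk := ((contDiff_scaledKernel hβ r).differentiable one_ne_zero) z
  have h1 : ∀ i, fderiv ℝ (fun z : Rn n => z i * scaledKernel β r z) z (stdVec i) =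
      z i * fderiv ℝ (scaledKernel β r) z (stdVec i) + scaledKernel β r z := by
    intro i
    have hc : HasFDerivAt (fun z : Rn n => z i) (EuclideanSpace.proj i : Rn n →L[ℝ] ℝ) z :=
      (EuclideanSpace.proj i : Rn n →L[ℝ] ℝ).hasFDerivAt
    rw [(HasFDerivAt.fun_mul hc hk.hasFDerivAt).fderiv]
    simp [stdVec]
  have h2 : fderiv ℝ (scaledKernel β r) z z =
      (r ^ n)⁻¹ * fderiv ℝ β (r⁻¹ • z) (r⁻¹ • z) := by
    have hl : HasFDerivAt (fun z : Rn n => r⁻¹ • z) (r⁻¹ • ContinuousLinearMap.id ℝ (Rn n)) z :=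
      (hasFDerivAt_id z).const_smul r⁻¹
    have := (((hβ.differentiable one_ne_zero) (r⁻¹ • z)).hasFDerivAt.comp z hl).const_mul (r ^ n)⁻¹
    change fderiv ℝ (fun z => (r ^ n)⁻¹ * (β ∘ fun z => r⁻¹ • z) z) z z = _
    rw [this.fderiv]
    simp
  have h3 : ∑ i, z i * fderiv ℝ (scaledKernel β r) z (stdVec i) =
      fderiv ℝ (scaledKernel β r) z z := by
    have := congrArg (fderiv ℝ (scaledKernel β r) z) (sum_smul_stdVec z)
    simpa [map_sum] using this
  simp only [h1, Finset.sum_add_distrib, h3, h2]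
  simp [scaledKernelDiv, scaledKernel]
  ring

end ScaledKernel

/-! ### Averages and their derivative in the scale -/

section Averages

variable {n : ℕ} {f : Rn n → ℝ} {β : Rn n → ℝ}

/-- The average of `f` around `x` with weight `scaledKernel β r`. -/
noncomputable def kernelAverage (β f : Rn n → ℝ) (r : ℝ) (x : Rn n) : ℝ :=
  ∫ y, f y * scaledKernel β r (x - y)

theorem continuous_kernelAverage (hβ : ContDiff ℝ 1 β) (hs : tsupport β ⊆ Metric.closedBall 0 2)
    (hf : LocallyIntegrable f) {r : ℝ} (hr : 0 < r) : Continuous (kernelAverage β f r) := by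
  have hcs : HasCompactSupport (scaledKernel β r) :=
    (isCompact_closedBall _ _).of_isClosed_subset (isClosed_tsupport _)
      (tsupport_scaledKernel_subset hs hr)
  exact hcs.continuous_convolution_right (ContinuousLinearMap.mul ℝ ℝ) hf
    (contDiff_scaledKernel hβ r).continuous

theorem hasDerivAt_kernelAverage (hβ : ContDiff ℝ 1 β) (hs : tsupport β ⊆ Metric.closedBall 0 2)
    (hf : LocallyIntegrable f) {r : ℝ} (hr : 0 < r) (x : Rn n) :
    HasDerivAt (fun r => kernelAverage β f r x)
      (∫ y, f y * (-r⁻¹ * scaledKernelDiv β r (x - y))) r := by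
  have hcβ : HasCompactSupport β :=
    (isCompact_closedBall _ _).of_isClosed_subset (isClosed_tsupport _) hs
  obtain ⟨C₀, hC₀⟩ := hcβ.exists_bound_of_continuous hβ.continuous
  obtain ⟨C₁, hC₁⟩ := (hcβ.fderiv (𝕜 := ℝ)).exists_bound_of_continuous
    (hβ.continuous_fderiv one_ne_zero)
  have hC₀0 : 0 ≤ C₀ := (norm_nonneg _).trans (hC₀ 0)
  have hC₁0 : 0 ≤ C₁ := (norm_nonneg _).trans (hC₁ 0)
  -- A bound for the scale derivative of the kernel, uniform for `s` within `r / 2` of `r`: negative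
  -- powers of `s` are taken at `r / 2`, and the 2 bounds the rescaled argument where the kernel
  -- lives.
  set C := (r / 2)⁻¹ * (((r / 2) ^ n)⁻¹ * (n * C₀ + C₁ * 2)) with hC
  have hC0 : 0 ≤ C := by positivity
  have hcont : ∀ s, Continuous fun y => scaledKernel β s (x - y) := fun s =>
    (contDiff_scaledKernel hβ s).continuous.comp (by fun_prop)
  have hcs : ∀ s, 0 < s → HasCompactSupport fun y => scaledKernel β s (x - y) := fun s hs0 =>
    HasCompactSupport.intro (isCompact_closedBall x (2 * s)) fun y hy => by
      refine scaledKernel_eq_zero hs hs0 ?_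
      rw [mem_closedBall_iff_norm, not_le, norm_sub_rev] at hy
      exact hy
  have hfi : ∀ s, 0 < s → Integrable fun y => f y * scaledKernel β s (x - y) := fun s hs0 =>
    integrable_mul_of_locallyIntegrableOn (Ω := univ) (locallyIntegrableOn_univ.2 hf) (hcont s)
      (hcs s hs0) (subset_univ _)
  have hball : Metric.ball r (r / 2) ∈ 𝓝 r := Metric.ball_mem_nhds r (by positivity)
  have hpos : ∀ s ∈ Metric.ball r (r / 2), r / 2 < s ∧ s < 2 * r := by
    intro s hs
    rw [Metric.mem_ball, Real.dist_eq, abs_lt] at hs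
    constructor <;> linarith [hs.1, hs.2]
  refine (hasDerivAt_integral_of_dominated_loc_of_deriv_le hball
    (F := fun s y => f y * scaledKernel β s (x - y))
    (F' := fun s y => f y * (-s⁻¹ * scaledKernelDiv β s (x - y)))
    (bound := fun y => (Metric.closedBall x (4 * r)).indicator (fun y => |f y| * C) y)
    ?_ (hfi r hr) ?_ ?_ ?_ ?_).2
  · filter_upwards [hball] with s hs'
    exact (hfi s (by linarith [(hpos s hs').1])).aestronglyMeasurable
  · refine hf.aestronglyMeasurable.mul (Continuous.aestronglyMeasurable ?_)
    exact continuous_const.mul ((continuous_scaledKernelDiv hβ r).comp (by fun_prop))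
  · refine Eventually.of_forall fun y s hs' => ?_
    obtain ⟨h1, h2⟩ := hpos s hs'
    have hs0 : 0 < s := by linarith
    have hr2 : 0 < r / 2 := by positivity
    by_cases hy : 2 * s < ‖x - y‖
    · rw [scaledKernelDiv_eq_zero hs hs0 hy]
      simp only [mul_zero, norm_zero]
      exact indicator_nonneg (fun y _ => by positivity) y
    · rw [not_lt] at hy
      have hmem : y ∈ Metric.closedBall x (4 * r) := by
        rw [mem_closedBall_iff_norm, norm_sub_rev]; linarith
      rw [indicator_of_mem hmem, norm_mul, Real.norm_eq_abs]
      refine mul_le_mul_of_nonneg_left ?_ (abs_nonneg _)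
      have hz : ‖s⁻¹ • (x - y)‖ ≤ 2 := by
        rw [norm_smul, norm_inv, Real.norm_of_nonneg hs0.le, inv_mul_le_iff₀ hs0]; linarith
      rw [norm_mul, norm_neg, norm_inv, Real.norm_of_nonneg hs0.le, scaledKernelDiv, norm_mul,
        norm_inv, norm_pow, Real.norm_of_nonneg hs0.le, hC]
      have k1 : ‖(n : ℝ) * β (s⁻¹ • (x - y)) + fderiv ℝ β (s⁻¹ • (x - y)) (s⁻¹ • (x - y))‖ ≤
          n * C₀ + C₁ * 2 := by
        refine (norm_add_le _ _).trans (add_le_add ?_ ?_)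
        · rw [norm_mul, Real.norm_natCast]
          gcongr
          exact hC₀ _
        · refine (ContinuousLinearMap.le_opNorm _ _).trans ?_
          exact mul_le_mul (hC₁ _) hz (norm_nonneg _) hC₁0
      gcongr
  · rw [integrable_indicator_iff Metric.isClosed_closedBall.measurableSet]
    exact (hf.integrableOn_isCompact (isCompact_closedBall _ _)).abs.mul_const C
  · refine Eventually.of_forall fun y s hs' => ?_
    obtain ⟨h1, h2⟩ := hpos s hs'
    exact (hasDerivAt_scaledKernel hβ (by linarith) (x - y)).const_mul (f y)

end Averages

/-! ### The scale derivative through the weak gradient -/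

section WeakGradient

variable {n : ℕ} {Ω : TopologicalSpace.Opens (Rn n)} {Q : Rn n → ℝ} {Q₁ : Fin n → Rn n → ℝ}
  {β : Rn n → ℝ}

/-- As functions of `y`, the fields `ψ i` have total divergence minus the scaled kernel divergence
at `x - y`. They are admissible test functions because their support lies in the ball inside `Ω`. -/
theorem integral_mul_scaledKernelDiv (h₁ : ∀ i, HasWeakPartialDeriv Ω i Q (Q₁ i))
    (hβ : ContDiff ℝ 1 β) (hs : tsupport β ⊆ Metric.closedBall 0 2) {r : ℝ} (hr : 0 < r) {x : Rn n}
    (hx : Metric.closedBall x (2 * r) ⊆ Ω) :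
    ∫ y, Q y * scaledKernelDiv β r (x - y) =
      ∑ i, ∫ y, Q₁ i y * ((x - y) i * scaledKernel β r (x - y)) := by
  set ψ : Fin n → Rn n → ℝ := fun i y => (x - y) i * scaledKernel β r (x - y) with hψ
  have hproj : ∀ i, ContDiff ℝ 1 fun z : Rn n => z i := fun i =>
    (EuclideanSpace.proj i : Rn n →L[ℝ] ℝ).contDiff
  have hθ : ∀ i, ContDiff ℝ 1 fun z : Rn n => z i * scaledKernel β r z := fun i =>
    (hproj i).mul (contDiff_scaledKernel hβ r)
  have hψc : ∀ i, ContDiff ℝ 1 (ψ i) := fun i =>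
    (hθ i).comp (contDiff_const.sub contDiff_id)
  have hψ0 : ∀ i, ∀ y ∉ Metric.closedBall x (2 * r), ψ i y = 0 := by
    intro i y hy
    rw [mem_closedBall_iff_norm, not_le, norm_sub_rev] at hy
    simp only [hψ, scaledKernel_eq_zero hs hr hy, mul_zero]
  have hψt : ∀ i, tsupport (ψ i) ⊆ Metric.closedBall x (2 * r) := fun i =>
    closure_minimal (fun y hy => by_contra fun h => hy (hψ0 i y h)) Metric.isClosed_closedBall
  have hψs : ∀ i, HasCompactSupport (ψ i) := fun i =>
    (isCompact_closedBall _ _).of_isClosed_subset (isClosed_tsupport _) (hψt i)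
  have hd : ∀ i y, fderiv ℝ (ψ i) y (stdVec i) =
      -fderiv ℝ (fun z => z i * scaledKernel β r z) (x - y) (stdVec i) := by
    intro i y
    have h1 : HasFDerivAt (fun y : Rn n => x - y) (-ContinuousLinearMap.id ℝ (Rn n)) y :=
      (hasFDerivAt_id y).const_sub x
    have h2 := (((hθ i).differentiable one_ne_zero) (x - y)).hasFDerivAt.comp y h1
    change fderiv ℝ ((fun z => z i * scaledKernel β r z) ∘ fun y => x - y) y (stdVec i) = _
    rw [h2.fderiv]
    simp
  have hint : ∀ i, Integrable fun y => Q y * fderiv ℝ (ψ i) y (stdVec i) := fun i =>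
    integrable_mul_of_locallyIntegrableOn (h₁ i).locallyIntegrableOn
      (((hψc i).continuous_fderiv one_ne_zero).clm_apply continuous_const)
      ((hψs i).fderiv_apply (𝕜 := ℝ) (stdVec i))
      ((tsupport_fderiv_apply_subset ℝ (stdVec i)).trans ((hψt i).trans hx))
  have h2 : ∀ y, Q y * scaledKernelDiv β r (x - y) =
      -∑ i, Q y * fderiv ℝ (ψ i) y (stdVec i) := by
    intro y
    rw [scaledKernelDiv_eq_sum hβ, Finset.mul_sum, ← Finset.sum_neg_distrib]
    refine Finset.sum_congr rfl fun i _ => ?_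
    rw [hd]; ring
  simp only [h2]
  rw [integral_neg, integral_finsetSum _ fun i _ => hint i, ← Finset.sum_neg_distrib]
  refine Finset.sum_congr rfl fun i _ => ?_
  rw [(h₁ i).integral_contDiff_one (hψc i) (hψs i) ((hψt i).trans hx), neg_neg]

/-- Hölder's inequality on the ball. For `p = ∞` the conventions `toReal ⊤ = 0` and `1 / 0 = 0` give
the correct exponent 1. -/
theorem exists_setIntegral_closedBall_le {p : ℝ≥0∞} (hp : 1 ≤ p) {f : Rn n → ℝ}
    (hf : MemLp f p (volume.restrict (Ω : Set (Rn n)))) :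
    ∃ K : ℝ, 0 ≤ K ∧ ∀ (x : Rn n) (r : ℝ), 0 < r → Metric.closedBall x r ⊆ Ω →
      IntegrableOn f (Metric.closedBall x r) ∧
      ∫ y in Metric.closedBall x r, |f y| ≤ K * (r ^ n) ^ (1 - 1 / p.toReal) := by
  set ω := (volume (Metric.ball (0 : Rn n) 1)).toReal with hω
  set θ := 1 - 1 / p.toReal with hθ
  have hθ0 : 0 ≤ θ := by
    rw [hθ, sub_nonneg]
    rcases eq_or_ne p ⊤ with rfl | hpt
    · simp
    · have : 1 ≤ p.toReal := by
        have := (ENNReal.toReal_le_toReal ENNReal.one_ne_top hpt).2 hp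
        simpa using this
      exact div_le_one_of_le₀ this (by linarith)
  set N := eLpNorm f p (volume.restrict (Ω : Set (Rn n))) with hN
  refine ⟨N.toReal * ω ^ θ, by positivity, fun x r hr hx => ?_⟩
  have hfB : MemLp f p (volume.restrict (Metric.closedBall x r)) :=
    hf.mono_measure (Measure.restrict_mono hx le_rfl)
  have hfin : IsFiniteMeasure (volume.restrict (Metric.closedBall x r)) :=
    ⟨by rw [Measure.restrict_apply_univ]; exact (isCompact_closedBall x r).measure_lt_top⟩
  have hfi : Integrable f (volume.restrict (Metric.closedBall x r)) := hfB.integrable hp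
  refine ⟨hfi, ?_⟩
  have h1 := eLpNorm_le_eLpNorm_mul_rpow_measure_univ hp hfB.aestronglyMeasurable
  have h2 : eLpNorm f p (volume.restrict (Metric.closedBall x r)) ≤ N :=
    eLpNorm_mono_measure f (Measure.restrict_mono hx le_rfl)
  have h3 : ∫ y in Metric.closedBall x r, |f y| =
      (eLpNorm f 1 (volume.restrict (Metric.closedBall x r))).toReal := by
    rw [eLpNorm_one_eq_lintegral_enorm]
    exact integral_norm_eq_lintegral_enorm hfi.aestronglyMeasurable
  have hvol : volume (Metric.closedBall x r) = ENNReal.ofReal (r ^ n * ω) := by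
    rw [Measure.addHaar_closedBall _ _ hr.le, ENNReal.ofReal_mul (by positivity), hω,
      ENNReal.ofReal_toReal (measure_ball_lt_top.ne)]
    simp
  rw [Measure.restrict_apply_univ, hvol, ENNReal.toReal_one, div_one, ← hθ,
    ENNReal.ofReal_rpow_of_nonneg (by positivity) hθ0] at h1
  rw [h3]
  have h4 : eLpNorm f 1 (volume.restrict (Metric.closedBall x r)) ≤
      N * ENNReal.ofReal ((r ^ n * ω) ^ θ) := h1.trans (by gcongr)
  refine (ENNReal.toReal_mono (ENNReal.mul_ne_top hf.2.ne ENNReal.ofReal_ne_top) h4).trans ?_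
  rw [ENNReal.toReal_mul, ENNReal.toReal_ofReal (by positivity),
    Real.mul_rpow (by positivity) (by positivity)]
  exact le_of_eq (by ring)

end WeakGradient

/-- A function on `(0, r₀)` whose derivative is `O(t ^ (-α))`, `α < 1`, is Hölder at `0`. -/
theorem abs_sub_le_of_hasDerivAt_rpow {u u' : ℝ → ℝ} {C α r₀ : ℝ} (hα : α < 1) (hC : 0 ≤ C)
    (hu : ∀ t ∈ Ioo 0 r₀, HasDerivAt u (u' t) t) (hu' : ∀ t ∈ Ioo 0 r₀, |u' t| ≤ C * t ^ (-α))
    {s r : ℝ} (hs : 0 < s) (hsr : s ≤ r) (hr : r < r₀) :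
    |u r - u s| ≤ C / (1 - α) * r ^ (1 - α) := by
  have hα' : 0 < 1 - α := by linarith
  -- A primitive of the bound: adding or subtracting `u` gives a monotone function.
  have hd : ∀ t ∈ Ioo 0 r₀,
      HasDerivAt (fun t : ℝ => C / (1 - α) * t ^ (1 - α)) (C * t ^ (-α)) t := by
    intro t ht
    refine ((Real.hasDerivAt_rpow_const (Or.inl ht.1.ne')).const_mul _).congr_deriv ?_
    rw [show 1 - α - 1 = -α by ring]
    field_simp
  have hmono : ∀ v v' : ℝ → ℝ, (∀ t ∈ Ioo 0 r₀, HasDerivAt v (v' t) t) →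
      (∀ t ∈ Ioo 0 r₀, 0 ≤ v' t) → v s ≤ v r := by
    intro v v' hv hv'
    refine monotoneOn_of_deriv_nonneg (convex_Ioo 0 r₀)
      (fun t ht => (hv t ht).continuousAt.continuousWithinAt) ?_ ?_ ⟨hs, hsr.trans_lt hr⟩
      ⟨hs.trans_le hsr, hr⟩ hsr
    · rw [interior_Ioo]
      exact fun t ht => (hv t ht).differentiableAt.differentiableWithinAt
    · rw [interior_Ioo]
      intro t ht
      rw [(hv t ht).deriv]
      exact hv' t ht
  have h1 := hmono _ _ (fun t ht => (hd t ht).sub (hu t ht)) fun t ht => by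
    linarith [(abs_le.1 (hu' t ht)).2]
  have h2 := hmono _ _ (fun t ht => (hd t ht).add (hu t ht)) fun t ht => by
    linarith [(abs_le.1 (hu' t ht)).1]
  simp only [Pi.sub_apply, Pi.add_apply] at h1 h2
  have h3 : 0 ≤ C / (1 - α) * s ^ (1 - α) := by positivity
  rw [abs_le]
  constructor <;> linarith

/-! ### Morrey's embedding -/

section Morrey

variable {n : ℕ} {Ω : TopologicalSpace.Opens (Rn n)} {Q : Rn n → ℝ} {Q₁ : Fin n → Rn n → ℝ}
  {β : Rn n → ℝ} {p : ℝ≥0∞}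

/-- The weight `z k_r(z)` is of order `r · r^(-n)` on a ball of radius `2r`, and Hölder contributes
`r^(n(1 - 1/p))`. The prefactor `r⁻¹` cancels one `r`, leaving `r^(-n/p)`, which is bounded for `p =
∞`. -/
theorem exists_abs_integral_mul_scaledKernelDiv_le (hp : 1 ≤ p)
    (hQ₁ : ∀ i, MemLp (Q₁ i) p (volume.restrict (Ω : Set (Rn n))))
    (h₁ : ∀ i, HasWeakPartialDeriv Ω i Q (Q₁ i))
    (hβ : ContDiff ℝ 1 β) (hs : tsupport β ⊆ Metric.closedBall 0 2) :
    ∃ C : ℝ, 0 ≤ C ∧ ∀ (x : Rn n) (r : ℝ), 0 < r → Metric.closedBall x (2 * r) ⊆ Ω →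
      |∫ y, Q y * (-r⁻¹ * scaledKernelDiv β r (x - y))| ≤ C * r ^ (-(n / p.toReal)) := by
  choose K hK0 hK using fun i => exists_setIntegral_closedBall_le hp (hQ₁ i)
  have hcβ : HasCompactSupport β :=
    (isCompact_closedBall _ _).of_isClosed_subset (isClosed_tsupport _) hs
  obtain ⟨C₀, hC₀⟩ := hcβ.exists_bound_of_continuous hβ.continuous
  have hC₀0 : 0 ≤ C₀ := (norm_nonneg _).trans (hC₀ 0)
  set θ := 1 - 1 / p.toReal with hθ
  have hKs : 0 ≤ ∑ i, K i := Finset.sum_nonneg fun i _ => hK0 i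
  refine ⟨2 * C₀ * (∑ i, K i) * ((2 : ℝ) ^ n) ^ θ, by positivity, fun x r hr hx => ?_⟩
  have hterm : ∀ i, |∫ y, Q₁ i y * ((x - y) i * scaledKernel β r (x - y))| ≤
      (2 * r * ((r ^ n)⁻¹ * C₀)) * (K i * ((2 * r) ^ n) ^ θ) := by
    intro i
    obtain ⟨hi, hle⟩ := hK i x (2 * r) (by positivity) hx
    have h0 : ∫ y, Q₁ i y * ((x - y) i * scaledKernel β r (x - y)) =
        ∫ y in Metric.closedBall x (2 * r), Q₁ i y * ((x - y) i * scaledKernel β r (x - y)) := by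
      refine (setIntegral_eq_integral_of_forall_compl_eq_zero fun y hy => ?_).symm
      rw [mem_closedBall_iff_norm, not_le, norm_sub_rev] at hy
      rw [scaledKernel_eq_zero hs hr hy, mul_zero, mul_zero]
    rw [h0]
    refine le_trans ?_ (mul_le_mul_of_nonneg_left hle (by positivity))
    rw [← integral_const_mul, ← Real.norm_eq_abs]
    have hi' : Integrable (fun y => |Q₁ i y|) (volume.restrict (Metric.closedBall x (2 * r))) :=
      Integrable.abs hi
    refine norm_integral_le_of_norm_le (hi'.const_mul _) ?_
    filter_upwards [ae_restrict_mem Metric.isClosed_closedBall.measurableSet] with y hy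
    rw [mem_closedBall_iff_norm, norm_sub_rev] at hy
    have hk : ‖scaledKernel β r (x - y)‖ ≤ (r ^ n)⁻¹ * C₀ := by
      rw [scaledKernel, norm_mul, norm_inv, norm_pow, Real.norm_of_nonneg hr.le]
      gcongr
      exact hC₀ _
    have hc : ‖(x - y) i‖ ≤ 2 * r := (PiLp.norm_apply_le (x - y) i).trans hy
    rw [norm_mul, norm_mul, mul_comm, Real.norm_eq_abs (Q₁ i y)]
    gcongr
  have h1 : ∫ y, Q y * (-r⁻¹ * scaledKernelDiv β r (x - y)) =
      -r⁻¹ * ∑ i, ∫ y, Q₁ i y * ((x - y) i * scaledKernel β r (x - y)) := by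
    rw [← integral_mul_scaledKernelDiv h₁ hβ hs hr hx, ← integral_const_mul]
    exact integral_congr_ae (Eventually.of_forall fun y => by ring)
  rw [h1, abs_mul, abs_neg, abs_inv, abs_of_pos hr]
  have h2 : |∑ i, ∫ y, Q₁ i y * ((x - y) i * scaledKernel β r (x - y))| ≤
      ∑ i, (2 * r * ((r ^ n)⁻¹ * C₀)) * (K i * ((2 * r) ^ n) ^ θ) :=
    (Finset.abs_sum_le_sum_abs _ _).trans (Finset.sum_le_sum fun i _ => hterm i)
  refine (mul_le_mul_of_nonneg_left h2 (by positivity)).trans (le_of_eq ?_)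
  rw [← Finset.mul_sum, ← Finset.sum_mul, mul_pow, Real.mul_rpow (by positivity) (by positivity)]
  have h3 : (r ^ n)⁻¹ * (r ^ n) ^ θ = r ^ (-(n / p.toReal)) := by
    rw [← Real.rpow_natCast, ← Real.rpow_neg hr.le, ← Real.rpow_mul hr.le, ← Real.rpow_add hr, hθ]
    congr 1
    ring
  rw [← h3]
  field_simp

/-- The averages of a function in `W^{1,p}`, `p > n`, converge at a uniform rate. -/
theorem exists_abs_kernelAverage_sub_le (hn : 1 ≤ n) (hp : (n : ℝ≥0∞) < p)
    (hQ : MemLp Q p (volume.restrict (Ω : Set (Rn n))))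
    (hQ₁ : ∀ i, MemLp (Q₁ i) p (volume.restrict (Ω : Set (Rn n))))
    (h₁ : ∀ i, HasWeakPartialDeriv Ω i Q (Q₁ i))
    (hβ : ContDiff ℝ 1 β) (hs : tsupport β ⊆ Metric.closedBall 0 2) :
    ∃ C γ : ℝ, 0 < γ ∧ ∀ (x : Rn n) (r₀ : ℝ), Metric.closedBall x (2 * r₀) ⊆ Ω →
      ∀ s r : ℝ, 0 < s → s ≤ r → r < r₀ →
        |kernelAverage β ((Ω : Set (Rn n)).indicator Q) r x -
          kernelAverage β ((Ω : Set (Rn n)).indicator Q) s x| ≤ C * r ^ γ := by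
  have hp1 : 1 ≤ p := le_trans (by exact_mod_cast hn) hp.le
  obtain ⟨C, hC, hb⟩ := exists_abs_integral_mul_scaledKernelDiv_le hp1 hQ₁ h₁ hβ hs
  have hα : n / p.toReal < 1 := by
    rcases eq_or_ne p ⊤ with rfl | hpt
    · simp
    · have h := (ENNReal.toReal_lt_toReal (ENNReal.natCast_ne_top n) hpt).2 hp
      rw [ENNReal.toReal_natCast] at h
      rwa [div_lt_one ((Nat.cast_nonneg n).trans_lt h)]
  refine ⟨C / (1 - n / p.toReal), 1 - n / p.toReal, by linarith,
    fun x r₀ hx s r hs0 hsr hr => ?_⟩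
  have hf : LocallyIntegrable ((Ω : Set (Rn n)).indicator Q) :=
    ((memLp_indicator_iff_restrict Ω.isOpen.measurableSet).2 hQ).locallyIntegrable hp1
  refine abs_sub_le_of_hasDerivAt_rpow (r₀ := r₀) hα hC
    (fun t ht => hasDerivAt_kernelAverage hβ hs hf ht.1 x) (fun t ht => ?_) hs0 hsr hr
  have hsub : Metric.closedBall x (2 * t) ⊆ (Ω : Set (Rn n)) :=
    (Metric.closedBall_subset_closedBall (by linarith [ht.2])).trans hx
  refine le_trans (le_of_eq ?_) (hb x t ht.1 hsub)
  congr 1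
  refine integral_congr_ae (Eventually.of_forall fun y => ?_)
  by_cases hy : y ∈ (Ω : Set (Rn n))
  · simp only [indicator_of_mem hy]
  · have : 2 * t < ‖x - y‖ := by
      by_contra! h
      exact hy (hsub (by rwa [mem_closedBall_iff_norm, norm_sub_rev]))
    simp only [scaledKernelDiv_eq_zero hs ht.1 this, mul_zero]

/-- Identifies the rescaled kernels with normalised bumps of fixed radius ratio 2, for which almost
everywhere convergence of the convolutions is available. -/
theorem scaledKernel_normed_contDiffBump {r : ℝ} (hr : 0 < r) (z : Rn n) :
    scaledKernel ((⟨1, 2, one_pos, one_lt_two⟩ : ContDiffBump (0 : Rn n)).normed volume) r z =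
      (⟨r, 2 * r, hr, by linarith⟩ : ContDiffBump (0 : Rn n)).normed volume z := by
  set φ : ContDiffBump (0 : Rn n) := ⟨1, 2, one_pos, one_lt_two⟩ with hφ
  set ψ : ContDiffBump (0 : Rn n) := ⟨r, 2 * r, hr, by linarith⟩ with hψ
  have h1 : ∀ z, ψ z = φ (r⁻¹ • z) := by
    intro z
    rw [ContDiffBump.apply, ContDiffBump.apply]
    simp only [hφ, hψ, sub_zero, inv_one, one_smul, div_one]
    rw [mul_div_assoc, div_self hr.ne', mul_one]
  have h2 : ∫ z, ψ z = r ^ n * ∫ z, φ z := by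
    simp only [h1]
    rw [Measure.integral_comp_inv_smul, abs_of_pos (by positivity)]
    simp
  rw [scaledKernel, ContDiffBump.normed_def, ContDiffBump.normed_def, h1, h2]
  field_simp

/-- Morrey's embedding: a weakly differentiable function in `W^{1,p}`, `p > n`, has a continuous
representative. -/
theorem exists_continuousOn_ae_eq (hn : 1 ≤ n) (hp : (n : ℝ≥0∞) < p)
    (hQ : MemLp Q p (volume.restrict (Ω : Set (Rn n))))
    (hQ₁ : ∀ i, MemLp (Q₁ i) p (volume.restrict (Ω : Set (Rn n))))
    (h₁ : ∀ i, HasWeakPartialDeriv Ω i Q (Q₁ i)) :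
    ∃ Qc : Rn n → ℝ, ContinuousOn Qc Ω ∧ Qc =ᵐ[volume.restrict (Ω : Set (Rn n))] Q := by
  have hp1 : 1 ≤ p := le_trans (by exact_mod_cast hn) hp.le
  set f : Rn n → ℝ := (Ω : Set (Rn n)).indicator Q with hf_def
  have hf : LocallyIntegrable f :=
    ((memLp_indicator_iff_restrict Ω.isOpen.measurableSet).2 hQ).locallyIntegrable hp1
  set φ : ContDiffBump (0 : Rn n) := ⟨1, 2, one_pos, one_lt_two⟩ with hφ
  set β : Rn n → ℝ := φ.normed volume with hβ_def
  have hβ : ContDiff ℝ 1 β := φ.contDiff_normed (n := 1)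
  have hs : tsupport β ⊆ Metric.closedBall 0 2 := (φ.tsupport_normed_eq).subset
  obtain ⟨C, γ, hγ, hC⟩ := exists_abs_kernelAverage_sub_le hn hp hQ hQ₁ h₁ hβ hs
  set ρ : ℕ → ℝ := fun k => 1 / ((k : ℝ) + 1) with hρ
  have hρ0 : ∀ k, 0 < ρ k := fun k => by positivity
  have hρa : ∀ {k l}, k ≤ l → ρ l ≤ ρ k := fun h => one_div_le_one_div_of_le (by positivity)
    (by exact_mod_cast Nat.succ_le_succ h)
  have hρt : Tendsto ρ atTop (𝓝 0) := tendsto_one_div_add_atTop_nhds_zero_nat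
  have hbt : Tendsto (fun k => C * ρ k ^ γ) atTop (𝓝 0) := by
    have := (hρt.rpow_const (Or.inr hγ.le)).const_mul C
    rwa [Real.zero_rpow hγ.ne', mul_zero] at this
  set v : ℕ → Rn n → ℝ := fun k x => kernelAverage β f (ρ k) x with hv
  set Qc : Rn n → ℝ := fun x => limUnder atTop fun k => v k x with hQc
  have hlim : ∀ (x : Rn n) (r₀ : ℝ), 0 < r₀ → Metric.closedBall x (2 * r₀) ⊆ Ω →
      Tendsto (fun k => v k x) atTop (𝓝 (Qc x)) := by
    intro x r₀ hr₀ hx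
    refine CauchySeq.tendsto_limUnder (Metric.cauchySeq_iff'.2 fun ε hε => ?_)
    obtain ⟨N, h1, h2⟩ := ((hbt.eventually (gt_mem_nhds hε)).and
      (hρt.eventually (gt_mem_nhds hr₀))).exists
    refine ⟨N, fun k hk => ?_⟩
    rw [dist_comm, Real.dist_eq]
    exact (hC x r₀ hx _ _ (hρ0 k) (hρa hk) h2).trans_lt h1
  -- Letting the smaller scale tend to 0 turns the Cauchy estimate into a rate independent of the
  -- point.
  have hrate : ∀ (x : Rn n) (r₀ : ℝ), 0 < r₀ → Metric.closedBall x (2 * r₀) ⊆ Ω →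
      ∀ k, ρ k < r₀ → |v k x - Qc x| ≤ C * ρ k ^ γ := by
    intro x r₀ hr₀ hx k hk
    refine le_of_tendsto ((tendsto_const_nhds.sub (hlim x r₀ hr₀ hx)).abs) ?_
    filter_upwards [eventually_ge_atTop k] with l hl
    exact hC x r₀ hx _ _ (hρ0 l) (hρa hl) hk
  refine ⟨Qc, ?_, ?_⟩
  · intro x hx
    obtain ⟨R, hR, hRΩ⟩ := Metric.isOpen_iff.1 Ω.isOpen x hx
    refine ContinuousAt.continuousWithinAt ?_
    -- All centres `y` in the half ball share the admissible radius `R / 8`, so the rate gives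
    -- uniform convergence and a continuous limit.
    have hsub : ∀ y ∈ Metric.ball x (R / 2), Metric.closedBall y (2 * (R / 8)) ⊆ (Ω : Set (Rn n)) :=
      fun y hy => (Metric.closedBall_subset_ball' (by
        rw [Metric.mem_ball] at hy; linarith)).trans hRΩ
    refine ContinuousOn.continuousAt (s := Metric.ball x (R / 2)) ?_
      (Metric.ball_mem_nhds x (by positivity))
    have hu : TendstoUniformlyOn v Qc atTop (Metric.ball x (R / 2)) := by
      refine Metric.tendstoUniformlyOn_iff.2 fun ε hε => ?_
      filter_upwards [hbt.eventually (gt_mem_nhds hε),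
        hρt.eventually (gt_mem_nhds (show (0 : ℝ) < R / 8 by positivity))] with k h1 h2 y hy
      rw [dist_comm, Real.dist_eq]
      exact (hrate y (R / 8) (by positivity) (hsub y hy) k h2).trans_lt h1
    exact hu.continuousOn (Frequently.of_forall fun k =>
      (continuous_kernelAverage hβ hs hf (hρ0 k)).continuousOn)
  -- By Lebesgue differentiation the same averages converge almost everywhere to `Q`, so the two
  -- limits agree on `Ω`.
  · have hae := ContDiffBump.ae_convolution_tendsto_right_of_locallyIntegrable (μ := volume)
      (φ := fun k => (⟨ρ k, 2 * ρ k, hρ0 k, by linarith [hρ0 k]⟩ : ContDiffBump (0 : Rn n)))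
      (l := atTop) (K := 2) (by simpa using hρt.const_mul 2) (Eventually.of_forall fun k => le_rfl)
      hf
    rw [EventuallyEq, ae_restrict_iff' Ω.isOpen.measurableSet]
    filter_upwards [hae] with x hx hxΩ
    obtain ⟨R, hR, hRΩ⟩ := Metric.isOpen_iff.1 Ω.isOpen x hxΩ
    have h2 := hlim x (R / 4) (by positivity)
      ((Metric.closedBall_subset_ball (by linarith)).trans hRΩ)
    have h3 : ∀ k, convolution
        ((⟨ρ k, 2 * ρ k, hρ0 k, by linarith [hρ0 k]⟩ : ContDiffBump (0 : Rn n)).normed volume) f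
        (ContinuousLinearMap.lsmul ℝ ℝ) volume x = v k x := by
      intro k
      rw [convolution_eq_swap]
      refine integral_congr_ae (Eventually.of_forall fun y => ?_)
      simp only [ContinuousLinearMap.lsmul_apply, smul_eq_mul]
      rw [← scaledKernel_normed_contDiffBump (hρ0 k), mul_comm]
    simp only [h3] at hx
    rw [tendsto_nhds_unique h2 hx, hf_def, indicator_of_mem hxΩ]

end Morrey

/-! ### Distributions given by densities -/

section DistOf

variable {n : ℕ} {U : TopologicalSpace.Opens (Rn n)} {μ : Measure (Rn n)}

theorem distOf_sum {ι : Type*} {s : Finset ι} {f : ι → Rn n → ℝ}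
    (hf : ∀ i ∈ s, LocallyIntegrableOn (f i) U μ) :
    ∑ i ∈ s, distOf U μ (f i) = distOf U μ fun x => ∑ i ∈ s, f i x := by
  have hsum : LocallyIntegrableOn (fun x => ∑ i ∈ s, f i x) U μ := by
    intro x hx
    choose! t ht hft using fun i (hi : i ∈ s) => hf i hi x hx
    refine ⟨⋂ i ∈ s, t i, (Filter.biInter_finset_mem s).2 ht, ?_⟩
    exact integrable_finsetSum s fun i hi => (hft i hi).mono_set (biInter_subset_of_mem hi)
  ext φ
  rw [sum_apply, distOf_apply hsum]
  simp only [Finset.mul_sum]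
  rw [integral_finsetSum]
  · exact Finset.sum_congr rfl fun i hi => distOf_apply (hf i hi) φ
  · intro i hi
    simp only [mul_comm (φ _)]
    exact integrable_mul_of_locallyIntegrableOn (hf i hi) φ.contDiff.continuous
      φ.hasCompactSupport φ.tsupport_subset

theorem distOf_congr {f g : Rn n → ℝ} (hf : LocallyIntegrableOn f U μ)
    (hg : LocallyIntegrableOn g U μ) (h : f =ᵐ[μ] g) : distOf U μ f = distOf U μ g := by
  ext φ
  rw [distOf_apply hf, distOf_apply hg]
  refine integral_congr_ae ?_
  filter_upwards [h] with x hx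
  rw [hx]

/-- The two signs cancel and the order of differentiation is reversed on the test function. -/
theorem partialDeriv_partialDeriv_distOf_apply {f : Rn n → ℝ} (hf : LocallyIntegrableOn f U volume)
    (i j : Fin n) (φ : 𝓓(U, ℝ)) :
    (∂_{stdVec i} (∂_{stdVec j} (distOf U volume f))) φ =
      ∫ x, f x * partialDeriv j (partialDeriv i φ) x := by
  rw [Distribution.lineDerivOp_apply_apply, map_neg, Distribution.lineDerivOp_apply_apply, map_neg,
    neg_neg, distOf_apply hf]
  have h1 : ⇑(∂_{stdVec i} φ : 𝓓(U, ℝ)) = partialDeriv i φ :=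
    funext fun x => lineDeriv_testFunction_apply φ (stdVec i) x
  refine integral_congr_ae (Eventually.of_forall fun x => ?_)
  simp only [lineDeriv_testFunction_apply, h1]
  rw [mul_comm]
  rfl

end DistOf

/-! ### Bounded coefficients preserve `L^p` -/

section Coefficients

variable {n : ℕ} {T K : Set (Rn n)} {p : ℝ≥0∞} {f c : Rn n → ℝ}

theorem memLp_mul_of_continuousOn (hf : MemLp f p (volume.restrict T)) (hT : MeasurableSet T)
    (hK : IsCompact K) (hTK : T ⊆ K) (hc : ContinuousOn c K) :
    MemLp (fun x => f x * c x) p (volume.restrict T) := by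
  obtain ⟨C, hC⟩ := hK.exists_bound_of_continuousOn hc
  refine hf.of_le_mul (c := C)
    (hf.aestronglyMeasurable.mul ((hc.mono hTK).aestronglyMeasurable hT)) ?_
  filter_upwards [ae_restrict_mem hT] with x hx
  rw [norm_mul, mul_comm]
  exact mul_le_mul_of_nonneg_right (hC x (hTK hx)) (norm_nonneg _)

/-- Serves to make the sign measurable. -/
theorem monotone_real_sign : Monotone Real.sign := by
  intro a b hab
  rcases lt_trichotomy a 0 with ha | rfl | ha
  · rw [Real.sign_of_neg ha]
    rcases Real.sign_apply_eq b with h | h | h <;> rw [h] <;> norm_num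
  · rcases hab.eq_or_lt with rfl | hb
    · rfl
    · rw [Real.sign_zero, Real.sign_of_pos hb]; norm_num
  · rw [Real.sign_of_pos ha, Real.sign_of_pos (ha.trans_le hab)]

theorem memLp_mul_sign (hf : MemLp f p (volume.restrict T)) (hT : MeasurableSet T)
    (hc : ContinuousOn c T) : MemLp (fun x => f x * Real.sign (c x)) p (volume.restrict T) := by
  have hm : AEMeasurable (fun x => Real.sign (c x)) (volume.restrict T) :=
    monotone_real_sign.measurable.comp_aemeasurable (hc.aemeasurable hT)
  refine hf.of_le (hf.aestronglyMeasurable.mul hm.aestronglyMeasurable)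
    (Eventually.of_forall fun x => ?_)
  rw [norm_mul]
  refine mul_le_of_le_one_right (norm_nonneg _) ?_
  rcases Real.sign_apply_eq (c x) with h | h | h <;> rw [h] <;> norm_num

theorem locallyIntegrableOn_of_memLp_restrict (hf : MemLp f p (volume.restrict T)) (hp : 1 ≤ p) :
    LocallyIntegrableOn f T volume :=
  locallyIntegrableOn_of_locallyIntegrable_restrict (hf.locallyIntegrable hp)

end Coefficients

/-! ### The tube, its compactness, and surface integrability -/

section SignedDist

variable {n : ℕ} {D : Set (Rn n)}

theorem gradient_apply (d : Rn n → ℝ) (x : Rn n) (i : Fin n) : ∇ d x i = partialDeriv i d x := by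
  rw [partialDeriv, ← inner_gradient_eq_fderiv, stdVec, EuclideanSpace.inner_single_right]
  simp

theorem sum_partialDeriv_mul_self {d : Rn n → ℝ} {x : Rn n} (h : ‖∇ d x‖ = 1) :
    ∑ i, partialDeriv i d x * partialDeriv i d x = 1 := by
  have := EuclideanSpace.norm_sq_eq (∇ d x)
  rw [h] at this
  simp only [gradient_apply, Real.norm_eq_abs, sq_abs] at this
  simp only [← sq, ← this, one_pow]

/-- The tube also handles an empty boundary: there `infDist` is 0 by convention, so the signed
distance vanishes everywhere, but the tube is empty. -/
theorem setOf_signedDist_eq_zero_inter_tube {ε : ℝ} (hε : 0 < ε) :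
    {x | signedDist D x = 0} ∩ (tube ε (frontier D) : Set (Rn n)) = frontier D := by
  have htube : (tube ε (frontier D) : Set (Rn n)) = Metric.thickening ε (frontier D) := rfl
  ext x
  rw [htube, mem_inter_iff, mem_ofPred_eq, ← abs_eq_zero, abs_signedDist]
  constructor
  · rintro ⟨h0, hx⟩
    obtain ⟨z, hz, -⟩ := Metric.mem_thickening_iff.1 hx
    rw [← isClosed_frontier.mem_iff_infDist_zero ⟨z, hz⟩] at h0
    exact h0
  · intro hx
    exact ⟨Metric.infDist_zero_of_mem hx, Metric.self_subset_thickening hε _ hx⟩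

/-- A compact tubular neighbourhood of the boundary on which the signed distance is `C²`. -/
theorem IsC2Domain.exists_cthickening_contDiffOn_signedDist {Ω : TopologicalSpace.Opens (Rn n)}
    (hD : IsC2Domain D) (hsub : CompactlyContained D Ω) :
    ∃ (W : Set (Rn n)) (ε₀ : ℝ), 0 < ε₀ ∧ IsOpen W ∧ ContDiffOn ℝ 2 (signedDist D) W ∧
      (∀ x ∈ W, ‖∇ (signedDist D) x‖ = 1) ∧ W ⊆ Ω ∧ IsCompact (Metric.cthickening ε₀ (frontier D)) ∧
      Metric.cthickening ε₀ (frontier D) ⊆ W := by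
  obtain ⟨W, hW, hDW, hd, hg⟩ := hD.exists_isOpen_contDiffOn_signedDist
  have hc : IsCompact (frontier D) :=
    hsub.1.of_isClosed_subset isClosed_frontier frontier_subset_closure
  obtain ⟨ε₀, hε₀, h⟩ := hc.exists_cthickening_subset_open (hW.inter Ω.isOpen)
    (subset_inter hDW (frontier_subset_closure.trans hsub.2))
  exact ⟨W ∩ Ω, ε₀, hε₀, hW.inter Ω.isOpen, hd.mono inter_subset_left, fun x hx => hg x hx.1,
    inter_subset_right, hc.cthickening, h⟩

/-- The boundary is a compact part of the zero level set of `d`, so it has finite area, and a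
continuous function is bounded on it. -/
theorem integrable_surfaceMeasure {m : ℕ} {D W : Set (Rn (m + 1))} (hc : IsCompact (frontier D))
    (hW : IsOpen W) (hDW : frontier D ⊆ W) (hd : ContDiffOn ℝ 2 (signedDist D) W)
    (hg : ∀ x ∈ W, ‖∇ (signedDist D) x‖ = 1) {f : Rn (m + 1) → ℝ}
    (hf : ContinuousOn f (frontier D)) : Integrable f (surfaceMeasure D) := by
  have hfin := euclideanHausdorffMeasure_levelSet_inter_lt_top (m := m) (by simp) hW
    (hd.of_le (by norm_num)) hg hc hDW
  have hsub : frontier D ⊆ {x | signedDist D x = 0} ∩ frontier D := fun x hx => by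
    refine ⟨?_, hx⟩
    rw [mem_ofPred_eq, ← abs_eq_zero, abs_signedDist]
    exact Metric.infDist_zero_of_mem hx
  obtain ⟨C, hC⟩ := hc.exists_bound_of_continuousOn hf
  have hm : MeasurableSet (frontier D) := isClosed_frontier.measurableSet
  refine IntegrableOn.of_bound ((measure_mono hsub).trans_lt hfin)
    (hf.aestronglyMeasurable hm) C ?_
  filter_upwards [ae_restrict_mem hm] with x hx
  exact hC x hx

end SignedDist

/-! ### The regular part `g` -/

section Remainder

variable {n : ℕ}

/-- The regular part of the Hessian of `Q / 2 * |d|`. -/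
noncomputable def hessianRemainder (d Q : Rn n → ℝ) (Q₁ : Fin n → Rn n → ℝ)
    (Q₂ : Fin n → Fin n → Rn n → ℝ) (x : Rn n) : Matrix (Fin n) (Fin n) ℝ :=
  Matrix.of fun i j => 2⁻¹ * (Q₂ i j x * |d x| + Q₁ j x * Real.sign (d x) * partialDeriv i d x +
    Q₁ i x * Real.sign (d x) * partialDeriv j d x +
    Q x * Real.sign (d x) * partialDeriv i (partialDeriv j d) x)

variable {Ω T : TopologicalSpace.Opens (Rn n)} {K W : Set (Rn n)} {d Q : Rn n → ℝ}
  {Q₁ : Fin n → Rn n → ℝ} {Q₂ : Fin n → Fin n → Rn n → ℝ} {p : ℝ≥0∞}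

theorem memLp_hessianRemainder (hQ : MemLp Q p (volume.restrict (T : Set (Rn n))))
    (hQ₁ : ∀ i, MemLp (Q₁ i) p (volume.restrict (T : Set (Rn n))))
    (hQ₂ : ∀ i j, MemLp (Q₂ i j) p (volume.restrict (T : Set (Rn n))))
    (hW : IsOpen W) (hd : ContDiffOn ℝ 2 d W) (hK : IsCompact K) (hTK : (T : Set (Rn n)) ⊆ K)
    (hKW : K ⊆ W) (i j : Fin n) :
    MemLp (fun x => Q₂ i j x * |d x|) p (volume.restrict (T : Set (Rn n))) ∧
    MemLp (fun x => Q₁ j x * Real.sign (d x) * partialDeriv i d x) p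
      (volume.restrict (T : Set (Rn n))) ∧
    MemLp (fun x => Q₁ i x * Real.sign (d x) * partialDeriv j d x) p
      (volume.restrict (T : Set (Rn n))) ∧
    MemLp (fun x => Q x * Real.sign (d x) * partialDeriv i (partialDeriv j d) x) p
      (volume.restrict (T : Set (Rn n))) ∧
    MemLp (fun x => hessianRemainder d Q Q₁ Q₂ x i j) p (volume.restrict (T : Set (Rn n))) := by
  have hT : MeasurableSet (T : Set (Rn n)) := T.isOpen.measurableSet
  have hd1 : ContDiffOn ℝ 1 d W := hd.of_le (by norm_num)
  have hdT : ContinuousOn d T := hd.continuousOn.mono (hTK.trans hKW)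
  have c1 : ∀ i, ContinuousOn (partialDeriv i d) K := fun i =>
    (continuousOn_partialDeriv hW hd1 i).mono hKW
  have c2 : ContinuousOn (partialDeriv i (partialDeriv j d)) K :=
    (continuousOn_partialDeriv hW (contDiffOn_partialDeriv hW hd j) i).mono hKW
  have m1 := memLp_mul_of_continuousOn (hQ₂ i j) hT hK hTK (hd.continuousOn.mono hKW).abs
  have m2 := memLp_mul_of_continuousOn (memLp_mul_sign (hQ₁ j) hT hdT) hT hK hTK (c1 i)
  have m3 := memLp_mul_of_continuousOn (memLp_mul_sign (hQ₁ i) hT hdT) hT hK hTK (c1 j)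
  have m4 := memLp_mul_of_continuousOn (memLp_mul_sign hQ hT hdT) hT hK hTK c2
  exact ⟨m1, m2, m3, m4, (((m1.add m2).add m3).add m4).const_mul 2⁻¹⟩

end Remainder

/-! ### The Hessian identity as distributions -/

section Hessian

variable {m : ℕ} {Ω : TopologicalSpace.Opens (Rn (m + 1))} {D W : Set (Rn (m + 1))}
  {Q Qc : Rn (m + 1) → ℝ} {Q₁ : Fin (m + 1) → Rn (m + 1) → ℝ}
  {Q₂ : Fin (m + 1) → Fin (m + 1) → Rn (m + 1) → ℝ} {p : ℝ≥0∞} {ε ε₀ : ℝ}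

/-- The distributional Hessian of `Q / 2 * |d|`. -/
theorem partialDeriv_partialDeriv_distOf_mul_abs_signedDist (hp : 1 ≤ p)
    (hQ : MemLp Q p (volume.restrict (Ω : Set (Rn (m + 1)))))
    (hQ₁ : ∀ i, MemLp (Q₁ i) p (volume.restrict (Ω : Set (Rn (m + 1)))))
    (hQ₂ : ∀ i j, MemLp (Q₂ i j) p (volume.restrict (Ω : Set (Rn (m + 1)))))
    (h₁ : ∀ i, HasWeakPartialDeriv Ω i Q (Q₁ i))
    (h₂ : ∀ i j, HasWeakPartialDeriv Ω i (Q₁ j) (Q₂ i j))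
    (hQc : ContinuousOn Qc Ω) (hQQ : Qc =ᵐ[volume.restrict (Ω : Set (Rn (m + 1)))] Q)
    (hW : IsOpen W) (hd : ContDiffOn ℝ 2 (signedDist D) W)
    (hg : ∀ x ∈ W, ‖∇ (signedDist D) x‖ = 1) (hWΩ : W ⊆ Ω) (hε : 0 < ε) (hεε : ε ≤ ε₀)
    (hK : IsCompact (Metric.cthickening ε₀ (frontier D)))
    (hKW : Metric.cthickening ε₀ (frontier D) ⊆ W) (i j : Fin (m + 1))
    (hI : Integrable (fun x => Qc x * partialDeriv i (signedDist D) x *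
      partialDeriv j (signedDist D) x) (surfaceMeasure D)) :
    ∂_{stdVec i} (∂_{stdVec j} (distOf (tube ε (frontier D)) volume
        (fun x => Q x / 2 * |signedDist D x|))) =
      distOf (tube ε (frontier D)) (surfaceMeasure D) (fun x =>
        Qc x * partialDeriv i (signedDist D) x * partialDeriv j (signedDist D) x) +
      distOf (tube ε (frontier D)) volume
        (fun x => hessianRemainder (signedDist D) Q Q₁ Q₂ x i j) := by
  set d := signedDist D with hd_def
  set T := tube ε (frontier D) with hT
  have hTK : (T : Set (Rn (m + 1))) ⊆ Metric.cthickening ε₀ (frontier D) :=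
    (Metric.thickening_subset_cthickening _ _).trans (Metric.cthickening_mono hεε _)
  have hTW : (T : Set (Rn (m + 1))) ⊆ W := hTK.trans hKW
  have hTΩ : (T : Set (Rn (m + 1))) ⊆ Ω := hTW.trans hWΩ
  have hmono : volume.restrict (T : Set (Rn (m + 1))) ≤ volume.restrict (Ω : Set (Rn (m + 1))) :=
    Measure.restrict_mono hTΩ le_rfl
  obtain ⟨m1, m2, m3, m4, m5⟩ := memLp_hessianRemainder (hQ.mono_measure hmono)
    (fun i => (hQ₁ i).mono_measure hmono) (fun i j => (hQ₂ i j).mono_measure hmono) hW hd hK hTK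
    hKW i j
  have m0 : MemLp (fun x => Q x / 2 * |d x|) p (volume.restrict (T : Set (Rn (m + 1)))) := by
    have := (memLp_mul_of_continuousOn (hQ.mono_measure hmono) T.isOpen.measurableSet hK hTK
      (hd.continuousOn.mono hKW).abs).const_mul 2⁻¹
    refine this.ae_eq (Eventually.of_forall fun x => ?_)
    simp only
    ring
  ext φ
  have hφ : ContDiff ℝ 2 φ := mod_cast contDiff_infty.1 φ.contDiff 2
  have hint : ∀ {f : Rn (m + 1) → ℝ}, MemLp f p (volume.restrict (T : Set (Rn (m + 1)))) →
      Integrable fun x => f x * φ x := fun hf =>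
    integrable_mul_of_locallyIntegrableOn (locallyIntegrableOn_of_memLp_restrict hf hp)
      φ.contDiff.continuous φ.hasCompactSupport φ.tsupport_subset
  -- The tube itself is taken as the open set of regularity, so that the zero set of `d` inside it
  -- is exactly the boundary.
  have key := integral_abs_mul_second_partialDeriv h₁ h₂ hQc hQQ T.isOpen (hd.mono hTW)
    (fun x hx => hg x (hTW hx)) hφ φ.hasCompactSupport (φ.tsupport_subset.trans hTΩ)
    φ.tsupport_subset i j
  rw [hd_def, setOf_signedDist_eq_zero_inter_tube hε, ← hd_def] at key
  rw [add_apply, partialDeriv_partialDeriv_distOf_apply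
    (locallyIntegrableOn_of_memLp_restrict m0 hp), distOf_apply (hI.locallyIntegrable.locallyIntegrableOn _),
    distOf_apply (locallyIntegrableOn_of_memLp_restrict m5 hp)]
  have e0 : ∫ x, Q x / 2 * |d x| * partialDeriv j (partialDeriv i φ) x =
      2⁻¹ * ∫ x, Q x * (|d x| * partialDeriv j (partialDeriv i φ) x) := by
    rw [← integral_const_mul]
    exact integral_congr_ae (Eventually.of_forall fun x => by simp only; ring)
  have e1 : ∫ x, φ x * hessianRemainder d Q Q₁ Q₂ x i j =
      2⁻¹ * ((∫ x, Q₂ i j x * |d x| * φ x) +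
        (∫ x, Q₁ j x * Real.sign (d x) * partialDeriv i d x * φ x) +
        (∫ x, Q₁ i x * Real.sign (d x) * partialDeriv j d x * φ x) +
        ∫ x, Q x * Real.sign (d x) * partialDeriv i (partialDeriv j d) x * φ x) := by
    have i12 := (hint m1).add (hint m2)
    have i123 := i12.add (hint m3)
    rw [← integral_add (hint m1) (hint m2)]
    change _ = 2⁻¹ * ((∫ x, ((fun x => Q₂ i j x * |d x| * φ x) +
      fun x => Q₁ j x * Real.sign (d x) * partialDeriv i d x * φ x) x) + _ + _)
    rw [← integral_add i12 (hint m3)]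
    change _ = 2⁻¹ * ((∫ x, (((fun x => Q₂ i j x * |d x| * φ x) +
      fun x => Q₁ j x * Real.sign (d x) * partialDeriv i d x * φ x) +
      fun x => Q₁ i x * Real.sign (d x) * partialDeriv j d x * φ x) x) + _)
    rw [← integral_add i123 (hint m4), ← integral_const_mul]
    exact integral_congr_ae (Eventually.of_forall fun x => by
      simp only [hessianRemainder, Matrix.of_apply, Pi.add_apply]; ring)
  have e2 : ∫ x, φ x * (Qc x * partialDeriv i d x * partialDeriv j d x) ∂surfaceMeasure D =
      ∫ x in frontier D, Qc x * (partialDeriv i d x * partialDeriv j d x * φ x)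
        ∂(Measure.euclideanHausdorffMeasure m) :=
    integral_congr_ae (Eventually.of_forall fun x => by simp only; ring)
  rw [e0, e1, e2, key]
  simp only [mul_assoc]
  ring

end Hessian

end SignedDistance

/-! ### The main theorem -/

theorem mainTheorem9 (n : ℕ) (hn : 2 ≤ n)
    (Ω : TopologicalSpace.Opens (Rn n)) (Ω' : Set (Rn n))
    (hC2 : IsC2Domain Ω') (hsub : CompactlyContained Ω' Ω) :
    ∃ ε₀ > (0 : ℝ), ∀ ε : ℝ, 0 < ε → ε < ε₀ →
      CompactlyContained (tube ε (frontier Ω') : Set (Rn n)) Ω ∧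
      ∀ (p : ℝ≥0∞), (n : ℝ≥0∞) < p → ∀ Q : Rn n → ℝ, MemW2 Ω p Q →
        -- the continuous representative `Qc` of `Q`
        ∃ Qc : Rn n → ℝ, ContinuousOn Qc Ω ∧ Qc =ᵐ[volume.restrict (Ω : Set (Rn n))] Q ∧
          Integrable Qc (surfaceMeasure Ω') ∧
          (∀ i j : Fin n, Integrable
            (fun x => Qc x * outerUnitNormal Ω' x i * outerUnitNormal Ω' x j)
            (surfaceMeasure Ω')) ∧
          ∃ g : Rn n → Matrix (Fin n) (Fin n) ℝ,
            (∀ i j, MemLp (fun x => g x i j) p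
              (volume.restrict (tube ε (frontier Ω') : Set (Rn n)))) ∧
            (∀ i j,
              ∂_{stdVec i} (∂_{stdVec j}
                  (distOf (tube ε (frontier Ω')) volume
                    (fun x => Q x / 2 * |signedDist Ω' x|)))
                = distOf (tube ε (frontier Ω')) (surfaceMeasure Ω')
                    (fun x => Qc x * outerUnitNormal Ω' x i * outerUnitNormal Ω' x j)
                  + distOf (tube ε (frontier Ω')) volume (fun x => g x i j)) ∧
            -distLaplacian (distOf (tube ε (frontier Ω')) volume
                (fun x => Q x / 2 * |signedDist Ω' x|))
              = -distOf (tube ε (frontier Ω')) (surfaceMeasure Ω') Qc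
                - distOf (tube ε (frontier Ω')) volume (fun x => (g x).trace) := by
  -- With `n = m + 1` the dimension `n - 1` of the surface measure reduces to `m`.
  obtain ⟨m, rfl⟩ : ∃ m, n = m + 1 := ⟨n - 1, by omega⟩
  -- `ε₀` is fixed before `p` and `Q` appear. The closed `ε₀`-neighbourhood is compact inside `W`,
  -- which bounds the derivatives of `d` on every smaller tube.
  obtain ⟨W, ε₀, hε₀, hW, hd, hg, hWΩ, hK, hKW⟩ :=
    hC2.exists_cthickening_contDiffOn_signedDist hsub
  refine ⟨ε₀, hε₀, fun ε hε hεε => ?_⟩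
  have hcl : closure (tube ε (frontier Ω') : Set (Rn (m + 1))) ⊆
      Metric.cthickening ε₀ (frontier Ω') :=
    (Metric.closure_thickening_subset_cthickening _ _).trans (Metric.cthickening_mono hεε.le _)
  refine ⟨⟨hK.of_isClosed_subset isClosed_closure hcl, hcl.trans (hKW.trans hWΩ)⟩, ?_⟩
  rintro p hp Q ⟨hQ, Q₁, Q₂, hQ₁, hQ₂⟩
  have hp1 : 1 ≤ p := le_trans (by exact_mod_cast Nat.le_add_left 1 m) hp.le
  obtain ⟨Qc, hQc, hQQ⟩ := exists_continuousOn_ae_eq (by omega) hp hQ (fun i => (hQ₁ i).1)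
    fun i => (hQ₁ i).2
  have hΓ : IsCompact (frontier Ω') :=
    hsub.1.of_isClosed_subset isClosed_frontier frontier_subset_closure
  have hΓW : frontier Ω' ⊆ W := (Metric.self_subset_cthickening _).trans hKW
  have hν : ∀ x ∈ frontier Ω', ∀ i,
      outerUnitNormal Ω' x i = partialDeriv i (SignedDistance.signedDist Ω') x := fun x hx i => by
    rw [outerUnitNormal_eq_gradient_signedDist hC2.isOpen hW hd hg hx (hΓW hx), gradient_apply]
  have hc : ∀ i, ContinuousOn (partialDeriv i (SignedDistance.signedDist Ω')) (frontier Ω') :=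
    fun i => (continuousOn_partialDeriv hW (hd.of_le (by norm_num)) i).mono hΓW
  have hQΓ : ContinuousOn Qc (frontier Ω') := hQc.mono (hΓW.trans hWΩ)
  have hI : Integrable Qc (surfaceMeasure Ω') := integrable_surfaceMeasure hΓ hW hΓW hd hg hQΓ
  have hIν : ∀ i j, Integrable (fun x => Qc x * partialDeriv i (SignedDistance.signedDist Ω') x *
      partialDeriv j (SignedDistance.signedDist Ω') x) (surfaceMeasure Ω') := fun i j =>
    integrable_surfaceMeasure hΓ hW hΓW hd hg ((hQΓ.mul (hc i)).mul (hc j))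
  have hmem : ∀ᵐ x ∂surfaceMeasure Ω', x ∈ frontier Ω' :=
    ae_restrict_mem isClosed_frontier.measurableSet
  have hae : ∀ i j, (fun x => Qc x * partialDeriv i (SignedDistance.signedDist Ω') x *
      partialDeriv j (SignedDistance.signedDist Ω') x) =ᵐ[surfaceMeasure Ω']
      fun x => Qc x * outerUnitNormal Ω' x i * outerUnitNormal Ω' x j := fun i j => by
    filter_upwards [hmem] with x hx
    rw [hν x hx, hν x hx]
  have hIν' : ∀ i j, Integrable (fun x => Qc x * outerUnitNormal Ω' x i * outerUnitNormal Ω' x j)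
      (surfaceMeasure Ω') := fun i j => (hIν i j).congr (hae i j)
  have hTΩ : (tube ε (frontier Ω') : Set (Rn (m + 1))) ⊆ Ω :=
    subset_closure.trans (hcl.trans (hKW.trans hWΩ))
  have hmono : volume.restrict (tube ε (frontier Ω') : Set (Rn (m + 1))) ≤
      volume.restrict (Ω : Set (Rn (m + 1))) := Measure.restrict_mono hTΩ le_rfl
  have hgp : ∀ i j, MemLp (fun x => hessianRemainder (SignedDistance.signedDist Ω') Q Q₁ Q₂ x i j) p
      (volume.restrict (tube ε (frontier Ω') : Set (Rn (m + 1)))) := fun i j =>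
    (memLp_hessianRemainder (hQ.mono_measure hmono) (fun i => (hQ₁ i).1.mono_measure hmono)
      (fun i j => (hQ₂ i j).1.mono_measure hmono) hW hd hK (subset_closure.trans hcl) hKW i
      j).2.2.2.2
  have hloc : ∀ {f : Rn (m + 1) → ℝ}, Integrable f (surfaceMeasure Ω') →
      LocallyIntegrableOn f (tube ε (frontier Ω')) (surfaceMeasure Ω') := fun hf =>
    hf.locallyIntegrable.locallyIntegrableOn _
  have hess : ∀ i j, ∂_{stdVec i} (∂_{stdVec j} (distOf (tube ε (frontier Ω')) volume
        (fun x => Q x / 2 * |SignedDistance.signedDist Ω' x|))) =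
      distOf (tube ε (frontier Ω')) (surfaceMeasure Ω')
        (fun x => Qc x * outerUnitNormal Ω' x i * outerUnitNormal Ω' x j) +
      distOf (tube ε (frontier Ω')) volume
        (fun x => hessianRemainder (SignedDistance.signedDist Ω') Q Q₁ Q₂ x i j) := fun i j => by
    rw [partialDeriv_partialDeriv_distOf_mul_abs_signedDist hp1 hQ (fun i => (hQ₁ i).1)
      (fun i j => (hQ₂ i j).1) (fun i => (hQ₁ i).2) (fun i j => (hQ₂ i j).2) hQc hQQ hW hd hg hWΩ hε
      hεε.le hK hKW i j (hIν i j), distOf_congr (hloc (hIν i j)) (hloc (hIν' i j)) (hae i j)]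
  refine ⟨Qc, hQc, hQQ, hI, hIν', _, hgp, hess, ?_⟩
  -- The diagonal surface terms add up to `Qc |ν|² = Qc` almost everywhere for the surface measure.
  have hsum : ∑ i, distOf (tube ε (frontier Ω')) (surfaceMeasure Ω')
      (fun x => Qc x * outerUnitNormal Ω' x i * outerUnitNormal Ω' x i) =
      distOf (tube ε (frontier Ω')) (surfaceMeasure Ω') Qc := by
    rw [distOf_sum fun i _ => hloc (hIν' i i)]
    refine distOf_congr (hloc (integrable_finsetSum _ fun i _ => hIν' i i)) (hloc hI) ?_
    filter_upwards [hmem] with x hx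
    simp only [hν x hx, mul_assoc, ← Finset.mul_sum]
    rw [sum_partialDeriv_mul_self (hg x (hΓW hx)), mul_one]
  rw [distLaplacian, Finset.sum_congr rfl fun i _ => hess i i, Finset.sum_add_distrib, hsum,
    distOf_sum fun i _ => locallyIntegrableOn_of_memLp_restrict (hgp i i) hp1, neg_add,
    ← sub_eq_add_neg]
  rfl
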